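/- Let $q$ be a prime power, $n$ a non-negative integer, and let $Y$ be a subgroup of the centre of $SL_n(q)$ with $1<|Y|_2<|(n,q-1)|_2$, where $|k|_2$ denotes the largest power of $2$ dividing $k$ and $(n,q-1)$ is the greatest common divisor. Call an element $g$ of a group $G$ *real* if $hgh^{-1}=g^{-1}$ for some $h\in G$, and *strongly real* if $h$ can moreover be chosen with $h^2=1$; a conjugacy class is real (resp. strongly real) if its elements are. Then a conjugacy class of $SL_n(q)/Y$ is real if and only if it is strongly real, and the number of real classes of $SL_n(q)/Y$ is $$\sum_{|\nu|=n} h_\nu\, sl_\nu ,$$ where the sum runs over all partitions $\nu=\{\nu_1,\dots,\nu_r\}=1^{n_1}2^{n_2}3^{n_3}\cdots$ of $n$. Moreover this equals the number of real classes of $SL_n(q)$. Here $h_\nu=\gcd(q-1,\nu_1,\dots,\nu_r)$ and $$sl_{\nu}=\begin{cases} \prod_{n_i>0} n_{q,n_i}, & \text{if } q \text{ is even or } n_i=0 \text{ for all odd } i,\\ \frac12 \prod_{n_i>0} n_{q,n_i}, & \text{if } q \text{ is odd and } i\,n_i \text{ is odd for some } i,\\ f_\nu(q)\prod_{i \text{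 odd},\, n_i>0} q^{\frac{n_i}2-1}\prod_{i \text{ even},\, n_i>0}n_{q,n_i}, & \text{otherwise}, \end{cases}$$ with $f_\nu(q)=\frac{(q+1)^s+(q-1)^s}{2}$, $s$ the number of odd $i$ for which $n_i>0$. For $d\ge 1$ the number $n_{q,d}$ (the number of self-reciprocal polynomials of degree $d$ over $\mathbb F_q$ with constant term $1$) is given by: for $q$ odd, $n_{q,d}=2q^{(d-1)/2}$ if $d$ is odd and $n_{q,d}=(q+1)q^{d/2-1}$ if $d$ is even; for $q$ even, $n_{q,d}=q^{(d-1)/2}$ if $d$ is odd and $n_{q,d}=q^{d/2}$ if $d$ is even. -/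

import Mathlib

/-- `g` is real: some `h` in the group satisfies `h g h⁻¹ = g⁻¹`. -/
def IsRealElement {G : Type*} [Group G] (g : G) : Prop :=
  ∃ h : G, h * g * h⁻¹ = g⁻¹

/-- `g` is strongly real: some `h` in the group with `h² = 1` satisfies `h g h⁻¹ = g⁻¹`. -/
def IsStronglyRealElement {G : Type*} [Group G] (g : G) : Prop :=
  ∃ h : G, h ^ 2 = 1 ∧ h * g * h⁻¹ = g⁻¹

/-- The set of conjugacy classes of real elements of `G`. -/
def realClasses (G : Type*) [Group G] : Set (ConjClasses G) :=
  {c | ∃ g : G, ConjClasses.mk g = c ∧ IsRealElement g}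

/-- The set of conjugacy classes of strongly real elements of `G`. -/
def stronglyRealClasses (G : Type*) [Group G] : Set (ConjClasses G) :=
  {c | ∃ g : G, ConjClasses.mk g = c ∧ IsStronglyRealElement g}

/-- `|k|₂`, the largest power of `2` dividing the positive integer `k`. -/
def twoPart (k : ℕ) : ℕ := 2 ^ padicValNat 2 k

/-- `n_{q,d}` for `d ≥ 1`: the number of self-reciprocal polynomials of degree `d` over the field
with `q` elements with constant term `1`, in closed form. -/
def selfReciprocalCount (q d : ℕ) : ℕ :=
  if Even q then
    if Even d then q ^ (d / 2) else q ^ ((d - 1) / 2)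
  else
    if Even d then (q + 1) * q ^ (d / 2 - 1) else 2 * q ^ ((d - 1) / 2)

/-- The multiplicity `n_i` of the part `i` in the partition `ν = 1^{n_1} 2^{n_2} ⋯`. -/
def mult {n : ℕ} (ν : n.Partition) (i : ℕ) : ℕ := ν.parts.count i

/-- The set of those `i` with `n_i > 0`. -/
def partSet {n : ℕ} (ν : n.Partition) : Finset ℕ := ν.parts.toFinset

/-- `h_ν = gcd(q - 1, ν_1, …, ν_r)` for `ν = {ν_1, …, ν_r}`. -/
def hNum (q : ℕ) {n : ℕ} (ν : n.Partition) : ℕ := Nat.gcd (q - 1) ν.parts.gcd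

open Classical in
/-- `f_ν(q) = ((q + 1)^r + (q - 1)^r) / 2`, where `r` is the number of odd `i` with `n_i > 0`. -/
noncomputable def fNum (q : ℕ) {n : ℕ} (ν : n.Partition) : ℚ :=
  let r := ((partSet ν).filter (fun i => Odd i)).card
  (((q : ℚ) + 1) ^ r + ((q : ℚ) - 1) ^ r) / 2

open Classical in
/-- The number `sl_ν`. In the last case `n_i` is even for every odd `i`. -/
noncomputable def slNum (q : ℕ) {n : ℕ} (ν : n.Partition) : ℚ :=
  if Even q ∨ ∀ i, Odd i → mult ν i = 0 then
    ∏ i ∈ partSet ν, (selfReciprocalCount q (mult ν i) : ℚ)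
  else if ∃ i, Odd (i * mult ν i) then
    (1 / 2) * ∏ i ∈ partSet ν, (selfReciprocalCount q (mult ν i) : ℚ)
  else
    fNum q ν
      * (∏ i ∈ (partSet ν).filter (fun i => Odd i), (q : ℚ) ^ (mult ν i / 2 - 1))
      * ∏ i ∈ (partSet ν).filter (fun i => Even i), (selfReciprocalCount q (mult ν i) : ℚ)

/-! Write q for the order of `F` and v for the 2-adic valuation. The hypothesis on 2-parts gives 1 ≤
v(|Y|) < v(gcd(n, q-1)), and this is used twice. It forces 4 ∣ n and 4 ∣ q - 1, so q is odd. It also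
makes every y in Y the square of a central element of SL_n(q): if y has order M, then 2M divides n
and q - 1, so the scalar y has a square root in the cyclic group `Fˣ` that is still an n-th root of
unity (`exists_center_mul_self_eq`).

The second fact reduces everything to SL_n(q). The number of real classes times the group order
counts the pairs (x, h) with h x h⁻¹ = x⁻¹. Lifted from G/Y to G, the equation becomes h x h⁻¹ = y
x⁻¹ for some y in Y, and replacing x by wx with w central, w² = y, removes y. Hence G/Y and G have
equally many real classes (`ncard_realClasses_quotient`). The same shift turns a real coset into a
real element wg of G, so strong reality also descends from G to G/Y.

In SL_n(q), the elementary divisors p^e of a real element are permuted by p ↦ `recip p`. Merging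
each p^e that is not self-reciprocal with its partner decomposes the space into modules F[X]/(f)
with f self-reciprocal, and each carries a linear involution inverting the root. Because 4 ∣ n,
signs can be chosen so that the product of the determinants is 1 (`HasType.exists_reverser`). Thus
real in GL_n(q), real in SL_n(q) and strongly real in SL_n(q) coincide for elements of SL_n(q).

It remains to count. A GL-class in the kernel of det splits into |Fˣ| / |det C(g)| classes of
SL_n(q). The group det C(g) consists of the m-th powers, m being the gcd of the exponents e
(`map_det_centralizer`), so the class splits into gcd(q - 1, m) = h_ν pieces, where the partition ν
contains e exactly deg p times for each p^e. For fixed ν, multiply together all p with exponent i to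
get u_i of degree n_i. Real classes of determinant 1 then correspond to families of self-reciprocal
u_i with ∏ u_i(0)^i = 1. Each u_i(0) is ±1, and averaging the trivial and the sign character over
all families gives sl_ν (`exists_selfReciprocal_family`). -/

open Polynomial

/-! ### Determinants along exact sequences and along the layers of a nilpotent map. -/

section Determinants

variable {F : Type*} [Field F]

lemma LinearMap.det_eq_of_equiv {V W : Type*} [AddCommGroup V] [Module F V] [AddCommGroup W]
    [Module F W] (φ : V ≃ₗ[F] W) (c : V →ₗ[F] V) (d : W →ₗ[F] W)
    (h : ∀ v, φ (c v) = d (φ v)) : LinearMap.det c = LinearMap.det d := by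
  rw [← LinearMap.det_conj c φ]
  congr 1
  ext w
  simp [h]

lemma LinearMap.det_eq_mul_of_exact {U V W : Type*} [AddCommGroup U] [Module F U]
    [AddCommGroup V] [Module F V] [FiniteDimensional F V] [AddCommGroup W] [Module F W]
    (α : U →ₗ[F] V) (β : V →ₗ[F] W) (hα : Function.Injective α) (hβ : Function.Surjective β)
    (hex : LinearMap.range α = LinearMap.ker β)
    (u : U →ₗ[F] U) (v : V →ₗ[F] V) (w : W →ₗ[F] W)
    (hu : ∀ x, α (u x) = v (α x)) (hw : ∀ x, β (v x) = w (β x)) :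
    LinearMap.det v = LinearMap.det u * LinearMap.det w := by
  have hle : LinearMap.ker β ≤ (LinearMap.ker β).comap v := by
    intro x hx
    simp only [Submodule.mem_comap, LinearMap.mem_ker] at hx ⊢
    rw [hw, hx, map_zero]
  rw [LinearMap.det_eq_det_mul_det (LinearMap.ker β) v hle]
  congr 1
  · symm
    apply LinearMap.det_eq_of_equiv
      ((LinearEquiv.ofInjective α hα).trans (LinearEquiv.ofEq _ _ hex))
    intro x
    ext
    simp [hu]
  · apply LinearMap.det_eq_of_equiv (LinearMap.quotKerEquivOfSurjective β hβ)
    intro x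
    induction x using Submodule.Quotient.induction_on with
    | H x =>
      rw [Submodule.mapQ_apply]
      exact hw x

lemma LinearMap.det_pi_dep {ι : Type*} [Fintype ι] {M : ι → Type*} [∀ i, AddCommGroup (M i)]
    [∀ i, Module F (M i)] [∀ i, FiniteDimensional F (M i)] (f : ∀ i, M i →ₗ[F] M i) :
    LinearMap.det (LinearMap.pi fun i => (f i).comp (LinearMap.proj i)) =
      ∏ i, LinearMap.det (f i) := by
  classical
  revert M
  refine Fintype.induction_empty_option (P := fun ι _ => ∀ {M : ι → Type _}
    [∀ i, AddCommGroup (M i)] [∀ i, Module F (M i)] [∀ i, FiniteDimensional F (M i)]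
    (f : ∀ i, M i →ₗ[F] M i), LinearMap.det (LinearMap.pi fun i => (f i).comp
      (LinearMap.proj i)) = ∏ i, LinearMap.det (f i)) ?_ ?_ ?_ ι
  · intro α β _ e ih M _ _ _ f
    let _ := Fintype.ofEquiv β e.symm
    rw [← Equiv.prod_comp e, ← ih (fun i => f (e i))]
    exact LinearMap.det_eq_of_equiv (LinearEquiv.piCongrLeft F M e).symm _ _ (fun v => rfl)
  · intro M _ _ _ f
    rw [LinearMap.det_eq_one_of_subsingleton]
    simp
  · intro α _ ih M _ _ _ f
    rw [Fintype.prod_option, ← ih (fun i => f (some i))]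
    apply LinearMap.det_eq_mul_of_exact (LinearMap.single F M none)
      (LinearMap.pi fun i => LinearMap.proj (some i))
    · exact Pi.single_injective none
    · intro y
      exact ⟨fun o => match o with | none => 0 | some i => y i, rfl⟩
    · ext x
      simp only [LinearMap.mem_range, LinearMap.mem_ker]
      constructor
      · rintro ⟨y, rfl⟩
        ext i
        simp
      · intro h
        refine ⟨x none, ?_⟩
        ext o
        cases o with
        | none => simp
        | some i => simpa using (congr_fun h i).symm
    · intro x
      ext o
      cases o with
      | none => simp
      | some i => simp
    · intro x
      rfl

open Classical in
/-- Determinant of the restriction of `c` to `W` (`1` if `W` is not invariant). -/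
noncomputable def restrictDet {V : Type*} [AddCommGroup V] [Module F V] (c : V →ₗ[F] V)
    (W : Submodule F V) : F :=
  if h : W ≤ W.comap c then LinearMap.det (c.restrict h) else 1

variable {V : Type*} [AddCommGroup V] [Module F V] [FiniteDimensional F V]

/-- `T` maps the range of `T ^ k` onto that of `T ^ (k + 1)` with kernel ker T ∩ range T^k, and `c`
respects this exact sequence; determinants are multiplicative along it. -/
lemma restrictDet_range_pow {T c : V →ₗ[F] V} (hc : Commute c T) (k : ℕ) :
    restrictDet c (LinearMap.range (T ^ k)) =
      restrictDet c (LinearMap.ker T ⊓ LinearMap.range (T ^ k)) *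
        restrictDet c (LinearMap.range (T ^ (k + 1))) := by
  have hcT : ∀ x, c (T x) = T (c x) := fun x => LinearMap.congr_fun hc x
  have hcTk : ∀ k x, c ((T ^ k) x) = (T ^ k) (c x) := fun k x =>
    LinearMap.congr_fun (hc.pow_right k) x
  have hR : ∀ k, LinearMap.range (T ^ k) ≤ (LinearMap.range (T ^ k)).comap c := by
    rintro k _ ⟨y, rfl⟩
    exact ⟨c y, (hcTk k y).symm⟩
  have hK : LinearMap.ker T ≤ (LinearMap.ker T).comap c := by
    intro x hx
    simp only [Submodule.mem_comap, LinearMap.mem_ker] at hx ⊢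
    rw [← hcT, hx, map_zero]
  have hKR : LinearMap.ker T ⊓ LinearMap.range (T ^ k) ≤
      (LinearMap.ker T ⊓ LinearMap.range (T ^ k)).comap c := fun x hx => ⟨hK hx.1, hR k hx.2⟩
  unfold restrictDet
  rw [dif_pos (hR k), dif_pos (hR (k + 1)), dif_pos hKR]
  have hT : ∀ x ∈ LinearMap.range (T ^ k), T x ∈ LinearMap.range (T ^ (k + 1)) := by
    rintro _ ⟨y, rfl⟩
    exact ⟨y, by rw [pow_succ', Module.End.mul_apply]⟩
  apply LinearMap.det_eq_mul_of_exact (Submodule.inclusion inf_le_right) (T.restrict hT)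
    (Submodule.inclusion_injective _)
  · rintro ⟨_, y, rfl⟩
    refine ⟨⟨(T ^ k) y, y, rfl⟩, ?_⟩
    ext
    simp [pow_succ']
  · ext ⟨x, hx⟩
    constructor
    · rintro ⟨⟨y, hy⟩, h⟩
      have : y = x := congrArg Subtype.val h
      subst this
      exact Subtype.ext hy.1
    · intro h
      exact ⟨⟨x, congrArg Subtype.val h, hx⟩, rfl⟩
  · intro x; rfl
  · intro x
    ext
    simp [hcT]

lemma LinearMap.det_eq_prod_restrictDet {T c : V →ₗ[F] V} (hc : Commute c T) (N : ℕ)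
    (hT : T ^ N = 0) :
    LinearMap.det c =
      ∏ k ∈ Finset.range N, restrictDet c (LinearMap.ker T ⊓ LinearMap.range (T ^ k)) := by
  have key : ∀ k, restrictDet c (LinearMap.range (T ^ 0)) =
      (∏ k ∈ Finset.range k, restrictDet c (LinearMap.ker T ⊓ LinearMap.range (T ^ k))) *
        restrictDet c (LinearMap.range (T ^ k)) := by
    intro k
    induction k with
    | zero => simp
    | succ k ih => rw [ih, Finset.prod_range_succ, restrictDet_range_pow hc, mul_assoc]
  have h0 : restrictDet c (LinearMap.range (T ^ 0)) = LinearMap.det c := by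
    have : LinearMap.range (T ^ 0) = ⊤ := by simp [Module.End.one_eq_id]
    rw [this, restrictDet, dif_pos (show ⊤ ≤ Submodule.comap c ⊤ from fun _ _ => trivial)]
    exact LinearMap.det_eq_of_equiv Submodule.topEquiv _ _ (fun v => rfl)
  have h1 : restrictDet c (LinearMap.range (T ^ N)) = 1 := by
    rw [hT]
    unfold restrictDet
    split_ifs with h
    · have : Subsingleton (LinearMap.range (0 : V →ₗ[F] V)) := by
        rw [LinearMap.range_zero]; infer_instance
      exact LinearMap.det_eq_one_of_subsingleton _
    · rfl
  rw [← h0, key N, h1, mul_one]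

/-- If the layers `ker T ⊓ range T ^ k` can only jump at multiples of `m`, then every determinant
of an endomorphism commuting with the nilpotent map `T` is an `m`-th power. -/
lemma LinearMap.exists_det_eq_pow {T c : V →ₗ[F] V} (hc : Commute c T) {m N : ℕ} (hm : 0 < m)
    (hT : T ^ N = 0)
    (hlayer : ∀ k, ¬ m ∣ k + 1 → LinearMap.ker T ⊓ LinearMap.range (T ^ k) ≤
      LinearMap.range (T ^ (k + 1))) :
    ∃ a : F, LinearMap.det c = a ^ m := by
  -- The exponent is padded to a multiple of `m`, so that the product over layers falls into `N`
  -- blocks of `m` equal factors.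
  have hT' : T ^ (m * N) = 0 := by rw [mul_comm, pow_mul, hT, zero_pow hm.ne']
  rw [LinearMap.det_eq_prod_restrictDet hc _ hT']
  set d := fun k => restrictDet c (LinearMap.ker T ⊓ LinearMap.range (T ^ k)) with hd
  have hstep : ∀ k, ¬ m ∣ k + 1 → d (k + 1) = d k := by
    intro k hk
    have : LinearMap.ker T ⊓ LinearMap.range (T ^ (k + 1)) =
        LinearMap.ker T ⊓ LinearMap.range (T ^ k) := by
      apply le_antisymm
      · apply inf_le_inf_left
        rintro _ ⟨y, rfl⟩
        exact ⟨T y, by rw [pow_succ, Module.End.mul_apply]⟩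
      · exact le_inf inf_le_left (hlayer k hk)
    simp only [hd, this]
  have hblock : ∀ j i, i < m → d (m * j + i) = d (m * j) := by
    intro j i
    induction i with
    | zero => simp
    | succ i ih =>
      intro hi
      rw [← ih (by omega), ← add_assoc]
      apply hstep
      rw [add_assoc, Nat.dvd_add_right (dvd_mul_right m j)]
      exact Nat.not_dvd_of_pos_of_lt (by omega) hi
  refine ⟨∏ j ∈ Finset.range N, d (m * j), ?_⟩
  rw [← Finset.prod_pow]
  change ∏ k ∈ Finset.range (m * N), d k = _
  clear hT hT'
  induction N with
  | zero => simp
  | succ N ih =>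
    rw [Nat.mul_succ, Finset.prod_range_add, ih, Finset.prod_range_succ,
      Finset.prod_congr rfl fun i hi => hblock N i (Finset.mem_range.1 hi)]
    simp

end Determinants

/-! ### Elementary divisors of an endomorphism: definition and existence. -/

section Blocks

variable {F : Type*} [Field F]

/-- The endomorphism `g` is isomorphic to multiplication by the root on `∏ i, F[X] / (f i)`. -/
def HasBlocks {V : Type*} [AddCommGroup V] [Module F V] (g : V →ₗ[F] V) {ι : Type*}
    (f : ι → F[X]) : Prop :=
  ∃ φ : V ≃ₗ[F] (∀ i, AdjoinRoot (f i)), ∀ v i, φ (g v) i = AdjoinRoot.root (f i) * φ v i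

/-- A pair `(p, e)` with `p` monic irreducible, `p ≠ X`, and `e > 0`. -/
def IsBlock (x : F[X] × ℕ) : Prop :=
  x.1.Monic ∧ Irreducible x.1 ∧ x.1.coeff 0 ≠ 0 ∧ 0 < x.2

section
variable {V W : Type*} [AddCommGroup V] [Module F V] [AddCommGroup W] [Module F W]
  {g : V →ₗ[F] V} {h : W →ₗ[F] W} {ι κ : Type*} {f : ι → F[X]}

lemma map_aeval_of_root {φ : V →ₗ[F] (∀ i, AdjoinRoot (f i))}
    (hφ : ∀ v i, φ (g v) i = AdjoinRoot.root (f i) * φ v i) (p : F[X]) (v : V) (i : ι) :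
    φ (aeval g p v) i = AdjoinRoot.mk (f i) p * φ v i := by
  induction p using Polynomial.induction_on' with
  | add p q hp hq => simp [hp, hq, add_mul]
  | monomial k a =>
    rw [aeval_monomial, ← C_mul_X_pow_eq_monomial, map_mul, map_pow, AdjoinRoot.mk_X]
    induction k generalizing v with
    | zero => simp [Algebra.smul_def]
    | succ k ih =>
      rw [pow_succ, ← mul_assoc, Module.End.mul_apply, ih, hφ]
      ring

lemma HasBlocks.exists_equiv (hg : HasBlocks g f) (hh : HasBlocks h f) :
    ∃ ψ : V ≃ₗ[F] W, ∀ v, ψ (g v) = h (ψ v) := by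
  obtain ⟨φ, hφ⟩ := hg
  obtain ⟨χ, hχ⟩ := hh
  refine ⟨φ.trans χ.symm, fun v => ?_⟩
  apply χ.injective
  ext i
  simp [hφ, hχ]

lemma HasBlocks.of_equiv (hg : HasBlocks g f) (ψ : W ≃ₗ[F] V) (hψ : ∀ v, ψ (h v) = g (ψ v)) :
    HasBlocks h f := by
  obtain ⟨φ, hφ⟩ := hg
  exact ⟨ψ.trans φ, fun v i => by simp [hψ, hφ]⟩

lemma HasBlocks.reindex (hg : HasBlocks g f) (σ : κ ≃ ι) : HasBlocks g (fun k => f (σ k)) := by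
  obtain ⟨φ, hφ⟩ := hg
  exact ⟨φ.trans (LinearEquiv.piCongrLeft F (fun i => AdjoinRoot (f i)) σ).symm,
    fun v k => hφ v (σ k)⟩

/-- Equal multisets of values mean equinumerous fibres; bijections between the fibres glue to the
required one. -/
lemma exists_perm_of_map_univ_eq {α : Type*} [Fintype ι] [Fintype κ] (a : ι → α) (b : κ → α)
    (hab : Finset.univ.val.map a = Finset.univ.val.map b) : ∃ σ : κ ≃ ι, ∀ k, a (σ k) = b k := by
  classical
  have hcard : ∀ x, Fintype.card {k // b k = x} = Fintype.card {i // a i = x} := by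
    intro x
    have h1 := congrArg (Multiset.count x) hab
    rw [Multiset.count_map, Multiset.count_map] at h1
    simp only [Fintype.card_subtype, Finset.card_def, Finset.filter_val]
    simp only [eq_comm (a := x)] at h1
    exact h1.symm
  refine ⟨(Equiv.sigmaFiberEquiv b).symm.trans ((Equiv.sigmaCongrRight fun x =>
    Fintype.equivOfCardEq (hcard x)).trans (Equiv.sigmaFiberEquiv a)), fun k => ?_⟩
  simp only [Equiv.trans_apply, Equiv.sigmaFiberEquiv, Equiv.coe_fn_mk, Equiv.coe_fn_symm_mk,
    Equiv.sigmaCongrRight_apply]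
  exact (Fintype.equivOfCardEq (hcard (b k)) ⟨k, rfl⟩).2

lemma HasBlocks.of_map_univ_eq [Fintype ι] [Fintype κ] {α : Type*} (P : α → F[X]) {a : ι → α}
    {b : κ → α} (hab : Finset.univ.val.map a = Finset.univ.val.map b)
    (hg : HasBlocks g (fun i => P (a i))) : HasBlocks g (fun k => P (b k)) := by
  obtain ⟨σ, hσ⟩ := exists_perm_of_map_univ_eq a b hab
  have := hg.reindex σ
  simpa only [hσ] using this

end

/-- `g` has the elementary divisors `p ^ e`, `(p, e) ∈ S`. -/
def HasType {V : Type*} [AddCommGroup V] [Module F V] (g : V →ₗ[F] V)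
    (S : Multiset (F[X] × ℕ)) : Prop :=
  ∃ (k : ℕ) (a : Fin k → F[X] × ℕ), Finset.univ.val.map a = S ∧
    HasBlocks g (fun i => (a i).1 ^ (a i).2)

section
variable {V W : Type*} [AddCommGroup V] [Module F V] [AddCommGroup W] [Module F W]
  {g : V →ₗ[F] V} {h : W →ₗ[F] W} {S : Multiset (F[X] × ℕ)}

lemma HasBlocks.hasType {ι : Type*} [Fintype ι] {a : ι → F[X] × ℕ}
    (hg : HasBlocks g (fun i => (a i).1 ^ (a i).2)) : HasType g (Finset.univ.val.map a) := by
  refine ⟨Fintype.card ι, a ∘ (Fintype.equivFin ι).symm, ?_, hg.reindex (Fintype.equivFin ι).symm⟩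
  rw [← Multiset.map_map, Multiset.map_univ_val_equiv]

lemma HasType.hasBlocks (hg : HasType g S) {ι : Type*} [Fintype ι] {a : ι → F[X] × ℕ}
    (ha : Finset.univ.val.map a = S) : HasBlocks g (fun i => (a i).1 ^ (a i).2) := by
  obtain ⟨k, b, hb, hgb⟩ := hg
  exact HasBlocks.of_map_univ_eq (fun x : F[X] × ℕ => x.1 ^ x.2) (hb.trans ha.symm) hgb

lemma HasType.exists_equiv (hg : HasType g S) (hh : HasType h S) :
    ∃ ψ : V ≃ₗ[F] W, ∀ v, ψ (g v) = h (ψ v) := by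
  obtain ⟨k, b, hb, hgb⟩ := hg
  exact hgb.exists_equiv (hh.hasBlocks hb)

lemma HasType.of_equiv (hg : HasType g S) (ψ : W ≃ₗ[F] V) (hψ : ∀ v, ψ (h v) = g (ψ v)) :
    HasType h S := by
  obtain ⟨k, b, hb, hgb⟩ := hg
  exact ⟨k, b, hb, hgb.of_equiv ψ hψ⟩

end

-- The structure theorem for the torsion `F[X]`-module defined by `g`. What remains is to make the
-- primes monic, to drop the summands with exponent 0, and to see that injectivity of `g` excludes
-- the prime X.
open DirectSum in
theorem exists_hasType {V : Type*} [AddCommGroup V] [Module F V] [FiniteDimensional F V]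
    (g : V →ₗ[F] V) (hinj : Function.Injective g) :
    ∃ S : Multiset (F[X] × ℕ), (∀ x ∈ S, IsBlock x) ∧ HasType g S := by
  classical
  obtain ⟨ι, _, p, hp, e, ⟨l⟩⟩ := Module.equiv_directSum_of_isTorsion
    (Module.AEval.isTorsion_of_finiteDimensional F V g)
  have hassoc : ∀ i, Associated (p i ^ e i) (normalize (p i) ^ e i) :=
    fun i => (associated_normalize (p i)).pow_pow
  let l' : ∀ i, V → AdjoinRoot (p i ^ e i) := fun i v => l (Module.AEval.of F V g v) i
  have hl'p : ∀ i (q : F[X]) v, l' i (aeval g q v) = AdjoinRoot.mk _ q * l' i v := by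
    intro i q v
    have h1 : l (Module.AEval.of F V g (aeval g q v)) = q • l (Module.AEval.of F V g v) := by
      rw [← map_smul, ← Module.AEval.of_aeval_smul]; rfl
    have h2 := congrArg (fun w => w i) h1
    refine h2.trans ?_
    rw [DirectSum.smul_apply]
    have hs : ∀ w : F[X] ⧸ (Submodule.span F[X] {p i ^ e i}),
        (show AdjoinRoot (p i ^ e i) from q • w) =
          AdjoinRoot.mk _ q * (show AdjoinRoot (p i ^ e i) from w) := by
      intro w
      induction w using Submodule.Quotient.induction_on with
      | H w => rfl
    exact hs _
  have hl'add : ∀ i v w, l' i (v + w) = l' i v + l' i w := by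
    intro i v w
    change (l _) i = _
    rw [map_add, map_add, DirectSum.add_apply]
    rfl
  let χ : ∀ i, V →ₗ[F] AdjoinRoot (normalize (p i) ^ e i) := fun i =>
    { toFun := fun v => AdjoinRoot.algEquivOfAssociated F _ _ (hassoc i) (l' i v)
      map_add' := fun v w => by rw [hl'add, map_add]
      map_smul' := fun c v => by
        rw [RingHom.id_apply, ← map_smul]
        congr 1
        have := hl'p i (C c) v
        rw [aeval_C, Module.algebraMap_end_apply] at this
        rw [this, AdjoinRoot.mk_C, Algebra.smul_def]
        rfl }
  have hχ : ∀ i v, χ i (g v) = AdjoinRoot.root _ * χ i v := by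
    intro i v
    have := hl'p i X v
    rw [aeval_X, AdjoinRoot.mk_X] at this
    change AdjoinRoot.algEquivOfAssociated F _ _ (hassoc i) (l' i (g v)) = _
    rw [this, map_mul, AdjoinRoot.algEquivOfAssociated_root]
    rfl
  -- The summands with exponent 0 are zero rings, so omitting them loses nothing.
  let Φ : V →ₗ[F] (∀ j : {i // e i ≠ 0}, AdjoinRoot (normalize (p j) ^ e j)) :=
    LinearMap.pi fun j => χ j
  have hΦ : Function.Bijective Φ := by
    constructor
    · rw [injective_iff_map_eq_zero]
      intro v hv
      have h0 : ∀ i, l' i v = 0 := by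
        intro i
        by_cases hi : e i = 0
        · have : Subsingleton (AdjoinRoot (p i ^ e i)) := by
            rw [← subsingleton_iff_zero_eq_one, eq_comm, ← map_one (AdjoinRoot.mk (p i ^ e i)),
              AdjoinRoot.mk_eq_zero, hi, pow_zero]
          exact Subsingleton.elim _ _
        · have := congr_fun hv ⟨i, hi⟩
          exact (AdjoinRoot.algEquivOfAssociated F _ _ (hassoc i)).injective
            (this.trans (map_zero _).symm)
      have h1 : l (Module.AEval.of F V g v) = 0 := by
        ext i
        exact h0 i
      simpa using h1
    · intro w
      let y₀ : ∀ i, F[X] ⧸ (Submodule.span F[X] {p i ^ e i}) := fun i => if hi : e i ≠ 0 then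
        (AdjoinRoot.algEquivOfAssociated F _ _ (hassoc i)).symm (w ⟨i, hi⟩) else 0
      let y : ⨁ i, F[X] ⧸ (Submodule.span F[X] {p i ^ e i}) :=
        DFinsupp.equivFunOnFintype.symm y₀
      have hy : ∀ i, y i = y₀ i :=
        fun i => congr_fun (DFinsupp.equivFunOnFintype.apply_symm_apply y₀) i
      refine ⟨(Module.AEval.of F V g).symm (l.symm y), ?_⟩
      ext ⟨i, hi⟩
      change AdjoinRoot.algEquivOfAssociated F _ _ (hassoc i) (l' i _) = _
      have : l' i ((Module.AEval.of F V g).symm (l.symm y)) =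
          (AdjoinRoot.algEquivOfAssociated F _ _ (hassoc i)).symm (w ⟨i, hi⟩) := by
        simp only [l', LinearEquiv.apply_symm_apply]
        rw [hy]
        exact dif_pos hi
      rw [this, AlgEquiv.apply_symm_apply]
  have hB : HasBlocks g (fun j : {i // e i ≠ 0} => normalize (p j) ^ e j) :=
    ⟨LinearEquiv.ofBijective Φ hΦ, fun v j => hχ j v⟩
  refine ⟨_, ?_, hB.hasType (a := fun j : {i // e i ≠ 0} => (normalize (p j), e j))⟩
  intro x hx
  rw [Multiset.mem_map] at hx
  obtain ⟨⟨i, hi⟩, -, rfl⟩ := hx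
  refine ⟨monic_normalize (hp i).ne_zero, (associated_normalize (p i)).irreducible (hp i), ?_,
    Nat.pos_of_ne_zero hi⟩
  intro h0
  -- If p^e = X * r, then the class of r is a nonzero vector killed by `g`.
  have hX : X ∣ normalize (p i) ^ e i := dvd_pow (X_dvd_iff.2 h0) hi
  obtain ⟨r, hr⟩ := hX
  obtain ⟨v, hv⟩ := hΦ.2 (Pi.single ⟨i, hi⟩ (AdjoinRoot.mk _ r))
  have hgv : g v = 0 := by
    apply hΦ.1
    rw [map_zero]
    ext ⟨j, hj⟩
    change χ j (g v) = 0
    rw [hχ]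
    have h2 : χ j v = _ := congr_fun hv ⟨j, hj⟩
    rw [h2]
    by_cases hij : j = i
    · subst hij
      rw [Pi.single_eq_same, ← AdjoinRoot.mk_X, ← map_mul, AdjoinRoot.mk_eq_zero, hr]
    · rw [Pi.single_eq_of_ne (by simpa using hij), mul_zero]
  have hv0 : v = 0 := hinj (by rw [hgv, map_zero])
  rw [hv0, map_zero] at hv
  have h3 := congr_fun hv ⟨i, hi⟩
  rw [Pi.single_eq_same, eq_comm, Pi.zero_apply, AdjoinRoot.mk_eq_zero, hr] at h3
  have hr0 : r ≠ 0 := by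
    rintro rfl
    rw [mul_zero] at hr
    exact pow_ne_zero _ (mt normalize_eq_zero.1 (hp i).ne_zero) hr
  have := natDegree_le_of_dvd h3 hr0
  rw [natDegree_X_mul hr0] at this
  omega

end Blocks

/-! ### Monic reciprocal polynomials. -/

section Recip

variable {F : Type*} [Field F]

/-- The monic reciprocal polynomial `X ^ deg p * p (1 / X) / p 0`. -/
noncomputable def recip (p : F[X]) : F[X] := C (p.coeff 0)⁻¹ * p.reverse

lemma recip_mul (p q : F[X]) : recip (p * q) = recip p * recip q := by
  simp only [recip, reverse_mul_of_domain, mul_coeff_zero, mul_inv, C_mul]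
  ring

lemma recip_one : recip (1 : F[X]) = 1 := by
  have : (1 : F[X]).reverse = 1 := by simpa using reverse_C (1 : F)
  simp [recip, this]

lemma recip_pow (p : F[X]) (e : ℕ) : recip (p ^ e) = recip p ^ e := by
  induction e with
  | zero => simp [recip_one]
  | succ e ih => rw [pow_succ, recip_mul, ih, pow_succ]

lemma natDegree_reverse_of_coeff_zero {p : F[X]} (h : p.coeff 0 ≠ 0) :
    p.reverse.natDegree = p.natDegree := by
  rw [reverse_natDegree, natTrailingDegree_eq_zero.2 (Or.inr h), Nat.sub_zero]

lemma natDegree_recip {p : F[X]} (h : p.coeff 0 ≠ 0) : (recip p).natDegree = p.natDegree := by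
  rw [recip, natDegree_C_mul (inv_ne_zero h), natDegree_reverse_of_coeff_zero h]

lemma coeff_recip (p : F[X]) {j : ℕ} (hj : j ≤ p.natDegree) :
    (recip p).coeff j = (p.coeff 0)⁻¹ * p.coeff (p.natDegree - j) := by
  rw [recip, coeff_C_mul, coeff_reverse, revAt_le hj]

lemma monic_recip {p : F[X]} (h : p.coeff 0 ≠ 0) : (recip p).Monic := by
  rw [Monic, leadingCoeff, natDegree_recip h, coeff_recip p le_rfl, Nat.sub_self,
    inv_mul_cancel₀ h]

lemma coeff_zero_recip {p : F[X]} (hp : p.Monic) : (recip p).coeff 0 = (p.coeff 0)⁻¹ := by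
  rw [coeff_recip p (Nat.zero_le _), Nat.sub_zero, hp.coeff_natDegree, mul_one]

lemma recip_recip {p : F[X]} (hp : p.Monic) (h : p.coeff 0 ≠ 0) : recip (recip p) = p := by
  have h' : (recip p).coeff 0 ≠ 0 := by rw [coeff_zero_recip hp]; exact inv_ne_zero h
  ext j
  by_cases hj : j ≤ p.natDegree
  · rw [coeff_recip _ (by rwa [natDegree_recip h]), coeff_zero_recip hp, natDegree_recip h,
      coeff_recip _ (Nat.sub_le _ _), Nat.sub_sub_self hj, inv_inv, mul_inv_cancel_left₀ h]
  · rw [coeff_eq_zero_of_natDegree_lt, coeff_eq_zero_of_natDegree_lt (by omega)]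
    rw [natDegree_recip h', natDegree_recip h]
    omega

/-- `recip` is multiplicative and involutive here, so a factorisation of `recip p` gives one of `p`;
it preserves degrees when the constant term is nonzero, hence it reflects units. -/
lemma irreducible_recip {p : F[X]} (hp : p.Monic) (h : p.coeff 0 ≠ 0) (hi : Irreducible p) :
    Irreducible (recip p) := by
  have h' : (recip p).coeff 0 ≠ 0 := by rw [coeff_zero_recip hp]; exact inv_ne_zero h
  have hunit : ∀ a : F[X], a.coeff 0 ≠ 0 → IsUnit (recip a) → IsUnit a := by
    intro a ha hu
    have := natDegree_eq_zero_of_isUnit hu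
    rw [natDegree_recip ha] at this
    rw [eq_C_of_natDegree_eq_zero this]
    exact isUnit_C.2 (IsUnit.mk0 _ ha)
  constructor
  · intro hu
    exact hi.not_isUnit (hunit p h hu)
  · intro a b hab
    have hab0 : a.coeff 0 * b.coeff 0 ≠ 0 := by rw [← mul_coeff_zero, ← hab]; exact h'
    have h2 : p = recip a * recip b := by rw [← recip_mul, ← hab, recip_recip hp h]
    rcases hi.isUnit_or_isUnit h2 with hu | hu
    · exact Or.inl (hunit a (left_ne_zero_of_mul hab0) hu)
    · exact Or.inr (hunit b (right_ne_zero_of_mul hab0) hu)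

/-- Reciprocal of a block. -/
noncomputable def recipBlock (x : F[X] × ℕ) : F[X] × ℕ := (recip x.1, x.2)

lemma IsBlock.recip {x : F[X] × ℕ} (hx : IsBlock x) : IsBlock (recipBlock x) := by
  refine ⟨monic_recip hx.2.2.1, irreducible_recip hx.1 hx.2.2.1 hx.2.1, ?_, hx.2.2.2⟩
  change (_root_.recip x.1).coeff 0 ≠ 0
  rw [coeff_zero_recip hx.1]
  exact inv_ne_zero hx.2.2.1

lemma IsBlock.recipBlock_recipBlock {x : F[X] × ℕ} (hx : IsBlock x) :
    recipBlock (recipBlock x) = x :=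
  Prod.ext (recip_recip hx.1 hx.2.2.1) rfl

lemma AdjoinRoot.isUnit_mk_of_isCoprime {f q : F[X]} (h : IsCoprime q f) :
    IsUnit (AdjoinRoot.mk f q) := by
  obtain ⟨a, b, hab⟩ := h
  refine .of_mul_eq_one_right (AdjoinRoot.mk f a) ?_
  rw [← map_mul, ← map_one (AdjoinRoot.mk f), ← hab, map_add, map_mul _ b, AdjoinRoot.mk_self,
    mul_zero, add_zero]

lemma AdjoinRoot.isUnit_root {f : F[X]} (h : f.coeff 0 ≠ 0) : IsUnit (AdjoinRoot.root f) := by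
  rw [← AdjoinRoot.mk_X]
  apply AdjoinRoot.isUnit_mk_of_isCoprime
  rw [(prime_X (R := F)).irreducible.coprime_iff_not_dvd, X_dvd_iff]
  exact h

lemma AdjoinRoot.eval₂_recip_inv_root {f : F[X]} (u : (AdjoinRoot f)ˣ)
    (hu : (u : AdjoinRoot f) = AdjoinRoot.root f) :
    eval₂ ((Algebra.ofId F (AdjoinRoot f) : F →ₐ[F] AdjoinRoot f) : F →+* AdjoinRoot f)
      ((u⁻¹ : (AdjoinRoot f)ˣ) : AdjoinRoot f) (recip f) = 0 := by
  let _ : Invertible (AdjoinRoot.root f) := ⟨(u⁻¹ : (AdjoinRoot f)ˣ), by simp [← hu],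
    by simp [← hu]⟩
  rw [recip, eval₂_mul]
  have := (eval₂_reverse_eq_zero_iff (AdjoinRoot.of f) (AdjoinRoot.root f) f).2
    (AdjoinRoot.eval₂_root f)
  exact mul_eq_zero_of_right _ this

/-- The isomorphism `F[X] / (recip f) ≃ F[X] / (f)` sending the root to the inverse of the root. -/
lemma AdjoinRoot.exists_recipEquiv {f : F[X]} (hf : f.Monic) (h : f.coeff 0 ≠ 0) :
    ∃ φ : AdjoinRoot (recip f) ≃ₐ[F] AdjoinRoot f,
      φ (AdjoinRoot.root (recip f)) * AdjoinRoot.root f = 1 := by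
  have h' : (recip f).coeff 0 ≠ 0 := by rw [coeff_zero_recip hf]; exact inv_ne_zero h
  obtain ⟨u, hu⟩ := AdjoinRoot.isUnit_root h
  obtain ⟨w, hw⟩ := AdjoinRoot.isUnit_root h'
  have hwf := AdjoinRoot.eval₂_recip_inv_root w hw
  rw [recip_recip hf h] at hwf
  let φ : AdjoinRoot (recip f) →ₐ[F] AdjoinRoot f := AdjoinRoot.liftAlgHom (recip f)
    (Algebra.ofId F _) _ (AdjoinRoot.eval₂_recip_inv_root u hu)
  let ψ : AdjoinRoot f →ₐ[F] AdjoinRoot (recip f) := AdjoinRoot.liftAlgHom f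
    (Algebra.ofId F _) _ hwf
  have hφ : φ w = ((u⁻¹ : (AdjoinRoot f)ˣ) : AdjoinRoot f) := by
    rw [hw]; exact AdjoinRoot.liftAlgHom_root ..
  have hψ : ψ u = ((w⁻¹ : (AdjoinRoot (recip f))ˣ) : AdjoinRoot (recip f)) := by
    rw [hu]; exact AdjoinRoot.liftAlgHom_root ..
  refine ⟨AlgEquiv.ofAlgHom φ ψ ?_ ?_, ?_⟩
  · apply AdjoinRoot.algHom_ext
    rw [← hu, AlgHom.comp_apply, hψ, AlgHom.id_apply]
    have h1 : φ ((w⁻¹ : (AdjoinRoot (recip f))ˣ) : AdjoinRoot (recip f)) * φ w = 1 := by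
      rw [← map_mul, Units.inv_mul, map_one]
    rw [hφ] at h1
    exact (Units.mul_inv_eq_one).1 h1
  · apply AdjoinRoot.algHom_ext
    rw [← hw, AlgHom.comp_apply, hφ, AlgHom.id_apply]
    have h1 : ψ ((u⁻¹ : (AdjoinRoot f)ˣ) : AdjoinRoot f) * ψ u = 1 := by
      rw [← map_mul, Units.inv_mul, map_one]
    rw [hψ] at h1
    exact (Units.mul_inv_eq_one).1 h1
  · have h1 : φ (AdjoinRoot.root (recip f)) * AdjoinRoot.root f = 1 := by
      rw [← hw, hφ, ← hu, Units.inv_mul]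
    exact h1

end Recip

/-! ### Elementary divisors of the inverse. -/

section InverseType

variable {F : Type*} [Field F] {V : Type*} [AddCommGroup V] [Module F V]

/-- The isomorphism F[X]/(recip f) ≅ F[X]/(f) sends the root to the inverse of the root, so
multiplication by the inverse root on one side is multiplication by the root on the other. -/
lemma HasBlocks.inverse {g g' : V →ₗ[F] V} (hgg' : g * g' = 1) {ι : Type*} {f : ι → F[X]}
    (hf : ∀ i, (f i).Monic) (h0 : ∀ i, (f i).coeff 0 ≠ 0) (hg : HasBlocks g f) :
    HasBlocks g' (fun i => recip (f i)) := by
  obtain ⟨φ, hφ⟩ := hg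
  choose ψ hψ using fun i => AdjoinRoot.exists_recipEquiv (hf i) (h0 i)
  refine ⟨φ.trans (LinearEquiv.piCongrRight fun i => (ψ i).symm.toLinearEquiv), fun v i => ?_⟩
  have key : (ψ i).symm (φ (g' v) i) = AdjoinRoot.root (recip (f i)) * (ψ i).symm (φ v i) := by
    rw [AlgEquiv.symm_apply_eq, map_mul, AlgEquiv.apply_symm_apply]
    have h1 : g (g' v) = v := LinearMap.congr_fun hgg' v
    conv_rhs => rw [← h1]
    rw [hφ, ← mul_assoc, hψ, one_mul]
  exact key

lemma IsBlock.coeff_zero_pow {x : F[X] × ℕ} (hx : IsBlock x) : (x.1 ^ x.2).coeff 0 ≠ 0 := by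
  rw [coeff_zero_eq_eval_zero, eval_pow, ← coeff_zero_eq_eval_zero]
  exact pow_ne_zero _ hx.2.2.1

lemma HasType.inverse {g g' : V →ₗ[F] V} (hgg' : g * g' = 1) {S : Multiset (F[X] × ℕ)}
    (hS : ∀ x ∈ S, IsBlock x) (hg : HasType g S) : HasType g' (S.map recipBlock) := by
  obtain ⟨k, a, rfl, h⟩ := hg
  have hB : ∀ i, IsBlock (a i) := fun i => hS _ (Multiset.mem_map_of_mem a (Finset.mem_univ i))
  refine ⟨k, fun i => recipBlock (a i), by rw [Multiset.map_map]; rfl, ?_⟩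
  have := h.inverse hgg' (fun i => (hB i).1.pow _) (fun i => (hB i).coeff_zero_pow)
  simp only [recip_pow] at this
  exact this

end InverseType

/-! ### Uniqueness of the elementary divisors through ranks. -/

section Rank

variable {F : Type*} [Field F]

lemma AdjoinRoot.finrank_eq_natDegree {f : F[X]} (hf : f.Monic) :
    Module.finrank F (AdjoinRoot f) = f.natDegree := by
  rw [(AdjoinRoot.powerBasis' hf).finrank]
  rfl

/-- Multiplication by `d` as a map `F[X] / (h) → F[X] / (d * h)`. -/
noncomputable def AdjoinRoot.mulMap (d : F[X]) {h : F[X]} (hh : h.Monic) :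
    AdjoinRoot h →ₗ[F] AdjoinRoot (d * h) :=
  (AdjoinRoot.mkₐ (d * h)).toLinearMap ∘ₗ LinearMap.mulLeft F d ∘ₗ AdjoinRoot.modByMonicHom hh

lemma AdjoinRoot.mulMap_mk (d : F[X]) {h : F[X]} (hh : h.Monic) (r : F[X]) :
    AdjoinRoot.mulMap d hh (AdjoinRoot.mk h r) = AdjoinRoot.mk (d * h) (d * r) := by
  change AdjoinRoot.mk (d * h) (d * AdjoinRoot.modByMonicHom hh (AdjoinRoot.mk h r)) = _
  rw [AdjoinRoot.modByMonicHom_mk, AdjoinRoot.mk_eq_mk, ← mul_sub]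
  apply mul_dvd_mul_left
  rw [modByMonic_eq_sub_mul_div]
  exact ⟨-(r /ₘ h), by ring⟩

lemma AdjoinRoot.mulMap_injective {d : F[X]} (hd : d ≠ 0) {h : F[X]} (hh : h.Monic) :
    Function.Injective (AdjoinRoot.mulMap d hh) := by
  rw [injective_iff_map_eq_zero]
  intro a
  induction a using AdjoinRoot.induction_on with
  | ih r =>
    rw [AdjoinRoot.mulMap_mk, AdjoinRoot.mk_eq_zero, AdjoinRoot.mk_eq_zero]
    exact (mul_dvd_mul_iff_left hd).1

/-- The ideal generated by d in F[X]/(dh) is isomorphic to F[X]/(h) as a vector space. -/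
lemma AdjoinRoot.finrank_range_mul {d h : F[X]} (hd : d ≠ 0) (hh : h.Monic) :
    Module.finrank F (LinearMap.range (LinearMap.mulLeft F (AdjoinRoot.mk (d * h) d))) =
      h.natDegree := by
  have : LinearMap.range (LinearMap.mulLeft F (AdjoinRoot.mk (d * h) d)) =
      LinearMap.range (AdjoinRoot.mulMap d hh) := by
    ext x
    constructor
    · rintro ⟨a, rfl⟩
      obtain ⟨r, rfl⟩ := AdjoinRoot.mk_surjective a
      exact ⟨AdjoinRoot.mk h r, by rw [AdjoinRoot.mulMap_mk, map_mul, LinearMap.mulLeft_apply]⟩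
    · rintro ⟨a, rfl⟩
      obtain ⟨r, rfl⟩ := AdjoinRoot.mk_surjective a
      exact ⟨AdjoinRoot.mk _ r, by rw [AdjoinRoot.mulMap_mk, map_mul, LinearMap.mulLeft_apply]⟩
  rw [this, LinearMap.finrank_range_of_inj (AdjoinRoot.mulMap_injective hd hh),
    AdjoinRoot.finrank_eq_natDegree hh]

lemma AdjoinRoot.finrank_range_mul_of_isCoprime {d f : F[X]} (hd : IsCoprime d f) (hf : f.Monic) :
    Module.finrank F (LinearMap.range (LinearMap.mulLeft F (AdjoinRoot.mk f d))) =
      f.natDegree := by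
  obtain ⟨u, hu⟩ := AdjoinRoot.isUnit_mk_of_isCoprime hd
  have : LinearMap.range (LinearMap.mulLeft F (AdjoinRoot.mk f d)) = ⊤ := by
    rw [LinearMap.range_eq_top]
    intro x
    exact ⟨(u⁻¹ : (AdjoinRoot f)ˣ) * x, by rw [LinearMap.mulLeft_apply, ← hu, Units.mul_inv_cancel_left]⟩
  rw [this, finrank_top, AdjoinRoot.finrank_eq_natDegree hf]

lemma isCoprime_of_monic_irreducible {p q : F[X]} (hp : p.Monic) (hq : q.Monic)
    (hpi : Irreducible p) (hqi : Irreducible q) (h : p ≠ q) : IsCoprime p q := by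
  rw [hpi.coprime_iff_not_dvd]
  intro hdvd
  exact h (eq_of_monic_of_associated hp hq (hpi.associated_of_dvd hqi hdvd))

open Classical in
lemma finrank_range_pow_block {x : F[X] × ℕ} (hx : IsBlock x) {p : F[X]} (hp : p.Monic)
    (hpi : Irreducible p) (k : ℕ) :
    Module.finrank F (LinearMap.range (LinearMap.mulLeft F (AdjoinRoot.mk (x.1 ^ x.2) (p ^ k)))) =
      if x.1 = p then (x.2 - k) * p.natDegree else x.2 * x.1.natDegree := by
  obtain ⟨r, e⟩ := x
  simp only
  split_ifs with h
  · subst h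
    rcases le_total k e with hk | hk
    · obtain ⟨j, rfl⟩ := Nat.exists_eq_add_of_le hk
      rw [pow_add, AdjoinRoot.finrank_range_mul (pow_ne_zero _ hp.ne_zero) (hp.pow j),
        natDegree_pow, Nat.add_sub_cancel_left]
    · have : AdjoinRoot.mk (r ^ e) (r ^ k) = 0 := AdjoinRoot.mk_eq_zero.2 (pow_dvd_pow r hk)
      rw [this, LinearMap.mulLeft_zero_eq_zero, LinearMap.range_zero, finrank_bot,
        Nat.sub_eq_zero_of_le hk, zero_mul]
  · rw [AdjoinRoot.finrank_range_mul_of_isCoprime _ (hx.1.pow e), natDegree_pow]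
    exact (isCoprime_of_monic_irreducible hp hx.1 hpi hx.2.1 (Ne.symm h)).pow

lemma finrank_range_pi {ι : Type*} [Fintype ι] {M : ι → Type*} [∀ i, AddCommGroup (M i)]
    [∀ i, Module F (M i)] [∀ i, FiniteDimensional F (M i)] (f : ∀ i, M i →ₗ[F] M i) :
    Module.finrank F (LinearMap.range (LinearMap.pi fun i => (f i).comp (LinearMap.proj i))) =
      ∑ i, Module.finrank F (LinearMap.range (f i)) := by
  let inc : (∀ i, LinearMap.range (f i)) →ₗ[F] (∀ i, M i) :=
    LinearMap.pi fun i => (LinearMap.range (f i)).subtype.comp (LinearMap.proj i)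
  have hinj : Function.Injective inc := by
    intro x y hxy
    ext i
    exact congr_fun hxy i
  have hr : LinearMap.range (LinearMap.pi fun i => (f i).comp (LinearMap.proj i)) =
      LinearMap.range inc := by
    ext x
    constructor
    · rintro ⟨y, rfl⟩
      exact ⟨fun i => ⟨f i (y i), y i, rfl⟩, rfl⟩
    · rintro ⟨y, rfl⟩
      choose z hz using fun i => (y i).2
      exact ⟨z, funext hz⟩
  rw [hr, LinearMap.finrank_range_of_inj hinj, Module.finrank_pi_fintype]

variable {V : Type*} [AddCommGroup V] [Module F V]

lemma HasType.finrank_eq {g : V →ₗ[F] V} {S : Multiset (F[X] × ℕ)} (hS : ∀ x ∈ S, IsBlock x)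
    (hg : HasType g S) :
    Module.finrank F V = (S.map fun x => x.2 * x.1.natDegree).sum := by
  obtain ⟨k, a, rfl, φ, hφ⟩ := hg
  have hB : ∀ i, IsBlock (a i) := fun i => hS _ (Multiset.mem_map_of_mem a (Finset.mem_univ i))
  have hfin : ∀ i, FiniteDimensional F (AdjoinRoot ((a i).1 ^ (a i).2)) :=
    fun i => ((hB i).1.pow _).finite_adjoinRoot
  rw [φ.finrank_eq, Module.finrank_pi_fintype, Multiset.map_map]
  exact Finset.sum_congr rfl fun i _ => by
    rw [AdjoinRoot.finrank_eq_natDegree ((hB i).1.pow _), natDegree_pow]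
    rfl

open Classical in
lemma HasType.finrank_range_aeval {g : V →ₗ[F] V} {S : Multiset (F[X] × ℕ)}
    (hS : ∀ x ∈ S, IsBlock x) (hg : HasType g S) {p : F[X]} (hp : p.Monic)
    (hpi : Irreducible p) (j : ℕ) :
    Module.finrank F (LinearMap.range (aeval g (p ^ j))) =
      (S.map fun x => if x.1 = p then (x.2 - j) * p.natDegree else x.2 * x.1.natDegree).sum := by
  obtain ⟨k, a, rfl, φ, hφ⟩ := hg
  have hB : ∀ i, IsBlock (a i) := fun i => hS _ (Multiset.mem_map_of_mem a (Finset.mem_univ i))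
  have hfin : ∀ i, FiniteDimensional F (AdjoinRoot ((a i).1 ^ (a i).2)) :=
    fun i => ((hB i).1.pow _).finite_adjoinRoot
  have h1 : (LinearMap.range (aeval g (p ^ j))).map (φ : V →ₗ[F] _) =
      LinearMap.range (LinearMap.pi fun i => (LinearMap.mulLeft F
        (AdjoinRoot.mk ((a i).1 ^ (a i).2) (p ^ j))).comp (LinearMap.proj i)) := by
    rw [← LinearMap.range_comp]
    have : (φ : V →ₗ[F] _) ∘ₗ aeval g (p ^ j) = (LinearMap.pi fun i => (LinearMap.mulLeft F
        (AdjoinRoot.mk ((a i).1 ^ (a i).2) (p ^ j))).comp (LinearMap.proj i)) ∘ₗ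
        (φ : V →ₗ[F] _) := by
      ext1 v
      funext i
      exact map_aeval_of_root (g := g) (f := fun i => (a i).1 ^ (a i).2)
        (φ := (φ : V →ₗ[F] _)) hφ (p ^ j) v i
    rw [this, LinearMap.range_comp_of_range_eq_top _ φ.range]
  rw [← LinearEquiv.finrank_map_eq φ, h1, finrank_range_pi, Multiset.map_map]
  exact Finset.sum_congr rfl fun i _ => finrank_range_pow_block (hB i) hp hpi j

/-- The ranks of p(g)^j for all j are invariants of `g`, and they determine how often each (p, e)
occurs. -/
theorem HasType.unique {g : V →ₗ[F] V} {S T : Multiset (F[X] × ℕ)}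
    (hS : ∀ x ∈ S, IsBlock x) (hT : ∀ x ∈ T, IsBlock x) (hgS : HasType g S) (hgT : HasType g T) :
    S = T := by
  classical
  have hcount : ∀ (p : F[X]) (j : ℕ), p.Monic → Irreducible p →
      S.countP (fun x => x.1 = p ∧ j < x.2) = T.countP (fun x => x.1 = p ∧ j < x.2) := by
    intro p j hp hpi
    -- The drop in rank from p(g)^j to p(g)^(j+1) is deg p times the number of blocks p^e with e >
    -- j.
    have key : ∀ U : Multiset (F[X] × ℕ),
        (U.map fun x => if x.1 = p then (x.2 - j) * p.natDegree else x.2 * x.1.natDegree).sum =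
        (U.map fun x => if x.1 = p then (x.2 - (j + 1)) * p.natDegree
          else x.2 * x.1.natDegree).sum +
          p.natDegree * U.countP (fun x => x.1 = p ∧ j < x.2) := by
      intro U
      induction U using Multiset.induction with
      | empty => simp
      | cons x U ih =>
        rw [Multiset.map_cons, Multiset.sum_cons, ih, Multiset.map_cons, Multiset.sum_cons,
          Multiset.countP_cons]
        by_cases h1 : x.1 = p
        · by_cases h2 : j < x.2
          · have : x.2 - j = x.2 - (j + 1) + 1 := by omega
            simp only [h1, h2, if_true, and_self, this]
            ring
          · have h3 : x.2 - j = 0 := by omega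
            have h4 : x.2 - (j + 1) = 0 := by omega
            simp [h1, h2, h3, h4]
        · simp [h1]
          ring
    have h0 := (hgS.finrank_range_aeval hS hp hpi j).symm.trans
      (hgT.finrank_range_aeval hT hp hpi j)
    have h1 := (hgS.finrank_range_aeval hS hp hpi (j + 1)).symm.trans
      (hgT.finrank_range_aeval hT hp hpi (j + 1))
    rw [key S, key T, h1] at h0
    exact Nat.eq_of_mul_eq_mul_left hpi.natDegree_pos (Nat.add_left_cancel h0)
  -- A second difference isolates the blocks with exponent exactly j + 1.
  have hsplit : ∀ (U : Multiset (F[X] × ℕ)) (p : F[X]) (j : ℕ),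
      U.countP (fun x => x.1 = p ∧ j < x.2) =
        U.countP (fun x => x.1 = p ∧ j + 1 < x.2) + U.count (p, j + 1) := by
    intro U p j
    induction U using Multiset.induction with
    | empty => simp
    | cons x U ih =>
      rw [Multiset.countP_cons, Multiset.countP_cons, Multiset.count_cons, ih]
      by_cases h1 : x.1 = p
      · by_cases h2 : x.2 = j + 1
        · have : (p, j + 1) = x := Prod.ext h1.symm h2.symm
          simp [this, h1, h2]
          omega
        · have h3 : (p, j + 1) ≠ x := fun h => h2 (by rw [← h])
          have h4 : j < x.2 ↔ j + 1 < x.2 := by omega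
          simp only [h1, h3, h4, if_false]
          omega
      · have h3 : (p, j + 1) ≠ x := fun h => h1 (by rw [← h])
        simp [h1, h3]
  ext ⟨p, e⟩
  by_cases hx : IsBlock (p, e)
  · obtain ⟨j, rfl⟩ : ∃ j, e = j + 1 := ⟨e - 1, by have := hx.2.2.2; simp only at this; omega⟩
    have h0 := hcount p j hx.1 hx.2.1
    rw [hsplit S, hsplit T, hcount p (j + 1) hx.1 hx.2.1] at h0
    exact Nat.add_left_cancel h0
  · rw [Multiset.count_eq_zero.2 fun h => hx (hS _ h), Multiset.count_eq_zero.2 fun h => hx (hT _ h)]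

end Rank

/-! ### Determinants of endomorphisms commuting with `g`. -/

section BlockDeterminants

variable {F : Type*} [Field F]

lemma AdjoinRoot.det_mulLeft_root {f : F[X]} (hf : f.Monic) :
    LinearMap.det (LinearMap.mulLeft F (AdjoinRoot.root f)) = (-1) ^ f.natDegree * f.coeff 0 := by
  have h := Algebra.PowerBasis.norm_gen_eq_coeff_zero_minpoly (AdjoinRoot.powerBasis hf.ne_zero)
  rw [AdjoinRoot.minpoly_powerBasis_gen_of_monic hf, AdjoinRoot.powerBasis_gen] at h
  exact h

/-- Multiplicativity along 0 → F[X]/(h) → F[X]/(dh) → F[X]/(d) → 0, where the first map is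
multiplication by d. -/
lemma AdjoinRoot.det_mulLeft_mk_mul {d h : F[X]} (hd : d.Monic) (hh : h.Monic) (b : F[X]) :
    LinearMap.det (LinearMap.mulLeft F (AdjoinRoot.mk (d * h) b)) =
      LinearMap.det (LinearMap.mulLeft F (AdjoinRoot.mk h b)) *
        LinearMap.det (LinearMap.mulLeft F (AdjoinRoot.mk d b)) := by
  have : FiniteDimensional F (AdjoinRoot (d * h)) := (hd.mul hh).finite_adjoinRoot
  have hβ : ∀ r, AdjoinRoot.algHomOfDvd F (d * h) d (dvd_mul_right d h) (AdjoinRoot.mk _ r) =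
      AdjoinRoot.mk d r := by
    intro r
    rw [← AdjoinRoot.aeval_eq, ← aeval_algHom_apply, AdjoinRoot.algHomOfDvd_root,
      AdjoinRoot.aeval_eq]
  apply LinearMap.det_eq_mul_of_exact (AdjoinRoot.mulMap d hh)
    (AdjoinRoot.algHomOfDvd F (d * h) d (dvd_mul_right d h)).toLinearMap
    (AdjoinRoot.mulMap_injective hd.ne_zero hh)
  · intro x
    obtain ⟨r, rfl⟩ := AdjoinRoot.mk_surjective x
    exact ⟨AdjoinRoot.mk _ r, hβ r⟩
  · ext x
    obtain ⟨r, rfl⟩ := AdjoinRoot.mk_surjective x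
    rw [LinearMap.mem_ker, AlgHom.toLinearMap_apply, hβ, AdjoinRoot.mk_eq_zero]
    constructor
    · rintro ⟨y, hy⟩
      obtain ⟨s, rfl⟩ := AdjoinRoot.mk_surjective y
      rw [AdjoinRoot.mulMap_mk, AdjoinRoot.mk_eq_mk] at hy
      have := (dvd_mul_right d h).trans hy
      exact (dvd_sub_right (dvd_mul_right d s)).1 this
    · rintro ⟨s, rfl⟩
      exact ⟨AdjoinRoot.mk h s, AdjoinRoot.mulMap_mk ..⟩
  · intro x
    obtain ⟨r, rfl⟩ := AdjoinRoot.mk_surjective x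
    rw [LinearMap.mulLeft_apply, LinearMap.mulLeft_apply, ← map_mul, AdjoinRoot.mulMap_mk,
      AdjoinRoot.mulMap_mk, ← map_mul]
    congr 1
    ring
  · intro x
    rw [LinearMap.mulLeft_apply, LinearMap.mulLeft_apply, AlgHom.toLinearMap_apply, map_mul, hβ]
    rfl

lemma AdjoinRoot.det_mulLeft_mk_pow {p : F[X]} (hp : p.Monic) (e : ℕ) (b : F[X]) :
    LinearMap.det (LinearMap.mulLeft F (AdjoinRoot.mk (p ^ e) b)) =
      LinearMap.det (LinearMap.mulLeft F (AdjoinRoot.mk p b)) ^ e := by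
  induction e with
  | zero =>
    have : Subsingleton (AdjoinRoot (p ^ 0)) := by
      rw [← subsingleton_iff_zero_eq_one, eq_comm, ← map_one (AdjoinRoot.mk (p ^ 0)),
        AdjoinRoot.mk_eq_zero, pow_zero]
    rw [LinearMap.det_eq_one_of_subsingleton, pow_zero]
  | succ e ih => rw [pow_succ p e, AdjoinRoot.det_mulLeft_mk_mul (hp.pow e) hp, ih, pow_succ']

variable {V : Type*} [AddCommGroup V] [Module F V]

lemma HasBlocks.det_eq {g : V →ₗ[F] V} {ι : Type*} [Fintype ι] {f : ι → F[X]}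
    (hf : ∀ i, (f i).Monic) (hg : HasBlocks g f) :
    LinearMap.det g = ∏ i, ((-1) ^ (f i).natDegree * (f i).coeff 0) := by
  obtain ⟨φ, hφ⟩ := hg
  have hfin : ∀ i, FiniteDimensional F (AdjoinRoot (f i)) := fun i => (hf i).finite_adjoinRoot
  rw [LinearMap.det_eq_of_equiv φ g (LinearMap.pi fun i => (LinearMap.mulLeft F
    (AdjoinRoot.root (f i))).comp (LinearMap.proj i)) (fun v => funext fun i => hφ v i),
    LinearMap.det_pi_dep]
  exact Finset.prod_congr rfl fun i _ => AdjoinRoot.det_mulLeft_root (hf i)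

lemma HasType.det_eq {g : V →ₗ[F] V} {S : Multiset (F[X] × ℕ)} (hS : ∀ x ∈ S, IsBlock x)
    (hg : HasType g S) :
    LinearMap.det g = (S.map fun x => ((-1) ^ x.1.natDegree * x.1.coeff 0) ^ x.2).prod := by
  obtain ⟨k, a, rfl, h⟩ := hg
  have hB : ∀ i, IsBlock (a i) := fun i => hS _ (Multiset.mem_map_of_mem a (Finset.mem_univ i))
  rw [h.det_eq fun i => (hB i).1.pow _, Multiset.map_map]
  refine Finset.prod_congr rfl fun i _ => ?_
  simp only [Function.comp_apply]
  rw [natDegree_pow, coeff_zero_eq_eval_zero, eval_pow, ← coeff_zero_eq_eval_zero, mul_pow,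
    ← pow_mul, mul_comm (a i).2]

lemma Multiset.exists_fin_map_eq {α : Type*} (S : Multiset α) :
    ∃ (k : ℕ) (a : Fin k → α), Finset.univ.val.map a = S := by
  induction S using Quotient.inductionOn with
  | h l =>
    refine ⟨l.length, l.get, ?_⟩
    rw [Fin.univ_val_map, List.ofFn_get]
    rfl

lemma exists_of_blocks {S : Multiset (F[X] × ℕ)} (hS : ∀ x ∈ S, IsBlock x) [FiniteDimensional F V]
    (hn : (S.map fun x => x.2 * x.1.natDegree).sum = Module.finrank F V) :
    ∃ g : V ≃ₗ[F] V, HasType (g : V →ₗ[F] V) S := by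
  obtain ⟨k, a, rfl⟩ := Multiset.exists_fin_map_eq S
  have hB : ∀ i, IsBlock (a i) := fun i => hS _ (Multiset.mem_map_of_mem a (Finset.mem_univ i))
  have hfin : ∀ i, FiniteDimensional F (AdjoinRoot ((a i).1 ^ (a i).2)) :=
    fun i => ((hB i).1.pow _).finite_adjoinRoot
  have hrank : Module.finrank F (∀ i, AdjoinRoot ((a i).1 ^ (a i).2)) = Module.finrank F V := by
    rw [← hn, Module.finrank_pi_fintype, Multiset.map_map]
    exact Finset.sum_congr rfl fun i _ => by
      rw [AdjoinRoot.finrank_eq_natDegree ((hB i).1.pow _), natDegree_pow]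
      rfl
  let φ := LinearEquiv.ofFinrankEq _ _ hrank
  choose u hu using fun i => AdjoinRoot.isUnit_root (hB i).coeff_zero_pow
  let M : (∀ i, AdjoinRoot ((a i).1 ^ (a i).2)) ≃ₗ[F] (∀ i, AdjoinRoot ((a i).1 ^ (a i).2)) :=
    LinearEquiv.piCongrRight fun i => LinearEquiv.ofLinearMap
      (LinearMap.mulLeft F (u i : AdjoinRoot ((a i).1 ^ (a i).2)))
      (LinearMap.mulLeft F ((u i)⁻¹ : (AdjoinRoot ((a i).1 ^ (a i).2))ˣ))
      (by ext1 x; simp) (by ext1 x; simp)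
  refine ⟨φ.symm.trans (M.trans φ), k, a, rfl, φ.symm, fun v i => ?_⟩
  simp only [LinearEquiv.coe_coe, LinearEquiv.trans_apply, LinearEquiv.symm_apply_apply]
  rw [← hu]
  rfl

/-- Componentwise multiplication by polynomials gives endomorphisms commuting with `g`. -/
lemma HasType.exists_commute_det_eq {g : V →ₗ[F] V} {S : Multiset (F[X] × ℕ)}
    (hS : ∀ x ∈ S, IsBlock x) (hg : HasType g S) {x : F[X] × ℕ} (hx : x ∈ S) (b : F[X]) :
    ∃ c : V →ₗ[F] V, Commute c g ∧
      LinearMap.det c = LinearMap.det (LinearMap.mulLeft F (AdjoinRoot.mk x.1 b)) ^ x.2 := by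
  classical
  obtain ⟨k, a, rfl, φ, hφ⟩ := hg
  have hB : ∀ i, IsBlock (a i) := fun i => hS _ (Multiset.mem_map_of_mem a (Finset.mem_univ i))
  have hfin : ∀ i, FiniteDimensional F (AdjoinRoot ((a i).1 ^ (a i).2)) :=
    fun i => ((hB i).1.pow _).finite_adjoinRoot
  obtain ⟨i₀, -, rfl⟩ := Multiset.mem_map.1 hx
  let q : Fin k → F[X] := fun i => if i = i₀ then b else 1
  let M : (∀ i, AdjoinRoot ((a i).1 ^ (a i).2)) →ₗ[F] (∀ i, AdjoinRoot ((a i).1 ^ (a i).2)) :=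
    LinearMap.pi fun i => (LinearMap.mulLeft F (AdjoinRoot.mk _ (q i))).comp (LinearMap.proj i)
  refine ⟨φ.symm.toLinearMap ∘ₗ M ∘ₗ φ.toLinearMap, ?_, ?_⟩
  · ext1 v
    apply φ.injective
    funext i
    simp only [Module.End.mul_apply, LinearMap.comp_apply, LinearEquiv.coe_coe,
      LinearEquiv.apply_symm_apply, hφ]
    change AdjoinRoot.mk ((a i).1 ^ (a i).2) (q i) * φ (g v) i =
      AdjoinRoot.root ((a i).1 ^ (a i).2) * (AdjoinRoot.mk ((a i).1 ^ (a i).2) (q i) * φ v i)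
    rw [hφ, mul_left_comm]
  · rw [LinearMap.det_eq_of_equiv φ _ M (fun v => by simp), LinearMap.det_pi_dep,
      Finset.prod_eq_single i₀]
    · simp only [q, if_true]
      exact AdjoinRoot.det_mulLeft_mk_pow (hB i₀).1 _ _
    · intro i _ hi
      simp only [q, hi, if_false, map_one]
      rw [LinearMap.mulLeft_one, LinearMap.det_id]
    · simp

/-- The norm from the finite field F[X]/(p) to `F` is surjective. Multiplying the single summand
F[X]/(p^e) by a lift of an element of norm a gives determinant a^e. -/
lemma HasType.exists_commute_det_eq_pow [Finite F] {g : V →ₗ[F] V} {S : Multiset (F[X] × ℕ)}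
    (hS : ∀ x ∈ S, IsBlock x) (hg : HasType g S) {x : F[X] × ℕ} (hx : x ∈ S) (a : F) :
    ∃ c : V →ₗ[F] V, Commute c g ∧ LinearMap.det c = a ^ x.2 := by
  have hxB := hS x hx
  have : Fact (Irreducible x.1) := ⟨hxB.2.1⟩
  have : FiniteDimensional F (AdjoinRoot x.1) := hxB.1.finite_adjoinRoot
  have : Finite (AdjoinRoot x.1) := Module.finite_of_finite F
  obtain ⟨y, hy⟩ := FiniteField.norm_surjective F (AdjoinRoot x.1) a
  obtain ⟨b, rfl⟩ := AdjoinRoot.mk_surjective y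
  obtain ⟨c, hc, hdet⟩ := hg.exists_commute_det_eq hS hx b
  refine ⟨c, hc, ?_⟩
  rw [hdet, ← hy]
  rfl

/-- In F[X]/(p^e) the kernel of p is generated by p^(e-1), and Q acts invertibly. So a multiple of
(pQ)^k killed by pQ is already a multiple of (pQ)^(k+1), unless k is exactly e - 1. -/
lemma AdjoinRoot.exists_mul_pow_eq {p Q : F[X]} (hp : p ≠ 0) (hQ : IsCoprime Q p) {e k : ℕ}
    (hek : e ≠ k + 1) {y : AdjoinRoot (p ^ e)} (hy : AdjoinRoot.mk (p ^ e) (p * Q) ^ (k + 1) * y = 0) :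
    ∃ z, AdjoinRoot.mk (p ^ e) (p * Q) ^ k * y = AdjoinRoot.mk (p ^ e) (p * Q) ^ (k + 1) * z := by
  obtain ⟨r, rfl⟩ := AdjoinRoot.mk_surjective y
  rw [← map_pow, ← map_mul, AdjoinRoot.mk_eq_zero, mul_pow, mul_right_comm] at hy
  have h1 : p ^ e ∣ p ^ (k + 1) * r := (hQ.symm.pow).dvd_of_dvd_mul_right hy
  rcases lt_or_ge e (k + 1) with h | h
  · refine ⟨0, ?_⟩
    rw [mul_zero, ← map_pow, ← map_mul, AdjoinRoot.mk_eq_zero, mul_pow, mul_assoc]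
    exact (pow_dvd_pow p (by omega)).trans (dvd_mul_right _ _)
  · obtain ⟨j, rfl⟩ : ∃ j, e = k + 1 + (j + 1) := ⟨e - (k + 2), by omega⟩
    rw [pow_add, mul_dvd_mul_iff_left (pow_ne_zero _ hp)] at h1
    obtain ⟨s, rfl⟩ := (dvd_pow_self p j.succ_ne_zero).trans h1
    obtain ⟨u, hu⟩ := AdjoinRoot.isUnit_mk_of_isCoprime
      (hQ.pow_right : IsCoprime Q (p ^ (k + 1 + (j + 1))))
    refine ⟨((u⁻¹ : (AdjoinRoot (p ^ (k + 1 + (j + 1))))ˣ) : AdjoinRoot (p ^ (k + 1 + (j + 1)))) *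
      AdjoinRoot.mk _ s, ?_⟩
    rw [pow_succ, mul_assoc, map_mul, map_mul, ← hu]
    congr 1
    rw [mul_assoc, Units.mul_inv_cancel_left]

/-- For P the product of the distinct primes occurring, P(g) is nilpotent, commutes with `c`, and
its layers ker ∩ range jump only at exponents of blocks. These are all multiples of m, so
`LinearMap.exists_det_eq_pow` applies. -/
theorem HasType.det_eq_pow_of_commute [FiniteDimensional F V] {g : V →ₗ[F] V}
    {S : Multiset (F[X] × ℕ)} (hS : ∀ x ∈ S, IsBlock x) (hg : HasType g S) {m : ℕ} (hm : 0 < m)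
    (hdvd : ∀ x ∈ S, m ∣ x.2) {c : V →ₗ[F] V} (hc : Commute c g) :
    ∃ a : F, LinearMap.det c = a ^ m := by
  classical
  obtain ⟨k, a, rfl, φ, hφ⟩ := hg
  have hB : ∀ i, IsBlock (a i) := fun i => hS _ (Multiset.mem_map_of_mem a (Finset.mem_univ i))
  let P : F[X] := ∏ p ∈ Finset.univ.image fun i => (a i).1, p
  have hP : ∀ i, ∃ Q, P = (a i).1 * Q ∧ IsCoprime Q (a i).1 := by
    intro i
    refine ⟨_, (Finset.mul_prod_erase _ (fun p => p)
      (Finset.mem_image_of_mem (fun i => (a i).1) (Finset.mem_univ i))).symm, ?_⟩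
    apply IsCoprime.prod_left
    intro p hp
    obtain ⟨hne, hp⟩ := Finset.mem_erase.1 hp
    obtain ⟨j, -, rfl⟩ := Finset.mem_image.1 hp
    exact isCoprime_of_monic_irreducible (hB j).1 (hB i).1 (hB j).2.1 (hB i).2.1 hne
  have hφP : ∀ (j : ℕ) v i, φ (((aeval g P) ^ j) v) i =
      AdjoinRoot.mk ((a i).1 ^ (a i).2) P ^ j * φ v i := by
    intro j v i
    rw [← map_pow, ← map_pow]
    exact map_aeval_of_root (g := g) (f := fun i => (a i).1 ^ (a i).2)
      (φ := (φ : V →ₗ[F] _)) hφ (P ^ j) v i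
  have hcT : Commute c (aeval g P) := by
    clear_value P
    clear hφP hP
    induction P using Polynomial.induction_on' with
    | add p q hp hq => rw [map_add]; exact hp.add_right hq
    | monomial k r =>
      rw [aeval_monomial]
      exact (Algebra.commute_algebraMap_right r c).mul_right (hc.pow_right k)
  -- The sum of all exponents is a crude but sufficient bound for the nilpotency index.
  apply LinearMap.exists_det_eq_pow hcT (N := ∑ i, (a i).2) hm
  · ext1 v
    apply φ.injective
    funext i
    rw [hφP, LinearMap.zero_apply, map_zero]
    have : AdjoinRoot.mk ((a i).1 ^ (a i).2) P ^ (∑ i, (a i).2) = 0 := by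
      rw [← map_pow, AdjoinRoot.mk_eq_zero]
      obtain ⟨Q, hQ, -⟩ := hP i
      rw [hQ, mul_pow]
      exact (pow_dvd_pow _ (Finset.single_le_sum (f := fun i => (a i).2) (fun _ _ => Nat.zero_le _)
        (Finset.mem_univ i))).trans (dvd_mul_right _ _)
    rw [this]
    exact zero_mul _
  · rintro j hj _ ⟨hx, y, rfl⟩
    have hz : ∀ i, ∃ z, AdjoinRoot.mk ((a i).1 ^ (a i).2) P ^ j * φ y i =
        AdjoinRoot.mk ((a i).1 ^ (a i).2) P ^ (j + 1) * z := by
      intro i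
      obtain ⟨Q, hQ, hcop⟩ := hP i
      rw [hQ]
      apply AdjoinRoot.exists_mul_pow_eq (hB i).1.ne_zero hcop
      · intro h
        exact hj (h ▸ hdvd _ (Multiset.mem_map_of_mem a (Finset.mem_univ i)))
      · rw [← hQ]
        have h1 : (aeval g P ^ (j + 1)) y = 0 := by
          rw [pow_succ', Module.End.mul_apply]
          exact hx
        have h2 := hφP (j + 1) y i
        rw [h1, map_zero] at h2
        exact h2.symm
    choose z hz using hz
    refine ⟨φ.symm z, ?_⟩
    apply φ.injective
    funext i
    rw [hφP, hφP, LinearEquiv.apply_symm_apply]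
    exact (hz i).symm

end BlockDeterminants

/-! ### Involutions of determinant 1 that invert a given endomorphism. -/

section Reversers

variable {F : Type*} [Field F]

lemma LinearMap.det_of_basis_perm {ι : Type*} [Fintype ι] [DecidableEq ι] {V : Type*}
    [AddCommGroup V] [Module F V] (B : Module.Basis ι F V) (σ : Equiv.Perm ι) (τ : V →ₗ[F] V)
    (h : ∀ i, τ (B i) = B (σ i)) : LinearMap.det τ = ((Equiv.Perm.sign σ : ℤ) : F) := by
  rw [← LinearMap.det_toMatrix B]
  have : LinearMap.toMatrix B B τ = (1 : Matrix ι ι F).submatrix σ.symm _root_.id := by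
    ext i j
    rw [LinearMap.toMatrix_apply, h, Module.Basis.repr_self, Matrix.submatrix_apply,
      Matrix.one_apply, Finsupp.single_apply]
    simp only [_root_.id, Equiv.symm_apply_eq, eq_comm (a := i)]
  rw [this, Matrix.det_permute, Matrix.det_one, mul_one, Equiv.Perm.sign_symm]

lemma Fin.sign_revPerm_of_even {m : ℕ} (hm : Even m) :
    Equiv.Perm.sign (Fin.revPerm : Equiv.Perm (Fin m)) = (-1) ^ (m / 2) := by
  rw [Equiv.Perm.sign_of_pow_two_eq_one]
  · have : IsEmpty (Function.fixedPoints (Fin.revPerm : Equiv.Perm (Fin m))) := by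
      constructor
      rintro ⟨i, hi⟩
      have h1 := congrArg Fin.val hi
      rw [Fin.revPerm_apply, Fin.val_rev] at h1
      obtain ⟨k, rfl⟩ := hm
      omega
    rw [Fintype.card_eq_zero (α := Function.fixedPoints (Fin.revPerm : Equiv.Perm (Fin m))),
      Fintype.card_fin, Nat.sub_zero]
  · ext i
    simp [sq]

/-- On `F[X] / (f)` with `f` self-reciprocal, there is a linear involution inverting the root, of
determinant `(-1) ^ (deg f / 2)` if `deg f` is even. -/
lemma AdjoinRoot.exists_reverser {f : F[X]} (hf : f.Monic) (h0 : f.coeff 0 ≠ 0)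
    (hr : recip f = f) :
    ∃ τ : AdjoinRoot f →ₗ[F] AdjoinRoot f, (∀ a, τ (τ a) = a) ∧
      (∀ a, AdjoinRoot.root f * τ (AdjoinRoot.root f * a) = τ a) ∧
      (Even f.natDegree → LinearMap.det τ = (-1) ^ (f.natDegree / 2)) := by
  obtain ⟨φ, hφ⟩ := AdjoinRoot.exists_recipEquiv hf h0
  obtain ⟨u, hu⟩ := AdjoinRoot.isUnit_root h0
  let A := AdjoinRoot f
  let ui : A := (u⁻¹ : (AdjoinRoot f)ˣ)
  have hui : ui * u = 1 := Units.inv_mul u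
  have hiu : (u : A) * ui = 1 := Units.mul_inv u
  let σ : A →ₐ[F] A := φ.toAlgHom.comp (AdjoinRoot.algEquivOfEq F f (recip f) hr.symm).toAlgHom
  have hσu : σ u = ui := by
    have h1 : σ u * u = 1 := by
      have h2 : AdjoinRoot.algEquivOfEq F f (recip f) hr.symm (AdjoinRoot.root f) =
        AdjoinRoot.root (recip f) := AdjoinRoot.algEquivOfEq_root f (recip f) hr.symm
      rw [hu, ← hφ, ← h2]
      rfl
    calc σ u = σ u * (u * ui) := by rw [hiu, mul_one]
      _ = ui := by rw [← mul_assoc, h1, one_mul]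
  have hσui : σ ui = u := by
    have h1 : σ ui * ui = 1 := by
      conv_lhs => rw [← hσu]
      rw [hσu, ← hσu, ← map_mul, hσu, hui, map_one]
    calc σ ui = σ ui * (ui * u) := by rw [hui, mul_one]
      _ = u := by rw [← mul_assoc, h1, one_mul]
  have hσσ : ∀ a, σ (σ a) = a := by
    have : σ.comp σ = AlgHom.id F A := by
      apply AdjoinRoot.algHom_ext
      rw [← hu, AlgHom.comp_apply, hσu, hσui, AlgHom.id_apply]
    exact fun a => DFunLike.congr_fun this a
  -- The involution σ of the algebra inverts the root u. The extra factor u⁻¹ makes τ send u^i to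
  -- u^(-1-i), which fixes no exponent, so that for even degree the determinant depends on the
  -- degree alone.
  let τ : A →ₗ[F] A := (LinearMap.mulLeft F ui).comp σ.toLinearMap
  have hτ : ∀ a, τ a = ui * σ a := fun a => rfl
  refine ⟨τ, fun a => ?_, fun a => ?_, fun hev => ?_⟩
  · rw [hτ, hτ, map_mul, hσσ, hσui, ← mul_assoc, hui, one_mul]
  · rw [← hu, hτ, hτ, map_mul, hσu, ← mul_assoc, hiu, one_mul]
  · let pb := AdjoinRoot.powerBasis' hf
    have hdim : pb.dim = f.natDegree := rfl
    let k := f.natDegree / 2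
    let e : A ≃ₗ[F] A := LinearEquiv.ofLinearMap (LinearMap.mulLeft F (ui ^ k))
      (LinearMap.mulLeft F ((u : A) ^ k))
      (by ext1 x; simp only [LinearMap.comp_apply, LinearMap.mulLeft_apply, LinearMap.id_apply]; rw [← mul_assoc, ← mul_pow, hui, one_pow, one_mul])
      (by ext1 x; simp only [LinearMap.comp_apply, LinearMap.mulLeft_apply, LinearMap.id_apply]; rw [← mul_assoc, ← mul_pow, hiu, one_pow, one_mul])
    -- With k half the degree, the basis u^(-k), …, u^(k-1) is symmetric under i ↦ -1-i, so τ
    -- reverses it.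
    let B : Module.Basis (Fin f.natDegree) F A := pb.basis.map e
    have hB : ∀ i : Fin f.natDegree, B i = ui ^ k * (u : A) ^ (i : ℕ) := by
      intro i
      have h1 := pb.basis_eq_pow i
      rw [AdjoinRoot.powerBasis'_gen, ← hu] at h1
      exact congrArg (ui ^ k * ·) h1
    rw [LinearMap.det_of_basis_perm B Fin.revPerm τ, Fin.sign_revPerm_of_even hev]
    · simp
    · intro i
      rw [hτ, hB, hB, map_mul, map_pow, map_pow, hσu, hσui, Fin.revPerm_apply, Fin.val_rev]
      have hk : f.natDegree = k + k := by
        obtain ⟨j, hj⟩ := hev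
        simp only [k]
        omega
      have hi := i.2
      have hinv : ∀ a b : ℕ, a ≤ b → ui ^ a * (u : A) ^ b = (u : A) ^ (b - a) := by
        intro a b hab
        obtain ⟨c, rfl⟩ := Nat.exists_eq_add_of_le hab
        rw [pow_add, ← mul_assoc, ← mul_pow, hui, one_pow, one_mul, Nat.add_sub_cancel_left]
      -- Multiplying by a high enough power of u clears all inverses before the two sides are
      -- compared.
      have hcancel : ∀ x y : A, (u : A) ^ (k + 1 + i) * x = (u : A) ^ (k + 1 + i) * y → x = y := by
        intro x y hxy
        have := congrArg (fun z => ui ^ (k + 1 + i) * z) hxy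
        simpa only [← mul_assoc, hinv _ _ le_rfl, Nat.sub_self, pow_zero, one_mul] using this
      apply hcancel
      have e1 : (u : A) ^ (k + 1 + i) * (ui * ((u : A) ^ k * ui ^ (i : ℕ))) =
          (u : A) ^ k * ((ui * u) * (ui * u) ^ (i : ℕ) * u ^ k) := by
        rw [pow_add, pow_add, mul_pow]; ring
      have e2 : (u : A) ^ (k + 1 + i) * (ui ^ k * (u : A) ^ (f.natDegree - (i + 1))) =
          (ui * u) ^ k * (u : A) ^ (k + k) := by
        have h1 : (u : A) ^ (k + 1 + i) * (u : A) ^ (f.natDegree - (i + 1)) =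
            (u : A) ^ k * (u : A) ^ (k + k) := by
          rw [← pow_add, ← pow_add]
          congr 1
          omega
        rw [mul_left_comm, h1, mul_pow, mul_assoc]
      rw [e1, e2, hui, one_pow, one_mul, one_pow, one_mul, one_mul, pow_add]

/-- A form of the Chinese remainder theorem: the diagonal map from ∏ F[X]/(f'_t) to ∏ F[X]/(f_i) is
injective by the lcm condition, hence bijective because the dimensions agree. -/
lemma HasBlocks.merge {V : Type*} [AddCommGroup V] [Module F V] {g : V →ₗ[F] V} {ι κ : Type*}
    [Fintype ι] [Fintype κ] {f : ι → F[X]} {f' : κ → F[X]} (hf : ∀ i, (f i).Monic)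
    (hf' : ∀ t, (f' t).Monic) (π : ι → κ) (hdvd : ∀ i, f i ∣ f' (π i))
    (hlcm : ∀ t r, (∀ i, π i = t → f i ∣ r) → f' t ∣ r)
    (hdeg : ∑ i, (f i).natDegree = ∑ t, (f' t).natDegree) (hg : HasBlocks g f) :
    HasBlocks g f' := by
  obtain ⟨φ, hφ⟩ := hg
  have hfin : ∀ i, FiniteDimensional F (AdjoinRoot (f i)) := fun i => (hf i).finite_adjoinRoot
  have hfin' : ∀ i, FiniteDimensional F (AdjoinRoot (f' i)) := fun i => (hf' i).finite_adjoinRoot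
  let Ψ : (∀ t, AdjoinRoot (f' t)) →ₗ[F] (∀ i, AdjoinRoot (f i)) := LinearMap.pi fun i =>
    (AdjoinRoot.algHomOfDvd F _ _ (hdvd i)).toLinearMap.comp (LinearMap.proj (π i))
  have hΨ : ∀ w i, Ψ w i = AdjoinRoot.algHomOfDvd F _ _ (hdvd i) (w (π i)) := fun w i => rfl
  have hmk : ∀ i r, AdjoinRoot.algHomOfDvd F _ _ (hdvd i) (AdjoinRoot.mk _ r) =
      AdjoinRoot.mk (f i) r := by
    intro i r
    rw [← AdjoinRoot.aeval_eq, ← aeval_algHom_apply, AdjoinRoot.algHomOfDvd_root,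
      AdjoinRoot.aeval_eq]
  have hinj : Function.Injective Ψ := by
    rw [injective_iff_map_eq_zero]
    intro w hw
    funext t
    obtain ⟨r, hr⟩ := AdjoinRoot.mk_surjective (w t)
    rw [← hr, Pi.zero_apply, AdjoinRoot.mk_eq_zero]
    apply hlcm
    rintro i rfl
    have h1 := congr_fun hw i
    rwa [hΨ, ← hr, hmk, Pi.zero_apply, AdjoinRoot.mk_eq_zero] at h1
  have hrank : Module.finrank F (∀ t, AdjoinRoot (f' t)) =
      Module.finrank F (∀ i, AdjoinRoot (f i)) := by
    rw [Module.finrank_pi_fintype, Module.finrank_pi_fintype]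
    simp only [AdjoinRoot.finrank_eq_natDegree (hf _), AdjoinRoot.finrank_eq_natDegree (hf' _)]
    exact hdeg.symm
  let E := LinearEquiv.ofInjectiveOfFinrankEq Ψ hinj hrank
  have hE : ∀ w, E w = Ψ w := fun w => rfl
  refine ⟨φ.trans E.symm, ?_⟩
  have key : ∀ v, E.symm (φ (g v)) = fun t => AdjoinRoot.root (f' t) * E.symm (φ v) t := by
    intro v
    rw [LinearEquiv.symm_apply_eq]
    funext i
    rw [hφ, hE, hΨ, map_mul, AdjoinRoot.algHomOfDvd_root]
    congr 1
    rw [← hΨ, ← hE, LinearEquiv.apply_symm_apply]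
  exact fun v t => congr_fun (key v) t

lemma HasBlocks.exists_reverser {V : Type*} [AddCommGroup V] [Module F V] {g : V →ₗ[F] V}
    {ι : Type*} [Fintype ι] {f : ι → F[X]} (hf : ∀ i, (f i).Monic)
    (h0 : ∀ i, (f i).coeff 0 ≠ 0) (hr : ∀ i, recip (f i) = f i) (hg : HasBlocks g f)
    (hdeg : 4 ∣ ∑ i, (f i).natDegree) :
    ∃ τ : V →ₗ[F] V, τ * τ = 1 ∧ g * τ * g = τ ∧ LinearMap.det τ = 1 := by
  classical
  have hfin : ∀ i, FiniteDimensional F (AdjoinRoot (f i)) := fun i => (hf i).finite_adjoinRoot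
  choose τ hτ hτr hτd using fun i => AdjoinRoot.exists_reverser (hf i) (h0 i) (hr i)
  have hsq : ∀ i, LinearMap.det (τ i) ^ 2 = 1 := by
    intro i
    have : τ i ∘ₗ τ i = LinearMap.id := LinearMap.ext (hτ i)
    rw [sq, ← LinearMap.det_comp, this, LinearMap.det_id]
  -- Replacing a τ_i by its negative keeps it an involution that inverts the root. If the total
  -- determinant is -1, one sign change on a summand of odd degree corrects it. If all degrees are
  -- even, the determinant is -1 to half the total degree, which is even because 4 divides the
  -- total.
  have hD : ∃ ε : ι → F, (∀ i, ε i ^ 2 = 1) ∧ ∏ i, LinearMap.det (ε i • τ i) = 1 := by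
    have hD2 : (∏ i, LinearMap.det (τ i)) ^ 2 = 1 := by
      rw [← Finset.prod_pow, Finset.prod_eq_one fun i _ => hsq i]
    rcases sq_eq_one_iff.1 hD2 with h | h
    · exact ⟨1, by simp, by simpa using h⟩
    · by_cases hodd : ∃ i₀, Odd (f i₀).natDegree
      · obtain ⟨i₀, hi₀⟩ := hodd
        refine ⟨fun i => if i = i₀ then -1 else 1, fun i => by beta_reduce; split_ifs <;> simp, ?_⟩
        simp only [LinearMap.det_smul, AdjoinRoot.finrank_eq_natDegree (hf _)]
        rw [Finset.prod_mul_distrib, h, Finset.prod_eq_single i₀ (fun i _ hi => by simp [hi])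
          (by simp), if_pos rfl, hi₀.neg_one_pow]
        ring
      · push Not at hodd
        simp only [Nat.not_odd_iff_even] at hodd
        refine ⟨1, by simp, ?_⟩
        simp only [Pi.one_apply, one_smul]
        rw [Finset.prod_congr rfl fun i _ => hτd i (hodd i), Finset.prod_pow_eq_pow_sum]
        apply Even.neg_one_pow
        have h2 : ∑ i, (f i).natDegree = 2 * ∑ i, (f i).natDegree / 2 := by
          rw [Finset.mul_sum]
          exact Finset.sum_congr rfl fun i _ => (Nat.mul_div_cancel' (hodd i).two_dvd).symm
        rw [h2] at hdeg
        rw [even_iff_two_dvd]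
        omega
  obtain ⟨ε, hε, hεD⟩ := hD
  obtain ⟨φ, hφ⟩ := hg
  let M : (∀ i, AdjoinRoot (f i)) →ₗ[F] (∀ i, AdjoinRoot (f i)) :=
    LinearMap.pi fun i => (ε i • τ i).comp (LinearMap.proj i)
  have hM : ∀ w i, M w i = ε i • τ i (w i) := fun w i => rfl
  refine ⟨φ.symm.toLinearMap ∘ₗ M ∘ₗ φ.toLinearMap, ?_, ?_, ?_⟩
  · ext1 v
    apply φ.injective
    funext i
    simp only [Module.End.mul_apply, LinearMap.comp_apply, LinearEquiv.coe_coe,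
      LinearEquiv.apply_symm_apply, hM, map_smul, hτ, smul_smul, Module.End.one_apply]
    rw [← sq, hε, one_smul]
  · ext1 v
    apply φ.injective
    funext i
    simp only [Module.End.mul_apply, LinearMap.comp_apply, LinearEquiv.coe_coe,
      LinearEquiv.apply_symm_apply, hM, hφ, mul_smul_comm, hτr]
  · rw [LinearMap.det_eq_of_equiv φ _ M (fun v => by simp), LinearMap.det_pi_dep, hεD]

lemma exists_self_reciprocal_split {S : Multiset (F[X] × ℕ)} (hS : ∀ x ∈ S, IsBlock x)
    (hr : S.map recipBlock = S) : ∃ A T : Multiset (F[X] × ℕ), S = A + (T + T.map recipBlock) ∧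
      (∀ x ∈ A, recipBlock x = x) ∧ ∀ x ∈ T, recipBlock x ≠ x := by
  classical
  induction S using Multiset.strongInductionOn with
  | ih S ih =>
    rcases Multiset.empty_or_exists_mem S with rfl | ⟨x, hx⟩
    · exact ⟨0, 0, by simp⟩
    · obtain ⟨S', rfl⟩ := Multiset.exists_cons_of_mem hx
      by_cases hxx : recipBlock x = x
      · rw [Multiset.map_cons, hxx, Multiset.cons_inj_right] at hr
        obtain ⟨A, T, rfl, hA, hT⟩ := ih S' (Multiset.lt_cons_self _ _)
          (fun y hy => hS y (Multiset.mem_cons_of_mem hy)) hr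
        refine ⟨x ::ₘ A, T, by rw [Multiset.cons_add], ?_, hT⟩
        intro y hy
        rcases Multiset.mem_cons.1 hy with rfl | hy
        exacts [hxx, hA y hy]
      · have hmem : recipBlock x ∈ S' := by
          have : recipBlock x ∈ x ::ₘ S' := hr ▸ Multiset.mem_map_of_mem _ hx
          exact (Multiset.mem_cons.1 this).resolve_left hxx
        obtain ⟨S'', rfl⟩ := Multiset.exists_cons_of_mem hmem
        rw [Multiset.map_cons, Multiset.map_cons, (hS x hx).recipBlock_recipBlock,
          Multiset.cons_swap, Multiset.cons_inj_right, Multiset.cons_inj_right] at hr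
        obtain ⟨A, T, rfl, hA, hT⟩ := ih S'' ((Multiset.lt_cons_self _ _).trans
          (Multiset.lt_cons_self _ _))
          (fun y hy => hS y (Multiset.mem_cons_of_mem (Multiset.mem_cons_of_mem hy))) hr
        refine ⟨A, x ::ₘ T, ?_, hA, ?_⟩
        · simp only [Multiset.map_cons, Multiset.cons_add, Multiset.add_cons]
          rw [Multiset.cons_swap]
        · intro y hy
          rcases Multiset.mem_cons.1 hy with rfl | hy
          exacts [hxx, hT y hy]

lemma Multiset.map_univ_sumElim {α β γ : Type*} [Fintype α] [Fintype β] (a : α → γ) (b : β → γ) :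
    Finset.univ.val.map (Sum.elim a b) = Finset.univ.val.map a + Finset.univ.val.map b := by
  rw [← Finset.univ_disjSum_univ, Finset.val_disjSum, Multiset.disjSum, Multiset.map_add,
    Multiset.map_map, Multiset.map_map]
  rfl

/-- A block equal to its reciprocal is self-reciprocal by itself. Any other p^e is coprime to (recip
p)^e, and the two merge into one cyclic summand with self-reciprocal modulus. -/
theorem HasType.exists_reverser {V : Type*} [AddCommGroup V] [Module F V] {g : V →ₗ[F] V}
    {S : Multiset (F[X] × ℕ)} (hS : ∀ x ∈ S, IsBlock x) (hr : S.map recipBlock = S)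
    (hg : HasType g S) (h4 : 4 ∣ Module.finrank F V) :
    ∃ τ : V →ₗ[F] V, τ * τ = 1 ∧ g * τ * g = τ ∧ LinearMap.det τ = 1 := by
  rw [hg.finrank_eq hS] at h4
  obtain ⟨A, T, rfl, hA, hT⟩ := exists_self_reciprocal_split hS hr
  obtain ⟨k, a, rfl⟩ := Multiset.exists_fin_map_eq A
  obtain ⟨l, b, rfl⟩ := Multiset.exists_fin_map_eq T
  have ha : ∀ i, IsBlock (a i) := fun i => hS _ (Multiset.mem_add.2 (Or.inl
    (Multiset.mem_map_of_mem a (Finset.mem_univ i))))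
  have hb : ∀ i, IsBlock (b i) := fun i => hS _ (Multiset.mem_add.2 (Or.inr (Multiset.mem_add.2
    (Or.inl (Multiset.mem_map_of_mem b (Finset.mem_univ i))))))
  let w : Fin k ⊕ (Fin l ⊕ Fin l) → F[X] × ℕ :=
    Sum.elim a (Sum.elim b fun j => recipBlock (b j))
  let f : Fin k ⊕ (Fin l ⊕ Fin l) → F[X] := fun i => (w i).1 ^ (w i).2
  let f' : Fin k ⊕ Fin l → F[X] := Sum.elim (fun i => (a i).1 ^ (a i).2)
    (fun j => (b j).1 ^ (b j).2 * (recipBlock (b j)).1 ^ (recipBlock (b j)).2)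
  have hw : Finset.univ.val.map w = Finset.univ.val.map a + (Finset.univ.val.map b +
      (Finset.univ.val.map b).map recipBlock) := by
    rw [Multiset.map_univ_sumElim, Multiset.map_univ_sumElim, Multiset.map_map]
    rfl
  have hgf : HasBlocks g f := hg.hasBlocks hw
  have hwB : ∀ i, IsBlock (w i) := by
    rintro (i | i | i)
    exacts [ha i, hb i, (hb i).recip]
  have hf : ∀ i, (f i).Monic := fun i => (hwB i).1.pow _
  have hf' : ∀ t, (f' t).Monic := by
    rintro (i | i)
    exacts [(ha i).1.pow _, ((hb i).1.pow _).mul ((hb i).recip.1.pow _)]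
  have hdeg : ∑ i, (f i).natDegree = ∑ t, (f' t).natDegree := by
    rw [Fintype.sum_sum_type, Fintype.sum_sum_type, Fintype.sum_sum_type, ← Finset.sum_add_distrib]
    congr 1
    refine Finset.sum_congr rfl fun i _ => ?_
    exact (((hb i).1.pow _).natDegree_mul ((hb i).recip.1.pow _)).symm
  have hgf' : HasBlocks g f' := by
    refine hgf.merge hf hf' (Sum.elim Sum.inl (Sum.elim Sum.inr Sum.inr)) ?_ ?_ hdeg
    · rintro (i | i | i)
      exacts [dvd_rfl, dvd_mul_right _ _, dvd_mul_left _ _]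
    · rintro (i | i) r h
      · exact h (Sum.inl i) rfl
      · refine IsCoprime.mul_dvd ?_ (h (Sum.inr (Sum.inl i)) rfl) (h (Sum.inr (Sum.inr i)) rfl)
        refine (isCoprime_of_monic_irreducible (hb i).1 (hb i).recip.1 (hb i).2.1
          (hb i).recip.2.1 ?_).pow
        intro h
        exact hT (b i) (Multiset.mem_map_of_mem b (Finset.mem_univ i)) (Prod.ext h.symm rfl)
  refine hgf'.exists_reverser hf' ?_ ?_ ?_
  · rintro (i | i)
    · exact (ha i).coeff_zero_pow
    · change (_ * _ : F[X]).coeff 0 ≠ 0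
      rw [mul_coeff_zero]
      exact mul_ne_zero (hb i).coeff_zero_pow (hb i).recip.coeff_zero_pow
  · rintro (i | i)
    · change recip ((a i).1 ^ (a i).2) = (a i).1 ^ (a i).2
      rw [recip_pow]
      congr 1
      exact congrArg Prod.fst (hA (a i) (Multiset.mem_map_of_mem a (Finset.mem_univ i)))
    · change recip ((b i).1 ^ (b i).2 * recip (b i).1 ^ (b i).2) =
        (b i).1 ^ (b i).2 * recip (b i).1 ^ (b i).2
      rw [recip_mul, recip_pow, recip_pow, recip_recip (hb i).1 (hb i).2.2.1, mul_comm]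
  · rw [← hdeg]
    rw [← hw, Multiset.map_map] at h4
    convert h4 using 1
    refine Finset.sum_congr rfl fun i _ => ?_
    rw [natDegree_pow]
    rfl

end Reversers

/-! ### Counting real classes, in a group and in a central quotient. -/

section ClassCounting

variable {G : Type*} [Group G]

lemma IsRealElement.isConj_iff {x : G} : IsRealElement x ↔ IsConj x x⁻¹ := by
  rw [_root_.isConj_iff]; rfl

lemma IsRealElement.of_isConj {x y : G} (hxy : IsConj x y) (hx : IsRealElement x) :
    IsRealElement y := by
  rw [IsRealElement.isConj_iff] at hx ⊢
  obtain ⟨c, rfl⟩ := _root_.isConj_iff.1 hxy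
  refine (hxy.symm.trans hx).trans (_root_.isConj_iff.2 ⟨c, by group⟩)

lemma card_conjugators (g x : G) [Decidable (IsConj g x)] :
    Nat.card {k : G // k * g * k⁻¹ = x} =
      if IsConj g x then Nat.card (Subgroup.centralizer {x}) else 0 := by
  split_ifs with h
  · obtain ⟨k₀, rfl⟩ := isConj_iff.1 h
    refine Nat.card_congr ⟨fun k => ⟨k.1 * k₀⁻¹, ?_⟩, fun c => ⟨c.1 * k₀, ?_⟩, ?_, ?_⟩
    · rw [Subgroup.mem_centralizer_singleton_iff]
      calc k.1 * k₀⁻¹ * (k₀ * g * k₀⁻¹) = k.1 * g * k.1⁻¹ * (k.1 * k₀⁻¹) := by group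
        _ = k₀ * g * k₀⁻¹ * (k.1 * k₀⁻¹) := by rw [k.2]
    · have hc := Subgroup.mem_centralizer_singleton_iff.1 c.2
      calc c.1 * k₀ * g * (c.1 * k₀)⁻¹ = c.1 * (k₀ * g * k₀⁻¹) * c.1⁻¹ := by group
        _ = k₀ * g * k₀⁻¹ := by rw [hc]; group
    · intro k; simp
    · intro c; simp
  · have : IsEmpty {k : G // k * g * k⁻¹ = x} := ⟨fun k => h (isConj_iff.2 ⟨k.1, k.2⟩)⟩
    exact Nat.card_of_isEmpty

lemma mem_realClasses_iff (c : ConjClasses G) : c ∈ realClasses G ↔ IsRealElement c.out := by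
  constructor
  · rintro ⟨g, rfl, hg⟩
    exact hg.of_isConj (ConjClasses.mk_eq_mk_iff_isConj.1 (Quotient.out_eq _).symm)
  · intro h
    exact ⟨c.out, Quotient.out_eq c, h⟩

variable [Fintype G]

-- Orbit–stabiliser: over one conjugacy class the orders of the centralizers add up to the order of
-- the group.
open Classical in
lemma sum_mul_card_centralizer (φ : G → ℚ) (hφ : ∀ x y, IsConj x y → φ x = φ y) :
    ∑ x, φ x * Nat.card (Subgroup.centralizer {x}) =
      Nat.card G * ∑ c : ConjClasses G, φ c.out := by
  rw [← Finset.sum_fiberwise Finset.univ (fun x : G => ConjClasses.mk x), Finset.mul_sum]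
  refine Finset.sum_congr rfl fun c _ => ?_
  obtain ⟨g, rfl⟩ := c.exists_rep
  have hg : IsConj (ConjClasses.mk g).out g := ConjClasses.mk_eq_mk_iff_isConj.1 (Quotient.out_eq _)
  rw [hφ _ _ hg]
  have h1 : ∀ x ∈ Finset.univ.filter (fun x : G => ConjClasses.mk x = ConjClasses.mk g),
      φ x * Nat.card (Subgroup.centralizer {x}) =
        φ g * Nat.card {k : G // k * g * k⁻¹ = x} := by
    intro x hx
    have hx : IsConj x g := ConjClasses.mk_eq_mk_iff_isConj.1 (Finset.mem_filter.1 hx).2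
    rw [card_conjugators, if_pos hx.symm, hφ x g hx]
  rw [Finset.sum_congr rfl h1, ← Finset.mul_sum, mul_comm]
  congr 1
  rw [← Nat.cast_sum]
  congr 1
  rw [Nat.card_eq_fintype_card, ← Finset.card_univ, Finset.card_eq_sum_card_fiberwise
    (f := fun k => k * g * k⁻¹)
    (t := Finset.univ.filter (fun x : G => ConjClasses.mk x = ConjClasses.mk g))]
  · refine Finset.sum_congr rfl fun x _ => ?_
    rw [Nat.card_eq_fintype_card, Fintype.card_subtype]
  · intro k _
    simp only [Finset.coe_filter, Finset.mem_univ, true_and, Set.mem_ofPred_eq]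
    exact ConjClasses.mk_eq_mk_iff_isConj.2 (isConj_iff.2 ⟨k, rfl⟩).symm

open Classical in
lemma ncard_realClasses_mul_card :
    ((realClasses G).ncard : ℚ) * Nat.card G =
      ∑ x : G, if IsRealElement x then (Nat.card (Subgroup.centralizer {x}) : ℚ) else 0 := by
  have h := sum_mul_card_centralizer (fun x : G => if IsRealElement x then (1 : ℚ) else 0) (by
    intro x y hxy
    have : IsRealElement x ↔ IsRealElement y := ⟨.of_isConj hxy, .of_isConj hxy.symm⟩
    simp only [this])
  simp only [ite_mul, one_mul, zero_mul] at h
  rw [h, mul_comm]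
  congr 1
  rw [Finset.sum_boole, Set.ncard_eq_toFinset_card']
  congr 2
  ext c
  simp [mem_realClasses_iff]

-- For real x, the elements inverting x form a coset of its centralizer, so the number of real
-- classes times the group order counts pairs (x, h).
open Classical in
lemma ncard_realClasses_mul_card' :
    ((realClasses G).ncard : ℚ) * Nat.card G =
      ∑ x : G, ∑ h : G, if h * x * h⁻¹ = x⁻¹ then (1 : ℚ) else 0 := by
  rw [ncard_realClasses_mul_card]
  refine Finset.sum_congr rfl fun x _ => ?_
  have h1 := card_conjugators x x⁻¹
  rw [Nat.card_eq_fintype_card, Fintype.card_subtype] at h1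
  rw [Finset.sum_boole, h1]
  simp only [IsRealElement.isConj_iff]
  have : Subgroup.centralizer {x⁻¹} = Subgroup.centralizer {x} := by
    ext y
    simp only [Subgroup.mem_centralizer_singleton_iff]
    exact Commute.inv_right_iff
  rw [this]
  split_ifs <;> simp

lemma sum_comp_quotient_mk (Y : Subgroup G) [Y.Normal] [Fintype (G ⧸ Y)] (f : G ⧸ Y → ℚ) :
    ∑ x : G, f (QuotientGroup.mk x) = Nat.card Y * ∑ q, f q := by
  classical
  rw [← Finset.sum_fiberwise Finset.univ (fun x : G => (QuotientGroup.mk x : G ⧸ Y)),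
    Finset.mul_sum]
  refine Finset.sum_congr rfl fun q _ => ?_
  obtain ⟨a, rfl⟩ := QuotientGroup.mk_surjective q
  rw [Finset.sum_congr rfl fun x hx => by rw [(Finset.mem_filter.1 hx).2], Finset.sum_const,
    nsmul_eq_mul, ← Fintype.card_subtype, ← Nat.card_eq_fintype_card]
  congr 2
  refine Nat.card_congr ⟨fun x => ⟨a⁻¹ * x.1, QuotientGroup.eq.1 x.2.symm⟩,
    fun y => ⟨a * y.1, QuotientGroup.mk_mul_of_mem a y.2⟩, fun x => ?_, fun y => ?_⟩ <;> simp

/-- Pairs (x, h) of the quotient that satisfy the inversion equation lift to |Y|² pairs each. The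
lifts are sorted by the y in Y with h x h⁻¹ = y x⁻¹, and each y contributes as many pairs as y = 1.
-/
theorem ncard_realClasses_quotient (Y : Subgroup G) [Y.Normal]
    (hY : ∀ y ∈ Y, ∃ w ∈ Subgroup.center G, w * w = y) :
    (realClasses (G ⧸ Y)).ncard = (realClasses G).ncard := by
  classical
  have h1 := ncard_realClasses_mul_card' (G := G ⧸ Y)
  have h2 := ncard_realClasses_mul_card' (G := G)
  have hcard : (Nat.card G : ℚ) = Nat.card (G ⧸ Y) * Nat.card Y := by
    exact_mod_cast Y.card_eq_card_quotient_mul_card_subgroup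
  have hYpos : (Nat.card Y : ℚ) ≠ 0 := by exact_mod_cast Nat.card_pos.ne'
  have hQpos : (Nat.card (G ⧸ Y) : ℚ) ≠ 0 := by exact_mod_cast Nat.card_pos.ne'
  have h3 : ∑ x : G, ∑ h : G, (if (QuotientGroup.mk h * QuotientGroup.mk x * (QuotientGroup.mk h)⁻¹
      = ((QuotientGroup.mk x : G ⧸ Y))⁻¹) then (1 : ℚ) else 0) =
      Nat.card Y * (Nat.card Y * ((realClasses (G ⧸ Y)).ncard * Nat.card (G ⧸ Y))) := by
    rw [h1]
    have hin : ∀ x : G ⧸ Y, ∑ h : G, (if (QuotientGroup.mk h * x * (QuotientGroup.mk h)⁻¹ = x⁻¹)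
        then (1 : ℚ) else 0) = Nat.card Y * ∑ h, if h * x * h⁻¹ = x⁻¹ then (1 : ℚ) else 0 :=
      fun x => sum_comp_quotient_mk Y (fun h => if h * x * h⁻¹ = x⁻¹ then (1 : ℚ) else 0)
    simp only [hin]
    rw [sum_comp_quotient_mk Y (fun x => (Nat.card Y : ℚ) * ∑ h, if h * x * h⁻¹ = x⁻¹ then
      (1 : ℚ) else 0), ← Finset.mul_sum]
    congr!
  have h4 : ∀ x h : G, (if (QuotientGroup.mk h * QuotientGroup.mk x * (QuotientGroup.mk h)⁻¹
      = ((QuotientGroup.mk x : G ⧸ Y))⁻¹) then (1 : ℚ) else 0) =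
      ∑ y : Y, if h * x * h⁻¹ = y * x⁻¹ then (1 : ℚ) else 0 := by
    intro x h
    have hiff : ((QuotientGroup.mk h * QuotientGroup.mk x * (QuotientGroup.mk h)⁻¹
      = ((QuotientGroup.mk x : G ⧸ Y))⁻¹)) ↔ h * x * h⁻¹ * x ∈ Y := by
      rw [← QuotientGroup.eq_one_iff, eq_inv_iff_mul_eq_one]
      rfl
    by_cases hm : h * x * h⁻¹ * x ∈ Y
    · rw [if_pos (hiff.2 hm), Finset.sum_eq_single ⟨_, hm⟩, if_pos (by simp)]
      · intro y _ hy
        rw [if_neg]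
        intro he
        refine hy (Subtype.ext ?_)
        change (y : G) = h * x * h⁻¹ * x
        rw [he]
        simp
      · simp
    · rw [if_neg (mt hiff.1 hm), Finset.sum_eq_zero]
      intro y _
      rw [if_neg]
      intro he
      exact hm (by rw [he]; simp)
  simp only [h4] at h3
  have h5 : ∑ x : G, ∑ h : G, ∑ y : Y, (if h * x * h⁻¹ = y * x⁻¹ then (1 : ℚ) else 0) =
      ∑ y : Y, ∑ x : G, ∑ h : G, (if h * x * h⁻¹ = y * x⁻¹ then (1 : ℚ) else 0) := by
    rw [Finset.sum_comm]
    simp only [Finset.sum_comm (s := (Finset.univ : Finset G)) (t := (Finset.univ : Finset Y))]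
    rw [Finset.sum_congr rfl fun y _ => Finset.sum_comm]
  have h6 : ∀ y : Y, ∑ x : G, ∑ h : G, (if h * x * h⁻¹ = y * x⁻¹ then (1 : ℚ) else 0) =
      (realClasses G).ncard * Nat.card G := by
    intro y
    rw [h2]
    obtain ⟨w, hw, hwy⟩ := hY y y.2
    -- Substituting wx for x absorbs y = w², since w is central.
    rw [← Equiv.sum_comp (Equiv.mulLeft w)]
    refine Finset.sum_congr rfl fun x _ => Finset.sum_congr rfl fun h _ => ?_
    have hc : ∀ z, z * w = w * z := fun z => Subgroup.mem_center_iff.1 hw z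
    have : h * (w * x) * h⁻¹ = y * (w * x)⁻¹ ↔ h * x * h⁻¹ = x⁻¹ := by
      have e1 : h * (w * x) * h⁻¹ = w * (h * x * h⁻¹) := by
        rw [← mul_assoc h, hc h]; group
      have e2 : (y : G) * (w * x)⁻¹ = w * x⁻¹ := by
        rw [← hwy, mul_inv_rev, mul_assoc w, ← mul_assoc w x⁻¹, ← hc, inv_mul_cancel_right]
      rw [e1, e2, mul_right_inj]
    simp only [Equiv.coe_mulLeft, this]
  rw [h5, Finset.sum_congr rfl fun y _ => h6 y, Finset.sum_const, Finset.card_univ, nsmul_eq_mul,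
    ← Nat.card_eq_fintype_card, hcard] at h3
  have h7 : ((realClasses G).ncard : ℚ) = (realClasses (G ⧸ Y)).ncard := by
    have h8 := mul_left_cancel₀ hYpos h3
    apply mul_right_cancel₀ (mul_ne_zero hQpos hYpos)
    rw [h8]; ring
  exact_mod_cast h7.symm

end ClassCounting

/-! ### Real classes of the kernel of a map to an abelian group. -/

section NormalSubgroupClasses

variable {N G D : Type*} [Group N] [Group G] [CommGroup D]

lemma card_map_conj_centralizer (d : G →* D) {x y : G} (hxy : IsConj x y) :
    (Subgroup.centralizer {x}).map d = (Subgroup.centralizer {y}).map d := by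
  have key : ∀ {x y : G}, IsConj x y →
      (Subgroup.centralizer {x}).map d ≤ (Subgroup.centralizer {y}).map d := by
    intro x y hxy
    obtain ⟨k, rfl⟩ := isConj_iff.1 hxy
    rintro _ ⟨c, hc, rfl⟩
    refine ⟨k * c * k⁻¹, ?_, ?_⟩
    · have hc := Subgroup.mem_centralizer_singleton_iff.1 hc
      refine Subgroup.mem_centralizer_singleton_iff.2 ?_
      calc k * c * k⁻¹ * (k * x * k⁻¹) = k * (c * x) * k⁻¹ := by group
        _ = k * x * k⁻¹ * (k * c * k⁻¹) := by rw [hc]; group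
    · rw [map_mul, map_mul, map_inv, mul_comm (d k), mul_inv_cancel_right]
  exact le_antisymm (key hxy) (key hxy.symm)

variable [Finite N] [Finite G] [Finite D]

omit [Finite N] [Finite G] [Finite D] in
lemma card_centralizer_eq (ι : N →* G) (hι : Function.Injective ι) (d : G →* D)
    (hιd : ι.range = d.ker) (x : N) :
    Nat.card (Subgroup.centralizer {ι x}) =
      Nat.card ((Subgroup.centralizer {ι x}).map d) * Nat.card (Subgroup.centralizer {x}) := by
  let d' : Subgroup.centralizer {ι x} →* D := d.comp (Subgroup.subtype _)
  have hr : d'.range = (Subgroup.centralizer {ι x}).map d := by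
    rw [MonoidHom.range_comp, Subgroup.range_subtype]
  rw [← Subgroup.card_mul_index d'.ker, Subgroup.index_ker, hr, mul_comm]
  congr 1
  symm
  refine Nat.card_congr (Equiv.ofBijective (fun c => ⟨⟨ι c.1, ?_⟩, ?_⟩) ⟨?_, ?_⟩)
  · have hc := Subgroup.mem_centralizer_singleton_iff.1 c.2
    exact Subgroup.mem_centralizer_singleton_iff.2 (by rw [← map_mul, hc, map_mul])
  · have : ι c.1 ∈ d.ker := hιd ▸ ⟨c.1, rfl⟩
    exact this
  · intro a b hab
    have := congrArg (fun z => z.1.1) hab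
    exact Subtype.ext (hι this)
  · rintro ⟨⟨g, hg⟩, hgd⟩
    have : g ∈ d.ker := hgd
    rw [← hιd] at this
    obtain ⟨c, rfl⟩ := this
    refine ⟨⟨c, ?_⟩, rfl⟩
    have hg := Subgroup.mem_centralizer_singleton_iff.1 hg
    exact Subgroup.mem_centralizer_singleton_iff.2 (hι (by rw [map_mul, map_mul, hg]))

open Classical in
/-- The number of real classes of a normal subgroup with abelian quotient, in terms of the classes
of the ambient group. -/
theorem ncard_realClasses_normal [Fintype (ConjClasses G)] (ι : N →* G)
    (hι : Function.Injective ι) (d : G →* D) (hd : Function.Surjective d) (hιd : ι.range = d.ker)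
    (hreal : ∀ x : N, IsRealElement x ↔ IsRealElement (ι x)) :
    ((realClasses N).ncard : ℚ) = ∑ c : ConjClasses G, if IsRealElement c.out ∧ d c.out = 1 then
      (Nat.card D : ℚ) / Nat.card ((Subgroup.centralizer {c.out}).map d) else 0 := by
  have := Fintype.ofFinite N
  have := Fintype.ofFinite G
  let φ : G → ℚ := fun x => if IsRealElement x ∧ d x = 1 then
    (Nat.card D : ℚ) / Nat.card ((Subgroup.centralizer {x}).map d) else 0
  have hφ : ∀ x y, IsConj x y → φ x = φ y := by
    intro x y hxy
    have h1 : IsRealElement x ↔ IsRealElement y := ⟨.of_isConj hxy, .of_isConj hxy.symm⟩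
    have h2 : d x = d y := by
      obtain ⟨k, rfl⟩ := isConj_iff.1 hxy
      rw [map_mul, map_mul, map_inv, mul_comm (d k), mul_inv_cancel_right]
    simp only [φ, h1, h2, card_map_conj_centralizer d hxy]
  have hG : (Nat.card G : ℚ) = Nat.card N * Nat.card D := by
    have h1 : Nat.card N = Nat.card d.ker := by
      rw [← hιd]
      exact Nat.card_congr (MonoidHom.ofInjective hι).toEquiv
    have h2 : d.ker.index = Nat.card D := by
      rw [Subgroup.index_ker, MonoidHom.range_eq_top.2 hd]
      exact Nat.card_congr Subgroup.topEquiv.toEquiv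
    rw [h1, ← h2]
    exact_mod_cast (Subgroup.card_mul_index d.ker).symm
  have hN0 : (Nat.card N : ℚ) ≠ 0 := by exact_mod_cast Nat.card_pos.ne'
  have hD0 : (Nat.card D : ℚ) ≠ 0 := by exact_mod_cast Nat.card_pos.ne'
  have h : ∑ x, φ x * Nat.card (Subgroup.centralizer {x}) =
      Nat.card G * ∑ c : ConjClasses G, φ c.out := by
    rw [sum_mul_card_centralizer φ hφ]
    congr!
  -- The weight φ vanishes off the kernel of `d`, so only the image of `N` contributes.
  have hres : ∑ x : G, φ x * Nat.card (Subgroup.centralizer {x}) =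
      ∑ x : N, φ (ι x) * Nat.card (Subgroup.centralizer {ι x}) := by
    symm
    refine (Finset.sum_map Finset.univ ⟨ι, hι⟩
      (fun x => φ x * (Nat.card (Subgroup.centralizer {x}) : ℚ))).symm.trans ?_
    apply Finset.sum_subset (Finset.subset_univ _)
    intro x _ hx
    have : d x ≠ 1 := by
      intro hdx
      have : x ∈ ι.range := hιd ▸ hdx
      obtain ⟨y, rfl⟩ := this
      exact hx (Finset.mem_map_of_mem ⟨ι, hι⟩ (Finset.mem_univ y))
    simp only [φ, this, and_false, if_false, zero_mul]
  -- The order of C_G(ιx) is that of its image under `d` times that of C_N(x), which cancels the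
  -- denominator in φ.
  have hval : ∀ x : N, φ (ι x) * Nat.card (Subgroup.centralizer {ι x}) =
      Nat.card D * if IsRealElement x then (Nat.card (Subgroup.centralizer {x}) : ℚ) else 0 := by
    intro x
    have h1 : d (ι x) = 1 := by
      have : ι x ∈ d.ker := hιd ▸ ⟨x, rfl⟩
      exact this
    have h2 : (Nat.card ((Subgroup.centralizer {ι x}).map d) : ℚ) ≠ 0 := by
      exact_mod_cast Nat.card_pos.ne'
    simp only [φ, h1, and_true, ← hreal]
    split_ifs
    · rw [card_centralizer_eq ι hι d hιd, Nat.cast_mul]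
      field_simp
    · ring
  rw [hres, Finset.sum_congr rfl fun x _ => hval x, ← Finset.mul_sum,
    ← ncard_realClasses_mul_card, hG] at h
  have h3 : (Nat.card N * Nat.card D : ℚ) * (realClasses N).ncard =
      Nat.card N * Nat.card D * ∑ c : ConjClasses G, φ c.out := by
    rw [← h]; ring
  exact mul_left_cancel₀ (mul_ne_zero hN0 hD0) h3

end NormalSubgroupClasses

/-! ### Conjugacy, reality and centralizers in GL_n and SL_n. -/

section MatrixGroups

variable {F : Type*} [Field F] {n : ℕ}

lemma toLinAlgEquiv'_injective_of_isUnit {A : Matrix (Fin n) (Fin n) F} (hA : IsUnit A) :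
    Function.Injective (Matrix.toLinAlgEquiv' A) := by
  obtain ⟨u, rfl⟩ := hA
  intro v w hvw
  have h : ∀ v, Matrix.toLinAlgEquiv' ((u⁻¹ : (Matrix (Fin n) (Fin n) F)ˣ) : Matrix _ _ F)
      (Matrix.toLinAlgEquiv' (u : Matrix (Fin n) (Fin n) F) v) = v := by
    intro v
    rw [← Module.End.mul_apply, ← map_mul, Units.inv_mul, map_one, Module.End.one_apply]
  rw [← h v, hvw, h w]

lemma exists_matrix_hasType (g : GL (Fin n) F) : ∃ S : Multiset (F[X] × ℕ),
    (∀ x ∈ S, IsBlock x) ∧ HasType (Matrix.toLinAlgEquiv' (g : Matrix (Fin n) (Fin n) F)) S :=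
  exists_hasType _ (toLinAlgEquiv'_injective_of_isUnit g.isUnit)

/-- The multiset of elementary divisors `(p, e)` of an invertible matrix. -/
noncomputable def elemDivisors (g : GL (Fin n) F) : Multiset (F[X] × ℕ) :=
  (exists_matrix_hasType g).choose

lemma isBlock_of_mem_elemDivisors {g : GL (Fin n) F} {x : F[X] × ℕ} (hx : x ∈ elemDivisors g) :
    IsBlock x := (exists_matrix_hasType g).choose_spec.1 x hx

lemma hasType_elemDivisors (g : GL (Fin n) F) :
    HasType (Matrix.toLinAlgEquiv' (g : Matrix (Fin n) (Fin n) F)) (elemDivisors g) :=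
  (exists_matrix_hasType g).choose_spec.2

lemma elemDivisors_eq {g : GL (Fin n) F} {S : Multiset (F[X] × ℕ)} (hS : ∀ x ∈ S, IsBlock x)
    (h : HasType (Matrix.toLinAlgEquiv' (g : Matrix (Fin n) (Fin n) F)) S) :
    elemDivisors g = S :=
  (hasType_elemDivisors g).unique (fun _ => isBlock_of_mem_elemDivisors) hS h

/-- An invertible matrix from an invertible linear map. -/
lemma exists_GL_of_linearEquiv (ψ : (Fin n → F) ≃ₗ[F] (Fin n → F)) :
    ∃ k : GL (Fin n) F, Matrix.toLinAlgEquiv' (k : Matrix (Fin n) (Fin n) F) = ψ := by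
  refine ⟨⟨Matrix.toLinAlgEquiv'.symm (ψ : (Fin n → F) →ₗ[F] (Fin n → F)),
    Matrix.toLinAlgEquiv'.symm (ψ.symm : (Fin n → F) →ₗ[F] (Fin n → F)), ?_, ?_⟩, ?_⟩
  · rw [← map_mul, Module.End.mul_eq_comp, LinearEquiv.comp_symm, ← Module.End.one_eq_id, map_one]
  · rw [← map_mul, Module.End.mul_eq_comp, LinearEquiv.symm_comp, ← Module.End.one_eq_id, map_one]
  · exact Matrix.toLinAlgEquiv'.apply_symm_apply _

theorem isConj_iff_elemDivisors_eq {g g' : GL (Fin n) F} :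
    IsConj g g' ↔ elemDivisors g = elemDivisors g' := by
  constructor
  · intro h
    obtain ⟨k, rfl⟩ := isConj_iff.1 h
    symm
    apply elemDivisors_eq (fun _ => isBlock_of_mem_elemDivisors)
    let ψ : (Fin n → F) ≃ₗ[F] (Fin n → F) := LinearEquiv.ofLinearMap
      (Matrix.toLinAlgEquiv' ((k⁻¹ : GL (Fin n) F) : Matrix (Fin n) (Fin n) F))
      (Matrix.toLinAlgEquiv' (k : Matrix (Fin n) (Fin n) F))
      (by rw [← Module.End.mul_eq_comp, ← map_mul, Units.inv_mul, map_one]; rfl)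
      (by rw [← Module.End.mul_eq_comp, ← map_mul, Units.mul_inv, map_one]; rfl)
    refine (hasType_elemDivisors g).of_equiv ψ fun v => ?_
    change Matrix.toLinAlgEquiv' ((k⁻¹ : GL (Fin n) F) : Matrix (Fin n) (Fin n) F) _ =
      Matrix.toLinAlgEquiv' (g : Matrix (Fin n) (Fin n) F)
        (Matrix.toLinAlgEquiv' ((k⁻¹ : GL (Fin n) F) : Matrix (Fin n) (Fin n) F) v)
    rw [← Module.End.mul_apply, ← Module.End.mul_apply, ← map_mul, ← map_mul, ← Units.val_mul,
      ← Units.val_mul, show k⁻¹ * (k * g * k⁻¹) = g * k⁻¹ by group]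
  · intro h
    obtain ⟨ψ, hψ⟩ := (hasType_elemDivisors g).exists_equiv (h ▸ hasType_elemDivisors g')
    obtain ⟨k, hk⟩ := exists_GL_of_linearEquiv ψ
    refine isConj_iff.2 ⟨k, ?_⟩
    rw [mul_inv_eq_iff_eq_mul]
    apply Units.ext
    apply Matrix.toLinAlgEquiv'.injective
    rw [Units.val_mul, Units.val_mul, map_mul, map_mul, hk]
    exact LinearMap.ext hψ

lemma elemDivisors_inv (g : GL (Fin n) F) :
    elemDivisors g⁻¹ = (elemDivisors g).map recipBlock := by
  apply elemDivisors_eq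
  · intro x hx
    obtain ⟨y, hy, rfl⟩ := Multiset.mem_map.1 hx
    exact (isBlock_of_mem_elemDivisors hy).recip
  · refine (hasType_elemDivisors g).inverse ?_ (fun _ => isBlock_of_mem_elemDivisors)
    rw [← map_mul, Units.mul_inv, map_one]

lemma isRealElement_iff_elemDivisors {g : GL (Fin n) F} :
    IsRealElement g ↔ (elemDivisors g).map recipBlock = elemDivisors g := by
  rw [IsRealElement.isConj_iff, isConj_iff_elemDivisors_eq, elemDivisors_inv, eq_comm]

lemma sum_elemDivisors (g : GL (Fin n) F) :
    ((elemDivisors g).map fun x => x.2 * x.1.natDegree).sum = n := by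
  rw [← (hasType_elemDivisors g).finrank_eq fun _ => isBlock_of_mem_elemDivisors,
    Module.finrank_fin_fun]

lemma exists_elemDivisors_eq {S : Multiset (F[X] × ℕ)} (hS : ∀ x ∈ S, IsBlock x)
    (hn : (S.map fun x => x.2 * x.1.natDegree).sum = n) :
    ∃ g : GL (Fin n) F, elemDivisors g = S := by
  obtain ⟨ψ, hψ⟩ := exists_of_blocks (V := Fin n → F) hS (by rw [hn, Module.finrank_fin_fun])
  obtain ⟨k, hk⟩ := exists_GL_of_linearEquiv ψ
  exact ⟨k, elemDivisors_eq hS (hk ▸ hψ)⟩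

lemma det_toLinAlgEquiv' (A : Matrix (Fin n) (Fin n) F) :
    LinearMap.det (Matrix.toLinAlgEquiv' A) = A.det := LinearMap.det_toLin' A

lemma det_eq_prod_elemDivisors (g : GL (Fin n) F) :
    (g : Matrix (Fin n) (Fin n) F).det =
      ((elemDivisors g).map fun x => ((-1) ^ x.1.natDegree * x.1.coeff 0) ^ x.2).prod := by
  rw [← det_toLinAlgEquiv']
  exact (hasType_elemDivisors g).det_eq fun _ => isBlock_of_mem_elemDivisors

/-- Bézout: the gcd is an integral combination of the exponents. -/
lemma pow_multiset_gcd_mem {D : Type*} [CommGroup D] (H : Subgroup D) (s : Multiset ℕ)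
    (hs : ∀ e ∈ s, ∀ a : D, a ^ e ∈ H) (a : D) : a ^ s.gcd ∈ H := by
  induction s using Multiset.induction with
  | empty => simp
  | cons e s ih =>
    rw [Multiset.gcd_cons]
    have h1 := hs e (Multiset.mem_cons_self e s) a
    have h2 := ih fun e he => hs e (Multiset.mem_cons_of_mem he)
    have h3 : a ^ (gcd e s.gcd) = (a ^ e) ^ (Nat.gcdA e s.gcd) * (a ^ s.gcd) ^ (Nat.gcdB e s.gcd) := by
      rw [← zpow_natCast, ← zpow_natCast, ← zpow_natCast, ← zpow_mul, ← zpow_mul, ← zpow_add]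
      congr 1
      exact Nat.gcd_eq_gcd_ab e s.gcd
    rw [h3]
    exact H.mul_mem (H.zpow_mem h1 _) (H.zpow_mem h2 _)

/-- Determinants of centralizing matrices are m-th powers by `HasType.det_eq_pow_of_commute`.
Conversely every a^e with e an exponent of a block is attained, and these generate all m-th powers.
-/
theorem map_det_centralizer [Finite F] (hn : 0 < n) (g : GL (Fin n) F) :
    (Subgroup.centralizer {g}).map (Matrix.GeneralLinearGroup.det) =
      (powMonoidHom ((elemDivisors g).map Prod.snd).gcd : Fˣ →* Fˣ).range := by
  set m := ((elemDivisors g).map Prod.snd).gcd with hm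
  have hmd : ∀ x ∈ elemDivisors g, m ∣ x.2 := fun x hx =>
    Multiset.gcd_dvd (Multiset.mem_map_of_mem _ hx)
  -- The gcd could vanish only if all exponents did, and then n would be 0.
  have hm0 : 0 < m := by
    apply Nat.pos_of_ne_zero
    intro h0
    have hsum := sum_elemDivisors g
    rw [Multiset.sum_eq_zero] at hsum
    · omega
    · intro y hy
      obtain ⟨x, hx, rfl⟩ := Multiset.mem_map.1 hy
      have := hmd x hx
      rw [h0, zero_dvd_iff] at this
      rw [this, zero_mul]
  apply le_antisymm
  · rintro _ ⟨c, hc, rfl⟩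
    have hc := Subgroup.mem_centralizer_singleton_iff.1 hc
    have hcomm : Commute (Matrix.toLinAlgEquiv' (c : Matrix (Fin n) (Fin n) F))
        (Matrix.toLinAlgEquiv' (g : Matrix (Fin n) (Fin n) F)) := by
      change _ * _ = _ * _
      rw [← map_mul, ← map_mul, ← Units.val_mul, hc, Units.val_mul]
    obtain ⟨a, ha⟩ := (hasType_elemDivisors g).det_eq_pow_of_commute
      (fun _ => isBlock_of_mem_elemDivisors) hm0 hmd hcomm
    rw [det_toLinAlgEquiv'] at ha
    have ha0 : a ≠ 0 := by
      rintro rfl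
      rw [zero_pow hm0.ne'] at ha
      exact Matrix.GeneralLinearGroup.det_ne_zero c ha
    refine ⟨Units.mk0 a ha0, ?_⟩
    ext
    simp [ha]
  · rintro _ ⟨a, rfl⟩
    rw [powMonoidHom_apply]
    apply pow_multiset_gcd_mem
    intro e he a
    obtain ⟨x, hx, rfl⟩ := Multiset.mem_map.1 he
    obtain ⟨c, hc, hdet⟩ := (hasType_elemDivisors g).exists_commute_det_eq_pow
      (fun _ => isBlock_of_mem_elemDivisors) hx (a : F)
    obtain ⟨C, rfl⟩ := Matrix.toLinAlgEquiv'.surjective c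
    rw [det_toLinAlgEquiv'] at hdet
    refine ⟨Matrix.GeneralLinearGroup.mkOfDetNeZero C (by rw [hdet]; simp), ?_, ?_⟩
    · refine Subgroup.mem_centralizer_singleton_iff.2 ?_
      ext1
      apply Matrix.toLinAlgEquiv'.injective
      rw [Units.val_mul, Units.val_mul, map_mul, map_mul]
      exact hc
    · ext
      rw [Units.val_pow_eq_pow_val]
      exact hdet

/-- The m-th powers in the cyclic group `Fˣ` of order q - 1 have index gcd(q - 1, m). -/
lemma card_div_card_map_det_centralizer [Fintype F] (hn : 0 < n) (g : GL (Fin n) F) :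
    (Nat.card Fˣ : ℚ) / Nat.card ((Subgroup.centralizer {g}).map
      (Matrix.GeneralLinearGroup.det)) =
      Nat.gcd (Fintype.card F - 1) ((elemDivisors g).map Prod.snd).gcd := by
  rw [map_det_centralizer hn, IsCyclic.card_powMonoidHom_range]
  have hq : Nat.card Fˣ = Fintype.card F - 1 := by
    rw [Nat.card_units, Nat.card_eq_fintype_card]
  rw [hq]
  have hpos : 0 < Fintype.card F - 1 := Nat.sub_pos_of_lt Fintype.one_lt_card
  have hd := Nat.gcd_dvd_left (Fintype.card F - 1) ((elemDivisors g).map Prod.snd).gcd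
  have hg := Nat.gcd_pos_of_pos_left ((elemDivisors g).map Prod.snd).gcd hpos
  rw [Nat.cast_div hd (by exact_mod_cast hg.ne')]
  have h1 : ((Fintype.card F - 1 : ℕ) : ℚ) ≠ 0 := by exact_mod_cast hpos.ne'
  field_simp

/-- If `4 ∣ n`, every element of `SL n F` which is real in `GL n F` is strongly real. -/
theorem isStronglyRealElement_of_toGL (h4 : 4 ∣ n) {x : Matrix.SpecialLinearGroup (Fin n) F}
    (hx : IsRealElement (Matrix.SpecialLinearGroup.toGL x)) : IsStronglyRealElement x := by
  obtain ⟨τ, h1, h2, h3⟩ := (hasType_elemDivisors (Matrix.SpecialLinearGroup.toGL x)).exists_reverser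
    (fun _ => isBlock_of_mem_elemDivisors) (isRealElement_iff_elemDivisors.1 hx)
    (by rwa [Module.finrank_fin_fun])
  obtain ⟨T, rfl⟩ := Matrix.toLinAlgEquiv'.surjective τ
  rw [det_toLinAlgEquiv'] at h3
  rw [← map_mul] at h1
  rw [← map_mul, ← map_mul] at h2
  have h1' : T * T = 1 := Matrix.toLinAlgEquiv'.injective (by rw [h1, map_one])
  have h2' := Matrix.toLinAlgEquiv'.injective h2
  let t : Matrix.SpecialLinearGroup (Fin n) F := ⟨T, h3⟩
  have hTT : t * t = 1 := Subtype.ext h1'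
  have hxT : x * t * x = t := Subtype.ext h2'
  refine ⟨t, by rw [sq, hTT], ?_⟩
  rw [mul_inv_eq_iff_eq_mul, eq_inv_mul_iff_mul_eq, ← mul_assoc]
  exact hxT

lemma range_toGL_eq_ker_det : (Matrix.SpecialLinearGroup.toGL :
    Matrix.SpecialLinearGroup (Fin n) F →* GL (Fin n) F).range =
      (Matrix.GeneralLinearGroup.det : GL (Fin n) F →* Fˣ).ker := by
  ext g
  constructor
  · rintro ⟨x, rfl⟩
    exact Matrix.SpecialLinearGroup.coeToGL_det x
  · intro hg
    refine ⟨⟨g, ?_⟩, Units.ext rfl⟩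
    have := congrArg Units.val (MonoidHom.mem_ker.1 hg)
    exact this

lemma IsStronglyRealElement.isRealElement {G : Type*} [Group G] {g : G}
    (h : IsStronglyRealElement g) : IsRealElement g := by
  obtain ⟨k, -, hk⟩ := h
  exact ⟨k, hk⟩

lemma isRealElement_toGL_iff (h4 : 4 ∣ n) (x : Matrix.SpecialLinearGroup (Fin n) F) :
    IsRealElement x ↔ IsRealElement (Matrix.SpecialLinearGroup.toGL x) := by
  refine ⟨?_, fun h => (isStronglyRealElement_of_toGL h4 h).isRealElement⟩
  rintro ⟨h, hh⟩
  exact ⟨Matrix.SpecialLinearGroup.toGL h, by rw [← map_inv, ← map_inv, ← hh, map_mul, map_mul]⟩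

-- Each real GL-class of determinant 1 is weighted by the number of SL-classes into which it splits.
open Classical in
theorem ncard_realClasses_SL [Fintype F] [Fintype (ConjClasses (GL (Fin n) F))] (hn : 0 < n)
    (h4 : 4 ∣ n) :
    ((realClasses (Matrix.SpecialLinearGroup (Fin n) F)).ncard : ℚ) =
      ∑ c : ConjClasses (GL (Fin n) F),
        if (elemDivisors c.out).map recipBlock = elemDivisors c.out ∧
          Matrix.GeneralLinearGroup.det c.out = 1 then
        (Nat.gcd (Fintype.card F - 1) ((elemDivisors c.out).map Prod.snd).gcd : ℚ) else 0 := by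
  have : Nonempty (Fin n) := ⟨⟨0, hn⟩⟩
  rw [ncard_realClasses_normal Matrix.SpecialLinearGroup.toGL
    Matrix.SpecialLinearGroup.toGL_injective Matrix.GeneralLinearGroup.det
    Matrix.GeneralLinearGroup.det_surjective range_toGL_eq_ker_det (isRealElement_toGL_iff h4)]
  simp only [isRealElement_iff_elemDivisors, card_div_card_map_det_centralizer hn]

end MatrixGroups

/-! ### Counting self-reciprocal polynomials and the formula for sl_ν. -/

section SelfReciprocalCount

variable {F : Type*} [Field F]

/-- Monic polynomials of degree `d` with `u_{d-j} = c u_j`. -/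
def selfRecSet (F : Type*) [Field F] (d : ℕ) (c : F) : Set F[X] :=
  {u | u.Monic ∧ u.natDegree = d ∧ ∀ j ≤ d, u.coeff (d - j) = c * u.coeff j}

lemma coeff_zero_of_mem_selfRecSet {d : ℕ} {c : F} {u : F[X]} (hu : u ∈ selfRecSet F d c) :
    u.coeff 0 = c := by
  have := hu.2.2 d le_rfl
  rw [Nat.sub_self] at this
  have h := hu.1.coeff_natDegree
  rw [hu.2.1] at h
  rw [this, h, mul_one]

/-- Comparing the leading coefficient with the constant term of `recip u = u` gives u(0)² = 1. -/
lemma selfRecSet_iff {d : ℕ} {u : F[X]} :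
    (u.Monic ∧ u.natDegree = d ∧ u.coeff 0 ≠ 0 ∧ recip u = u) ↔
      u ∈ selfRecSet F d 1 ∨ u ∈ selfRecSet F d (-1) := by
  constructor
  · rintro ⟨hm, rfl, h0, hr⟩
    have key : ∀ j ≤ u.natDegree, u.coeff (u.natDegree - j) = u.coeff 0 * u.coeff j := by
      intro j hj
      have := coeff_recip u hj
      rw [hr] at this
      rw [this, mul_inv_cancel_left₀ h0]
    have h1 := key 0 (Nat.zero_le _)
    rw [Nat.sub_zero, hm.coeff_natDegree, ← sq] at h1
    rcases sq_eq_one_iff.1 h1.symm with h | h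
    · exact Or.inl ⟨hm, rfl, fun j hj => h ▸ key j hj⟩
    · exact Or.inr ⟨hm, rfl, fun j hj => h ▸ key j hj⟩
  · have key : ∀ c : F, c * c = 1 → u ∈ selfRecSet F d c →
        (u.Monic ∧ u.natDegree = d ∧ u.coeff 0 ≠ 0 ∧ recip u = u) := by
      intro c hc hu
      have h0 := coeff_zero_of_mem_selfRecSet hu
      have hc0 : c ≠ 0 := by rintro rfl; simp at hc
      have hu0 : u.coeff 0 ≠ 0 := by rwa [h0]
      refine ⟨hu.1, hu.2.1, hu0, ?_⟩
      ext j
      by_cases hj : j ≤ u.natDegree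
      · have hj' : j ≤ d := hu.2.1 ▸ hj
        rw [coeff_recip u hj, h0, hu.2.1, hu.2.2 j hj', inv_mul_cancel_left₀ hc0]
      · rw [coeff_eq_zero_of_natDegree_lt, coeff_eq_zero_of_natDegree_lt (by omega)]
        rw [natDegree_recip hu0]
        omega
    rintro (h | h)
    exacts [key 1 (by ring) h, key (-1) (by ring) h]

/-- The coefficients of X, …, X^k are free and determine the rest by symmetry. For d even and c = 1
the middle one is among them; for d even and c = -1 it equals its own negative, so it is 0. -/
lemma ncard_selfRecSet [Finite F] (h2 : (2 : F) ≠ 0) {d k : ℕ} {c : F} (hd : 1 ≤ d)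
    (hc : c * c = 1)
    (hk : d = 2 * k + 1 ∨ (d = 2 * k ∧ c = 1) ∨ (d = 2 * k + 2 ∧ c = -1)) :
    (selfRecSet F d c).Finite ∧ (selfRecSet F d c).ncard = Nat.card F ^ k := by
  have hkd : k < d := by omega
  let e : selfRecSet F d c → (Fin k → F) := fun u j => u.1.coeff (j + 1)
  have he : Function.Bijective e := by
    constructor
    · rintro ⟨u, hu⟩ ⟨v, hv⟩ huv
      have h1 : ∀ j, 1 ≤ j → j ≤ k → u.coeff j = v.coeff j := by
        intro j hj1 hjk
        have := congr_fun huv ⟨j - 1, by omega⟩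
        simp only [e, Nat.sub_add_cancel hj1] at this
        exact this
      ext j
      change u.coeff j = v.coeff j
      by_cases hj0 : j = 0
      · rw [hj0, coeff_zero_of_mem_selfRecSet hu, coeff_zero_of_mem_selfRecSet hv]
      by_cases hjd : j = d
      · have h3 := hu.1.coeff_natDegree
        have h4 := hv.1.coeff_natDegree
        rw [hu.2.1] at h3
        rw [hv.2.1] at h4
        rw [hjd, h3, h4]
      by_cases hjd' : d < j
      · rw [coeff_eq_zero_of_natDegree_lt (hu.2.1.trans_lt hjd'),
          coeff_eq_zero_of_natDegree_lt (hv.2.1.trans_lt hjd')]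
      by_cases hjk : j ≤ k
      · exact h1 j (by omega) hjk
      by_cases hjk' : d - j ≤ k
      · have h3 := hu.2.2 (d - j) (by omega)
        have h4 := hv.2.2 (d - j) (by omega)
        rw [Nat.sub_sub_self (by omega)] at h3 h4
        rw [h3, h4, h1 _ (by omega) hjk']
      · have hmid : d - j = j ∧ c = -1 := by
          rcases hk with hk | ⟨hk, -⟩ | ⟨hk, hc⟩
          · omega
          · omega
          · exact ⟨by omega, hc⟩
        have hz : ∀ w ∈ selfRecSet F d c, w.coeff j = 0 := by
          intro w hw
          have h3 := hw.2.2 j (by omega)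
          rw [hmid.1, hmid.2] at h3
          have h4 : 2 * w.coeff j = 0 := by linear_combination h3
          exact (mul_eq_zero.1 h4).resolve_left h2
        rw [hz u hu, hz v hv]
    · intro a
      let w : ℕ → F := fun j => if j = 0 then c else if j = d then 1 else
        if h : j - 1 < k then a ⟨j - 1, h⟩ else if h : d - j - 1 < k then c * a ⟨d - j - 1, h⟩ else 0
      let u : F[X] := ∑ j ∈ Finset.range (d + 1), monomial j (w j)
      have hcoeff : ∀ j, u.coeff j = if j ≤ d then w j else 0 := by
        intro j
        simp only [u, finsetSum_coeff, coeff_monomial, Finset.sum_ite_eq', Finset.mem_range,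
          Nat.lt_succ_iff]
      have hwd : w d = 1 := by simp only [w, if_true, if_neg (show d ≠ 0 by omega)]
      have hdeg : u.natDegree ≤ d := by
        rw [natDegree_le_iff_coeff_eq_zero]
        intro j hj
        rw [hcoeff, if_neg (by omega)]
      have hud : u.coeff d = 1 := by rw [hcoeff, if_pos le_rfl, hwd]
      have hdeg' : u.natDegree = d := le_antisymm hdeg (le_natDegree_of_ne_zero (by simp [hud]))
      have hsym : ∀ j ≤ d, w (d - j) = c * w j := by
        intro j hj
        by_cases hj0 : j = 0
        · subst hj0
          rw [Nat.sub_zero, hwd]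
          simp only [w, if_true, hc]
        by_cases hjd : j = d
        · subst hjd
          rw [Nat.sub_self, hwd]
          simp only [w, if_true, mul_one]
        have e1 : d - j ≠ 0 := by omega
        have e2 : d - j ≠ d := by omega
        have e3 : d - (d - j) = j := by omega
        simp only [w, if_neg hj0, if_neg hjd, if_neg e1, if_neg e2, e3]
        by_cases hjk : j - 1 < k
        · by_cases hjk' : d - j - 1 < k
          · have : d - j = j ∧ c = 1 := by
              rcases hk with hk | ⟨hk, hc⟩ | ⟨hk, -⟩
              · omega
              · exact ⟨by omega, hc⟩
              · omega
            rw [dif_pos hjk', dif_pos hjk, this.2, one_mul]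
            refine congrArg a (Fin.ext ?_)
            change d - j - 1 = j - 1
            rw [this.1]
          · rw [dif_neg hjk', dif_pos hjk, dif_pos hjk]
        · by_cases hjk' : d - j - 1 < k
          · rw [dif_pos hjk', dif_neg hjk, dif_pos hjk', ← mul_assoc, hc, one_mul]
          · rw [dif_neg hjk', dif_neg hjk, dif_neg hjk, dif_neg hjk', mul_zero]
      refine ⟨⟨u, ?_, hdeg', ?_⟩, ?_⟩
      · rw [Monic, leadingCoeff, hdeg', hud]
      · intro j hj
        rw [hcoeff, hcoeff, if_pos hj, if_pos (Nat.sub_le _ _), hsym j hj]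
      · funext j
        have hj := j.2
        change u.coeff (j + 1) = a j
        rw [hcoeff, if_pos (by omega)]
        simp only [w, if_neg (Nat.succ_ne_zero (j : ℕ)), if_neg (show (j : ℕ) + 1 ≠ d by omega),
          Nat.add_sub_cancel, dif_pos hj, Fin.eta]
  have hfin : Finite (selfRecSet F d c) := Finite.of_injective e he.1
  refine ⟨Set.toFinite _, ?_⟩
  rw [← Nat.card_coe_set_eq, Nat.card_congr (Equiv.ofBijective e he), Nat.card_fun,
    Nat.card_eq_fintype_card (α := Fin k), Fintype.card_fin]

/-- The sign character on `{1, -1}`. -/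
noncomputable def signChar (F : Type*) [Field F] (x : F) : ℚ := open Classical in if x = 1 then 1 else -1

lemma prod_sign {ι : Type*} (h2 : (2 : F) ≠ 0) (s : Finset ι) (x : ι → F)
    (hx : ∀ i ∈ s, x i = 1 ∨ x i = -1) (e : ι → ℕ) :
    (∏ i ∈ s, x i ^ e i = 1 ∨ ∏ i ∈ s, x i ^ e i = -1) ∧
      signChar F (∏ i ∈ s, x i ^ e i) = ∏ i ∈ s, signChar F (x i) ^ e i := by
  classical
  have hne : (-1 : F) ≠ 1 := by
    intro h
    exact h2 (by linear_combination -h)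
  have s1 : signChar F 1 = 1 := by simp [signChar]
  have sm : signChar F (-1) = -1 := by simp [signChar, hne]
  have hmul : ∀ a b : F, (a = 1 ∨ a = -1) → (b = 1 ∨ b = -1) →
      (a * b = 1 ∨ a * b = -1) ∧ signChar F (a * b) = signChar F a * signChar F b := by
    rintro a b (rfl | rfl) (rfl | rfl) <;> simp [s1, sm]
  have hpow : ∀ a : F, (a = 1 ∨ a = -1) → ∀ k : ℕ,
      (a ^ k = 1 ∨ a ^ k = -1) ∧ signChar F (a ^ k) = signChar F a ^ k := by
    intro a ha k
    induction k with
    | zero => simp [s1]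
    | succ k ih =>
      have := hmul _ _ ih.1 ha
      rw [pow_succ, pow_succ, ← ih.2]
      exact this
  induction s using Finset.induction_on with
  | empty => simp [s1]
  | insert i s hi ih =>
    have ih' := ih fun j hj => hx j (Finset.mem_insert_of_mem hj)
    have hp := hpow _ (hx i (Finset.mem_insert_self _ _)) (e i)
    rw [Finset.prod_insert hi, Finset.prod_insert hi, ← hp.2, ← ih'.2]
    exact hmul _ _ hp.1 ih'.1

-- On ±1, the indicator of 1 is half the sum of the trivial and the sign character; the sum of each
-- character over a product set factors.
open Classical in
lemma card_filter_prod_sign {ι α : Type*} [Fintype ι] [DecidableEq ι] (h2 : (2 : F) ≠ 0)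
    (t : ι → Finset α) (x : α → F) (hx : ∀ i, ∀ u ∈ t i, x u = 1 ∨ x u = -1) (e : ι → ℕ) :
    (((Fintype.piFinset t).filter fun u => ∏ i, x (u i) ^ e i = 1).card : ℚ) =
      (∏ i, ((t i).card : ℚ) + ∏ i, ∑ u ∈ t i, signChar F (x u) ^ e i) / 2 := by
  have hne : (-1 : F) ≠ 1 := by
    intro h
    exact h2 (by linear_combination -h)
  have h1 : ∏ i, ((t i).card : ℚ) = ∑ u ∈ Fintype.piFinset t, (1 : ℚ) := by
    rw [Finset.sum_const, Fintype.card_piFinset]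
    simp
  rw [h1, Finset.prod_univ_sum, ← Finset.sum_add_distrib, Finset.sum_div, Finset.card_filter]
  push_cast
  refine Finset.sum_congr rfl fun u hu => ?_
  have hp := prod_sign h2 Finset.univ (fun i => x (u i))
    (fun i _ => hx i _ (Fintype.mem_piFinset.1 hu i)) e
  rw [← hp.2]
  rcases hp.1 with h | h
  · rw [h]
    simp [signChar]
  · rw [h]
    simp [signChar, hne]

/-- The sets with u(0) = 1 and u(0) = -1 have q^k and q^l elements; the cardinality is the sum of
these and the sign sum is their difference. For even d, l = k - 1; for odd d, l = k and the signs
cancel. -/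
lemma exists_finset_self_reciprocal [Finite F] (h2 : (2 : F) ≠ 0) (hq : Odd (Nat.card F))
    {d : ℕ} (hd : 1 ≤ d) :
    ∃ t : Finset F[X],
      (∀ u, u ∈ t ↔ u.Monic ∧ u.natDegree = d ∧ u.coeff 0 ≠ 0 ∧ recip u = u) ∧
      (∀ u ∈ t, u.coeff 0 = 1 ∨ u.coeff 0 = -1) ∧
      (t.card : ℚ) = selfReciprocalCount (Nat.card F) d ∧
      ∑ u ∈ t, signChar F (u.coeff 0) =
        if Even d then ((Nat.card F : ℚ) - 1) * (Nat.card F : ℚ) ^ (d / 2 - 1) else 0 := by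
  classical
  have hne : (-1 : F) ≠ 1 := by
    intro h
    exact h2 (by linear_combination -h)
  have hqe : ¬ Even (Nat.card F) := Nat.not_even_iff_odd.2 hq
  have main : ∀ k l : ℕ,
      ((selfRecSet F d (1 : F)).Finite ∧ (selfRecSet F d (1 : F)).ncard = Nat.card F ^ k) →
      ((selfRecSet F d (-1 : F)).Finite ∧ (selfRecSet F d (-1 : F)).ncard = Nat.card F ^ l) →
      ∃ t : Finset F[X],
      (∀ u, u ∈ t ↔ u.Monic ∧ u.natDegree = d ∧ u.coeff 0 ≠ 0 ∧ recip u = u) ∧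
      (∀ u ∈ t, u.coeff 0 = 1 ∨ u.coeff 0 = -1) ∧
      (t.card : ℚ) = (Nat.card F : ℚ) ^ k + (Nat.card F : ℚ) ^ l ∧
      ∑ u ∈ t, signChar F (u.coeff 0) = (Nat.card F : ℚ) ^ k - (Nat.card F : ℚ) ^ l := by
    rintro k l ⟨f1, c1⟩ ⟨f2, c2⟩
    rw [Set.ncard_eq_toFinset_card _ f1] at c1
    rw [Set.ncard_eq_toFinset_card _ f2] at c2
    have hdisj : Disjoint f1.toFinset f2.toFinset := by
      rw [Finset.disjoint_left]
      intro u hu hu'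
      rw [Set.Finite.mem_toFinset] at hu hu'
      exact hne ((coeff_zero_of_mem_selfRecSet hu').symm.trans (coeff_zero_of_mem_selfRecSet hu))
    refine ⟨f1.toFinset ∪ f2.toFinset, fun u => ?_, fun u hu => ?_, ?_, ?_⟩
    · rw [selfRecSet_iff, Finset.mem_union, Set.Finite.mem_toFinset, Set.Finite.mem_toFinset]
    · rw [Finset.mem_union, Set.Finite.mem_toFinset, Set.Finite.mem_toFinset] at hu
      exact hu.imp coeff_zero_of_mem_selfRecSet coeff_zero_of_mem_selfRecSet
    · rw [Finset.card_union_of_disjoint hdisj, c1, c2]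
      push_cast
      rfl
    · rw [Finset.sum_union hdisj]
      have e1 : ∑ u ∈ f1.toFinset, signChar F (u.coeff 0) = f1.toFinset.card := by
        rw [Finset.card_eq_sum_ones]
        push_cast
        refine Finset.sum_congr rfl fun u hu => ?_
        rw [coeff_zero_of_mem_selfRecSet ((Set.Finite.mem_toFinset _).1 hu)]
        simp [signChar]
      have e2 : ∑ u ∈ f2.toFinset, signChar F (u.coeff 0) = -f2.toFinset.card := by
        rw [Finset.card_eq_sum_ones]
        push_cast
        rw [← Finset.sum_neg_distrib]
        refine Finset.sum_congr rfl fun u hu => ?_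
        rw [coeff_zero_of_mem_selfRecSet ((Set.Finite.mem_toFinset _).1 hu)]
        simp [signChar, hne]
      rw [e1, e2, c1, c2]
      push_cast
      ring
  by_cases hde : Even d
  · obtain ⟨k, hk⟩ := hde
    obtain ⟨t, ht1, ht2, ht3, ht4⟩ := main k (k - 1)
      (ncard_selfRecSet h2 hd (by ring) (Or.inr (Or.inl ⟨by omega, rfl⟩)))
      (ncard_selfRecSet h2 hd (by ring) (Or.inr (Or.inr ⟨by omega, rfl⟩)))
    have hde : Even d := ⟨k, hk⟩
    have hkd : d / 2 = k := by omega
    have hp : (Nat.card F : ℚ) ^ k = (Nat.card F : ℚ) * (Nat.card F : ℚ) ^ (k - 1) := by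
      rw [← pow_succ', Nat.sub_add_cancel (by omega)]
    refine ⟨t, ht1, ht2, ?_, ?_⟩
    · rw [ht3, selfReciprocalCount, if_neg hqe, if_pos hde, hkd, hp]
      push_cast
      ring
    · rw [ht4, if_pos hde, hkd, hp]
      ring
  · have hdo := Nat.not_even_iff_odd.1 hde
    obtain ⟨k, hk⟩ := hdo
    obtain ⟨t, ht1, ht2, ht3, ht4⟩ := main k k
      (ncard_selfRecSet h2 hd (by ring) (Or.inl hk))
      (ncard_selfRecSet h2 hd (by ring) (Or.inl hk))
    have hkd : (d - 1) / 2 = k := by omega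
    refine ⟨t, ht1, ht2, ?_, ?_⟩
    · rw [ht3, selfReciprocalCount, if_neg hqe, if_neg hde, hkd]
      push_cast
      ring
    · rw [ht4, if_neg hde, sub_self]

/-- All three cases of sl_ν are half the sum of two products. The factors of the second are the sums
of u(0)^i over self-reciprocal u of degree n_i: the full count for even i, and 0 when both i and n_i
are odd. -/
lemma slNum_eq_of_odd {q : ℕ} (hq : Odd q) {n : ℕ} (ν : n.Partition) :
    slNum q ν = (∏ i ∈ partSet ν, (selfReciprocalCount q (mult ν i) : ℚ) +
      ∏ i ∈ partSet ν, if Even i then (selfReciprocalCount q (mult ν i) : ℚ) else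
        if Even (mult ν i) then ((q : ℚ) - 1) * (q : ℚ) ^ (mult ν i / 2 - 1) else 0) / 2 := by
  classical
  have hqe : ¬ Even q := Nat.not_even_iff_odd.2 hq
  have hmem : ∀ i, i ∈ partSet ν ↔ mult ν i ≠ 0 := by
    intro i
    rw [partSet, Multiset.mem_toFinset, mult, Multiset.count_ne_zero]
  rw [slNum]
  split_ifs with ha hb
  · have ha' := ha.resolve_left hqe
    have : ∀ i ∈ partSet ν, (if Even i then (selfReciprocalCount q (mult ν i) : ℚ) else
        if Even (mult ν i) then ((q : ℚ) - 1) * (q : ℚ) ^ (mult ν i / 2 - 1) else 0) =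
        selfReciprocalCount q (mult ν i) := by
      intro i hi
      rw [if_pos]
      by_contra hie
      exact (hmem i).1 hi (ha' i (Nat.not_even_iff_odd.1 hie))
    rw [Finset.prod_congr rfl this]
    ring
  · obtain ⟨i, hi⟩ := hb
    rw [Nat.odd_mul] at hi
    have hi' : i ∈ partSet ν := (hmem i).2 fun h => by simp [h] at hi
    rw [Finset.prod_eq_zero (s := partSet ν) (f := fun i => if Even i then _ else _) hi']
    · ring
    · rw [if_neg (Nat.not_even_iff_odd.2 hi.1), if_neg (Nat.not_even_iff_odd.2 hi.2)]
  · have hb' : ∀ i, ¬ Even i → Even (mult ν i) := by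
      intro i hi
      by_contra h
      exact hb ⟨i, Nat.odd_mul.2 ⟨Nat.not_even_iff_odd.1 hi, Nat.not_even_iff_odd.1 h⟩⟩
    have hfil : (partSet ν).filter (fun i => Odd i) = (partSet ν).filter (fun i => ¬ Even i) :=
      Finset.filter_congr fun i _ => Nat.not_even_iff_odd.symm
    have e1 : ∏ i ∈ partSet ν, (selfReciprocalCount q (mult ν i) : ℚ) =
        (∏ i ∈ (partSet ν).filter (fun i => Even i), (selfReciprocalCount q (mult ν i) : ℚ)) *
        (((q : ℚ) + 1) ^ ((partSet ν).filter (fun i => ¬ Even i)).card *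
          ∏ i ∈ (partSet ν).filter (fun i => ¬ Even i), (q : ℚ) ^ (mult ν i / 2 - 1)) := by
      rw [← Finset.prod_filter_mul_prod_filter_not (partSet ν) (fun i => Even i),
        ← Finset.prod_const, ← Finset.prod_mul_distrib]
      congr 1
      refine Finset.prod_congr rfl fun i hi => ?_
      rw [selfReciprocalCount, if_neg hqe, if_pos (hb' i (Finset.mem_filter.1 hi).2)]
      push_cast
      rfl
    have e2 : (∏ i ∈ partSet ν, if Even i then (selfReciprocalCount q (mult ν i) : ℚ) else
        if Even (mult ν i) then ((q : ℚ) - 1) * (q : ℚ) ^ (mult ν i / 2 - 1) else 0) =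
        (∏ i ∈ (partSet ν).filter (fun i => Even i), (selfReciprocalCount q (mult ν i) : ℚ)) *
        (((q : ℚ) - 1) ^ ((partSet ν).filter (fun i => ¬ Even i)).card *
          ∏ i ∈ (partSet ν).filter (fun i => ¬ Even i), (q : ℚ) ^ (mult ν i / 2 - 1)) := by
      rw [← Finset.prod_filter_mul_prod_filter_not (partSet ν) (fun i => Even i),
        ← Finset.prod_const, ← Finset.prod_mul_distrib]
      congr 1
      · exact Finset.prod_congr rfl fun i hi => if_pos (Finset.mem_filter.1 hi).2
      · refine Finset.prod_congr rfl fun i hi => ?_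
        rw [if_neg (Finset.mem_filter.1 hi).2, if_pos (hb' i (Finset.mem_filter.1 hi).2)]
    rw [e1, e2, fNum, hfil]
    ring

open Classical in
lemma exists_selfReciprocal_family [Finite F] (h2 : (2 : F) ≠ 0) (hq : Odd (Nat.card F))
    {n : ℕ} (ν : n.Partition) :
    ∃ T : Finset (partSet ν → F[X]),
      (∀ u, u ∈ T ↔ (∀ i, (u i).Monic ∧ (u i).natDegree = mult ν i ∧ (u i).coeff 0 ≠ 0 ∧
        recip (u i) = u i) ∧ ∏ i, (u i).coeff 0 ^ (i : ℕ) = 1) ∧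
      (T.card : ℚ) = slNum (Nat.card F) ν := by
  have hmem : ∀ i : partSet ν, 1 ≤ mult ν i := by
    intro i
    exact Multiset.count_pos.2 (Multiset.mem_toFinset.1 i.2)
  choose t ht1 ht2 ht3 ht4 using fun i : partSet ν =>
    exists_finset_self_reciprocal (F := F) h2 hq (hmem i)
  refine ⟨(Fintype.piFinset t).filter fun u => ∏ i, (u i).coeff 0 ^ (i : ℕ) = 1, fun u => ?_, ?_⟩
  · rw [Finset.mem_filter, Fintype.mem_piFinset]
    exact and_congr_left fun _ => forall_congr' fun i => ht1 i _
  · rw [card_filter_prod_sign h2 t (fun u => u.coeff 0) ht2 (fun i => (i : ℕ)), slNum_eq_of_odd hq,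
      ← Finset.prod_coe_sort (partSet ν), ← Finset.prod_coe_sort (partSet ν)]
    congr 2
    · exact Finset.prod_congr rfl fun i _ => ht3 i
    · refine Finset.prod_congr rfl fun i _ => ?_
      have hs : ∀ x : F, signChar F x = 1 ∨ signChar F x = -1 := by
        intro x
        rw [signChar]
        split_ifs <;> simp
      -- For even i the i-th power of a sign is 1 and the sum is a cardinality; for odd i it is the
      -- sign sum itself.
      by_cases hi : Even (i : ℕ)
      · rw [if_pos hi, ← ht3 i, Finset.card_eq_sum_ones]
        push_cast
        refine Finset.sum_congr rfl fun u _ => ?_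
        rcases hs (u.coeff 0) with h | h <;> simp [h, hi.neg_one_pow]
      · rw [if_neg hi, ← ht4 i]
        refine Finset.sum_congr rfl fun u _ => ?_
        rcases hs (u.coeff 0) with h | h <;>
          simp [h, (Nat.not_even_iff_odd.1 hi).neg_one_pow]

end SelfReciprocalCount

/-! ### Regrouping elementary divisors by exponent. -/

section PolyPart

variable {F : Type*} [Field F]

/-- The product of all `p` with `(p, i)` in the multiset. -/
noncomputable def polyPart (S : Multiset (F[X] × ℕ)) (i : ℕ) : F[X] :=
  (S.map fun x => if x.2 = i then x.1 else 1).prod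

lemma polyPart_zero (i : ℕ) : polyPart (0 : Multiset (F[X] × ℕ)) i = 1 := rfl

lemma polyPart_cons (x : F[X] × ℕ) (S : Multiset (F[X] × ℕ)) (i : ℕ) :
    polyPart (x ::ₘ S) i = (if x.2 = i then x.1 else 1) * polyPart S i := by
  rw [polyPart, Multiset.map_cons, Multiset.prod_cons, polyPart]

lemma polyPart_sum {ι : Type*} (s : Finset ι) (S : ι → Multiset (F[X] × ℕ)) (i : ℕ) :
    polyPart (∑ j ∈ s, S j) i = ∏ j ∈ s, polyPart (S j) i := by
  classical
  induction s using Finset.induction_on with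
  | empty => rfl
  | insert a s ha ih =>
    rw [Finset.sum_insert ha, Finset.prod_insert ha, ← ih, polyPart, Multiset.map_add,
      Multiset.prod_add, polyPart, polyPart]

lemma polyPart_map_pair (R : Multiset F[X]) (i j : ℕ) :
    polyPart (R.map fun p => (p, j)) i = if j = i then R.prod else 1 := by
  rw [polyPart, Multiset.map_map]
  split_ifs with h
  · simp [h]
  · simp [h]

lemma monic_polyPart {S : Multiset (F[X] × ℕ)} (hS : ∀ x ∈ S, IsBlock x) (i : ℕ) :
    (polyPart S i).Monic := by
  refine monic_multiset_prod_of_monic _ _ fun x hx => ?_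
  split_ifs
  · exact (hS x hx).1
  · exact monic_one

lemma polyPart_map_recipBlock (S : Multiset (F[X] × ℕ)) (i : ℕ) :
    polyPart (S.map recipBlock) i = recip (polyPart S i) := by
  induction S using Multiset.induction_on with
  | empty => rw [Multiset.map_zero, polyPart_zero, recip_one]
  | cons x S ih =>
    rw [Multiset.map_cons, polyPart_cons, polyPart_cons, ih, recip_mul, recipBlock]
    split_ifs
    · rfl
    · rw [recip_one]

lemma coeff_zero_polyPart (S : Multiset (F[X] × ℕ)) (i : ℕ) :
    (polyPart S i).coeff 0 = (S.map fun x => if x.2 = i then x.1.coeff 0 else 1).prod := by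
  induction S using Multiset.induction_on with
  | empty => simp [polyPart_zero]
  | cons x S ih =>
    rw [polyPart_cons, mul_coeff_zero, ih, Multiset.map_cons, Multiset.prod_cons]
    split_ifs
    · rfl
    · rw [coeff_one_zero]

lemma coeff_zero_polyPart_ne_zero {S : Multiset (F[X] × ℕ)} (hS : ∀ x ∈ S, IsBlock x) (i : ℕ) :
    (polyPart S i).coeff 0 ≠ 0 := by
  rw [coeff_zero_polyPart]
  refine Multiset.prod_ne_zero fun h => ?_
  obtain ⟨x, hx, h⟩ := Multiset.mem_map.1 h
  split_ifs at h
  · exact (hS x hx).2.2.1 h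
  · exact one_ne_zero h

/-- The multiset containing `e` exactly `deg p` times for each `(p, e)`. -/
def blockParts (S : Multiset (F[X] × ℕ)) : Multiset ℕ :=
  S.bind fun x => Multiset.replicate x.1.natDegree x.2

lemma count_blockParts {S : Multiset (F[X] × ℕ)} (hS : ∀ x ∈ S, IsBlock x) (i : ℕ) :
    (blockParts S).count i = (polyPart S i).natDegree := by
  induction S using Multiset.induction_on with
  | empty => simp [polyPart_zero, blockParts]
  | cons x S ih =>
    have hS' : ∀ y ∈ S, IsBlock y := fun y hy => hS y (Multiset.mem_cons_of_mem hy)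
    have hm := monic_polyPart hS' i
    rw [blockParts, Multiset.cons_bind, Multiset.count_add, Multiset.count_replicate,
      polyPart_cons]
    rw [blockParts] at ih
    split_ifs
    · rw [(hS x (Multiset.mem_cons_self _ _)).1.natDegree_mul hm, ih hS']
    · rw [one_mul, zero_add, ih hS']

lemma sum_blockParts (S : Multiset (F[X] × ℕ)) :
    (blockParts S).sum = (S.map fun x => x.2 * x.1.natDegree).sum := by
  rw [blockParts, Multiset.sum_bind]
  simp only [Multiset.sum_replicate, smul_eq_mul, mul_comm]

lemma IsBlock.natDegree_pos {x : F[X] × ℕ} (hx : IsBlock x) : 0 < x.1.natDegree :=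
  hx.2.1.natDegree_pos

lemma mem_blockParts {S : Multiset (F[X] × ℕ)} (hS : ∀ x ∈ S, IsBlock x) {i : ℕ} :
    i ∈ blockParts S ↔ ∃ x ∈ S, x.2 = i := by
  rw [blockParts, Multiset.mem_bind]
  refine exists_congr fun x => and_congr_right fun hx => ?_
  rw [Multiset.mem_replicate]
  exact ⟨fun h => h.2.symm, fun h => ⟨(hS x hx).natDegree_pos.ne', h.symm⟩⟩

lemma gcd_blockParts {S : Multiset (F[X] × ℕ)} (hS : ∀ x ∈ S, IsBlock x) :
    (blockParts S).gcd = (S.map Prod.snd).gcd := by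
  apply Nat.dvd_antisymm
  · refine Multiset.dvd_gcd.2 fun i hi => Multiset.gcd_dvd ?_
    obtain ⟨x, hx, rfl⟩ := Multiset.mem_map.1 hi
    exact (mem_blockParts hS).2 ⟨x, hx, rfl⟩
  · refine Multiset.dvd_gcd.2 fun i hi => Multiset.gcd_dvd ?_
    obtain ⟨x, hx, rfl⟩ := (mem_blockParts hS).1 hi
    exact Multiset.mem_map_of_mem _ hx

-- Unique factorisation: the products over all p with a given exponent recover the multiset of
-- blocks.
open Classical in
lemma count_normalizedFactors_polyPart {S : Multiset (F[X] × ℕ)} (hS : ∀ x ∈ S, IsBlock x)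
    (p : F[X]) (i : ℕ) :
    (UniqueFactorizationMonoid.normalizedFactors (polyPart S i)).count p = S.count (p, i) := by
  induction S using Multiset.induction_on with
  | empty => simp [polyPart_zero]
  | cons x S ih =>
    have hS' : ∀ y ∈ S, IsBlock y := fun y hy => hS y (Multiset.mem_cons_of_mem hy)
    have hm := (monic_polyPart hS' i).ne_zero
    have hx := hS x (Multiset.mem_cons_self _ _)
    rw [polyPart_cons, Multiset.count_cons, ← ih hS']
    split_ifs with h1 h2 h2
    · rw [UniqueFactorizationMonoid.normalizedFactors_mul hx.1.ne_zero hm,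
        UniqueFactorizationMonoid.normalizedFactors_irreducible hx.2.1, hx.1.normalize_eq_self,
        Multiset.count_add, Multiset.count_singleton, if_pos (congrArg Prod.fst h2), add_comm]
    · rw [UniqueFactorizationMonoid.normalizedFactors_mul hx.1.ne_zero hm,
        UniqueFactorizationMonoid.normalizedFactors_irreducible hx.2.1, hx.1.normalize_eq_self,
        Multiset.count_add, Multiset.count_singleton, if_neg, add_comm]
      rintro rfl
      exact h2 (Prod.ext rfl h1.symm)
    · exact absurd (congrArg Prod.snd h2).symm h1
    · rw [one_mul, add_zero]

lemma eq_of_polyPart_eq {S T : Multiset (F[X] × ℕ)} (hS : ∀ x ∈ S, IsBlock x)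
    (hT : ∀ x ∈ T, IsBlock x) (h : ∀ i, polyPart S i = polyPart T i) : S = T := by
  classical
  refine Multiset.ext.2 fun x => ?_
  rw [← Prod.mk.eta (p := x), ← count_normalizedFactors_polyPart hS,
    ← count_normalizedFactors_polyPart hT, h]

lemma map_recipBlock_eq_iff {S : Multiset (F[X] × ℕ)} (hS : ∀ x ∈ S, IsBlock x) :
    S.map recipBlock = S ↔ ∀ i, recip (polyPart S i) = polyPart S i := by
  constructor
  · intro h i
    rw [← polyPart_map_recipBlock, h]
  · intro h
    refine eq_of_polyPart_eq (fun x hx => ?_) hS fun i => by rw [polyPart_map_recipBlock, h]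
    obtain ⟨y, hy, rfl⟩ := Multiset.mem_map.1 hx
    exact (hS y hy).recip

lemma polyPart_eq_one_of_notMem {S : Multiset (F[X] × ℕ)} (hS : ∀ x ∈ S, IsBlock x) {i : ℕ}
    (hi : i ∉ blockParts S) : polyPart S i = 1 := by
  rw [← (monic_polyPart hS i).natDegree_eq_zero, ← count_blockParts hS,
    Multiset.count_eq_zero.2 hi]

lemma prod_coeff_zero_polyPart (S : Multiset (F[X] × ℕ)) (s : Finset ℕ) (hs : ∀ x ∈ S, x.2 ∈ s) :
    ∏ i ∈ s, (polyPart S i).coeff 0 ^ i = (S.map fun x => x.1.coeff 0 ^ x.2).prod := by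
  induction S using Multiset.induction_on with
  | empty => simp [polyPart_zero]
  | cons x S ih =>
    rw [Multiset.map_cons, Multiset.prod_cons,
      ← ih fun y hy => hs y (Multiset.mem_cons_of_mem hy)]
    simp only [polyPart_cons, mul_coeff_zero, mul_pow, Finset.prod_mul_distrib]
    congr 1
    rw [Finset.prod_eq_single x.2]
    · rw [if_pos rfl]
    · intro b _ hb
      rw [if_neg hb.symm, coeff_one_zero, one_pow]
    · intro h
      exact absurd (hs x (Multiset.mem_cons_self _ _)) h

lemma prod_neg_one_pow_mul (S : Multiset (F[X] × ℕ)) :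
    (S.map fun x => ((-1) ^ x.1.natDegree * x.1.coeff 0) ^ x.2).prod =
      (-1) ^ (S.map fun x => x.2 * x.1.natDegree).sum *
        (S.map fun x => x.1.coeff 0 ^ x.2).prod := by
  induction S using Multiset.induction_on with
  | empty => simp
  | cons x S ih =>
    rw [Multiset.map_cons, Multiset.prod_cons, ih, Multiset.map_cons, Multiset.sum_cons,
      Multiset.map_cons, Multiset.prod_cons, mul_pow, pow_add, ← pow_mul]
    ring

/-- A family of self-reciprocal polynomials indexed by the parts of a partition comes from a
multiset of blocks. -/
lemma exists_polyPart_eq {n : ℕ} (ν : n.Partition) (u : partSet ν → F[X])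
    (hu : ∀ i, (u i).Monic ∧ (u i).natDegree = mult ν i ∧ (u i).coeff 0 ≠ 0) :
    ∃ S : Multiset (F[X] × ℕ), (∀ x ∈ S, IsBlock x) ∧ blockParts S = ν.parts ∧
      ∀ i : partSet ν, polyPart S i = u i := by
  classical
  let S : Multiset (F[X] × ℕ) := ∑ i : partSet ν,
    (UniqueFactorizationMonoid.normalizedFactors (u i)).map fun p => (p, (i : ℕ))
  have hS : ∀ x ∈ S, IsBlock x := by
    intro x hx
    obtain ⟨i, -, hi⟩ := Multiset.mem_sum.1 hx
    obtain ⟨p, hp, rfl⟩ := Multiset.mem_map.1 hi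
    rw [Polynomial.mem_normalizedFactors_iff (hu i).1.ne_zero] at hp
    refine ⟨hp.2.1, hp.1, fun h0 => (hu i).2.2 ?_, ν.parts_pos (Multiset.mem_toFinset.1 i.2)⟩
    obtain ⟨r, hr⟩ := hp.2.2
    rw [hr, mul_coeff_zero, h0, zero_mul]
  have hprod : ∀ i, (UniqueFactorizationMonoid.normalizedFactors (u i)).prod = u i := by
    intro i
    rw [UniqueFactorizationMonoid.prod_normalizedFactors_eq (hu i).1.ne_zero,
      (hu i).1.normalize_eq_self]
  have hpart : ∀ j, polyPart S j = ∏ i : partSet ν, if (i : ℕ) = j then u i else 1 := by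
    intro j
    rw [polyPart_sum]
    refine Finset.prod_congr rfl fun i _ => ?_
    rw [polyPart_map_pair, hprod]
  have hpart' : ∀ i : partSet ν, polyPart S (i : ℕ) = u i := by
    intro i
    rw [hpart, Finset.prod_eq_single i]
    · rw [if_pos rfl]
    · intro j _ hj
      rw [if_neg fun h => hj (Subtype.ext h)]
    · intro h
      exact absurd (Finset.mem_univ i) h
  refine ⟨S, hS, Multiset.ext.2 fun j => ?_, hpart'⟩
  rw [count_blockParts hS]
  by_cases hj : j ∈ partSet ν
  · have := hpart' ⟨j, hj⟩
    rw [this, (hu _).2.1, mult]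
  · rw [hpart, Finset.prod_eq_one, natDegree_one, Multiset.count_eq_zero.2]
    · exact fun h => hj (Multiset.mem_toFinset.2 h)
    · intro i _
      rw [if_neg]
      rintro rfl
      exact hj i.2

end PolyPart

/-! ### Real classes of SL_n as a sum over partitions. -/

section Counting

variable {F : Type*} [Field F] {n : ℕ}

/-- The partition recording the sizes of the elementary divisors over an algebraic closure. -/
noncomputable def typePartition (g : GL (Fin n) F) : n.Partition where
  parts := blockParts (elemDivisors g)
  parts_pos := by
    intro i hi
    obtain ⟨x, hx, rfl⟩ := (mem_blockParts fun _ => isBlock_of_mem_elemDivisors).1 hi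
    exact (isBlock_of_mem_elemDivisors hx).2.2.2
  parts_sum := by rw [sum_blockParts, sum_elemDivisors]

lemma hNum_typePartition (q : ℕ) (g : GL (Fin n) F) :
    hNum q (typePartition g) = Nat.gcd (q - 1) ((elemDivisors g).map Prod.snd).gcd := by
  rw [hNum, typePartition, gcd_blockParts fun _ => isBlock_of_mem_elemDivisors]

lemma natDegree_polyPart_elemDivisors (g : GL (Fin n) F) (i : ℕ) :
    (polyPart (elemDivisors g) i).natDegree = mult (typePartition g) i :=
  (count_blockParts (fun _ => isBlock_of_mem_elemDivisors) i).symm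

/-- The block p^e contributes ((-1)^(deg p) p(0))^e to the determinant; the signs multiply to
(-1)^n, which is 1 for even n. -/
lemma det_eq_one_iff (hn : Even n) (g : GL (Fin n) F) :
    Matrix.GeneralLinearGroup.det g = 1 ↔
      ∏ i : partSet (typePartition g), (polyPart (elemDivisors g) i).coeff 0 ^ (i : ℕ) = 1 := by
  rw [Finset.prod_coe_sort (partSet (typePartition g))
    fun i => (polyPart (elemDivisors g) i).coeff 0 ^ i, prod_coeff_zero_polyPart,
    ← Units.val_inj, Matrix.GeneralLinearGroup.val_det_apply, det_eq_prod_elemDivisors,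
    prod_neg_one_pow_mul, sum_elemDivisors, hn.neg_one_pow, one_mul, Units.val_one]
  intro x hx
  exact Multiset.mem_toFinset.2
    ((mem_blockParts fun _ => isBlock_of_mem_elemDivisors).2 ⟨x, hx, rfl⟩)

lemma elemDivisors_out_mk (g : GL (Fin n) F) :
    elemDivisors (ConjClasses.mk g).out = elemDivisors g :=
  isConj_iff_elemDivisors_eq.1 (ConjClasses.mk_eq_mk_iff_isConj.1 (Quotient.out_eq _))

lemma elemDivisors_out_injective : Function.Injective
    fun c : ConjClasses (GL (Fin n) F) => elemDivisors c.out := by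
  intro c c' h
  rw [← Quotient.out_eq c, ← Quotient.out_eq c']
  exact ConjClasses.mk_eq_mk_iff_isConj.2 (isConj_iff_elemDivisors_eq.2 h)

-- A class corresponds to its family (u_i), with u_i the product of all p of exponent i. Factoring
-- the u_i reconstructs the blocks, reality becomes self-reciprocity of every u_i, and det = 1
-- becomes ∏ u_i(0)^i = 1.
open Classical in
lemma card_filter_typePartition [Finite F] [Fintype (ConjClasses (GL (Fin n) F))]
    (h2 : (2 : F) ≠ 0) (hq : Odd (Nat.card F)) (hn : Even n) (ν : n.Partition) :
    ((Finset.univ.filter fun c : ConjClasses (GL (Fin n) F) => typePartition c.out = ν ∧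
      (elemDivisors c.out).map recipBlock = elemDivisors c.out ∧
        Matrix.GeneralLinearGroup.det c.out = 1).card : ℚ) = slNum (Nat.card F) ν := by
  obtain ⟨T, hT, hcard⟩ := exists_selfReciprocal_family h2 hq ν
  rw [← hcard]
  congr 1
  refine Finset.card_bij (fun c _ i => polyPart (elemDivisors c.out) i) ?_ ?_ ?_
  · intro c hc
    obtain ⟨-, rfl, hr, hd⟩ := Finset.mem_filter.1 hc
    have hS : ∀ x ∈ elemDivisors c.out, IsBlock x := fun _ => isBlock_of_mem_elemDivisors
    refine (hT _).2 ⟨fun i => ⟨monic_polyPart hS _, natDegree_polyPart_elemDivisors _ _,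
      coeff_zero_polyPart_ne_zero hS _, (map_recipBlock_eq_iff hS).1 hr _⟩, ?_⟩
    exact (det_eq_one_iff hn _).1 hd
  · intro c hc c' hc' h
    obtain ⟨-, h1, -, -⟩ := Finset.mem_filter.1 hc
    obtain ⟨-, h1', -, -⟩ := Finset.mem_filter.1 hc'
    refine elemDivisors_out_injective (eq_of_polyPart_eq (fun _ => isBlock_of_mem_elemDivisors)
      (fun _ => isBlock_of_mem_elemDivisors) fun i => ?_)
    by_cases hi : i ∈ partSet ν
    · exact congr_fun h ⟨i, hi⟩
    · rw [polyPart_eq_one_of_notMem (fun _ => isBlock_of_mem_elemDivisors),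
        polyPart_eq_one_of_notMem (fun _ => isBlock_of_mem_elemDivisors)]
      · exact fun h => hi (Multiset.mem_toFinset.2 (h1' ▸ h))
      · exact fun h => hi (Multiset.mem_toFinset.2 (h1 ▸ h))
  · intro u hu
    obtain ⟨hu, hd⟩ := (hT u).1 hu
    obtain ⟨S, hS, hp, hSu⟩ := exists_polyPart_eq ν u fun i => ⟨(hu i).1, (hu i).2.1, (hu i).2.2.1⟩
    obtain ⟨g, hg⟩ := exists_elemDivisors_eq (n := n) hS
      (by rw [← sum_blockParts, hp, ν.parts_sum])
    have hg' : elemDivisors (ConjClasses.mk g).out = S := by rw [elemDivisors_out_mk, hg]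
    have hν : typePartition (ConjClasses.mk g).out = ν :=
      Nat.Partition.ext ((congrArg blockParts hg').trans hp)
    refine ⟨ConjClasses.mk g, Finset.mem_filter.2 ⟨Finset.mem_univ _, hν, ?_, ?_⟩, ?_⟩
    · rw [hg', map_recipBlock_eq_iff hS]
      intro i
      by_cases hi : i ∈ partSet ν
      · rw [hSu ⟨i, hi⟩, (hu _).2.2.2]
      · rw [polyPart_eq_one_of_notMem hS, recip_one]
        rw [hp]
        exact fun h => hi (Multiset.mem_toFinset.2 h)
    · rw [det_eq_one_iff hn, hν, hg', ← hd]
      exact Finset.prod_congr rfl fun i _ => by rw [hSu]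
    · funext i
      rw [hg', hSu]

open Classical in
theorem ncard_realClasses_SL_eq_sum [Fintype F] (h2 : (2 : F) ≠ 0) (hq : Odd (Fintype.card F))
    (hn : 0 < n) (h4 : 4 ∣ n) :
    ((realClasses (Matrix.SpecialLinearGroup (Fin n) F)).ncard : ℚ) =
      ∑ ν : n.Partition, (hNum (Fintype.card F) ν : ℚ) * slNum (Fintype.card F) ν := by
  have : Fintype (ConjClasses (GL (Fin n) F)) := Fintype.ofFinite _
  rw [ncard_realClasses_SL hn h4, ← Finset.sum_fiberwise _ fun c => typePartition c.out]
  refine Finset.sum_congr rfl fun ν _ => ?_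
  rw [← Nat.card_eq_fintype_card] at hq ⊢
  rw [← card_filter_typePartition h2 hq ((by decide : Even 4).trans_dvd h4) ν,
    ← Finset.filter_filter, Finset.card_filter, Nat.cast_sum, Finset.mul_sum]
  refine Finset.sum_congr rfl fun c hc => ?_
  rw [← (Finset.mem_filter.1 hc).2, hNum_typePartition]
  split_ifs <;> simp

end Counting

/-! ### Square roots of the elements of Y and the main theorem. -/

section Main

/-- Let z generate `Fˣ` and q - 1 = 2Mc. Then r^M = 1 forces r = z^(2cb), and w = z^(cb) is killed
by 2M, hence by n. -/
lemma exists_mul_self_eq_of_pow_eq_one {F : Type*} [Field F] [Fintype F] (r : Fˣ) {M n : ℕ}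
    (hM : 0 < M) (hq : 2 * M ∣ Fintype.card F - 1) (hn : 2 * M ∣ n) (hr : r ^ M = 1) :
    ∃ w : Fˣ, w ^ n = 1 ∧ w * w = r := by
  obtain ⟨z, hz⟩ := IsCyclic.exists_generator (α := Fˣ)
  have hord : orderOf z = Fintype.card F - 1 := by
    classical
    rw [orderOf_eq_card_of_forall_mem_zpowers hz, Nat.card_eq_fintype_card, Fintype.card_units]
  obtain ⟨a, rfl⟩ := (mem_powers_iff_mem_zpowers (x := z)).2 (hz r)
  obtain ⟨c, hc⟩ := hq
  obtain ⟨e, rfl⟩ := hn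
  have h1 : 2 * M * c ∣ a * M := by
    rw [← hc, ← hord, orderOf_dvd_iff_pow_eq_one, pow_mul]
    exact hr
  obtain ⟨b, rfl⟩ : 2 * c ∣ a := by
    refine Nat.dvd_of_mul_dvd_mul_right hM ?_
    rwa [mul_right_comm]
  refine ⟨z ^ (c * b), ?_, ?_⟩
  · rw [← pow_mul, ← orderOf_dvd_iff_pow_eq_one, hord, hc]
    exact ⟨b * e, by ring⟩
  · rw [← pow_add]
    exact congrArg (z ^ ·) (by ring)

lemma twoPart_lt_iff {a b : ℕ} : twoPart a < twoPart b ↔ padicValNat 2 a < padicValNat 2 b :=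
  Nat.pow_lt_pow_iff_right (by norm_num)

lemma two_mul_dvd_of_padicValNat_lt {m N : ℕ} (hN : N ≠ 0) (h : m ∣ N)
    (hlt : padicValNat 2 m < padicValNat 2 N) : 2 * m ∣ N := by
  obtain ⟨t, rfl⟩ := h
  rw [padicValNat.mul (left_ne_zero_of_mul hN) (right_ne_zero_of_mul hN)] at hlt
  rw [mul_comm]
  exact mul_dvd_mul_left m (dvd_of_one_le_padicValNat (by omega))

/-- Under the hypothesis on 2-parts, the elements of `Y` are squares of central elements. -/
lemma exists_center_mul_self_eq {F : Type*} [Field F] [Fintype F] {n : ℕ}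
    {Y : Subgroup (Matrix.SpecialLinearGroup (Fin n) F)}
    (hY : Y ≤ Subgroup.center (Matrix.SpecialLinearGroup (Fin n) F))
    (h2 : twoPart (Nat.card Y) < twoPart (Nat.gcd n (Fintype.card F - 1)))
    {y : Matrix.SpecialLinearGroup (Fin n) F} (hy : y ∈ Y) :
    ∃ w ∈ Subgroup.center (Matrix.SpecialLinearGroup (Fin n) F), w * w = y := by
  have hN : Nat.gcd n (Fintype.card F - 1) ≠ 0 := by
    intro h
    have := Fintype.one_lt_card (α := F)
    have := Nat.eq_zero_of_gcd_eq_zero_right h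
    omega
  obtain ⟨r, hrn, hr⟩ := Matrix.SpecialLinearGroup.mem_center_iff.1 (hY hy)
  rw [Fintype.card_fin] at hrn
  by_cases hn : n = 0
  · subst hn
    exact ⟨1, one_mem _, Subsingleton.elim _ _⟩
  have hr0 : r ≠ 0 := by
    rintro rfl
    simp [hn] at hrn
  have hm : Nonempty (Fin n) := ⟨⟨0, Nat.pos_of_ne_zero hn⟩⟩
  have hpow : ∀ k, y ^ k = 1 ↔ Units.mk0 r hr0 ^ k = 1 := by
    intro k
    rw [← Units.val_inj, Matrix.SpecialLinearGroup.ext_iff, Matrix.ext_iff, Matrix.SpecialLinearGroup.coe_pow, ← hr, ← map_pow,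
      Matrix.SpecialLinearGroup.coe_one, ← map_one (Matrix.scalar (Fin n)),
      Matrix.scalar_inj, Units.val_pow_eq_pow_val, Units.val_mk0, Units.val_one]
  have hyN : y ^ Nat.gcd n (Fintype.card F - 1) = 1 := by
    rw [hpow, ← orderOf_dvd_iff_pow_eq_one]
    refine Nat.dvd_gcd (orderOf_dvd_of_pow_eq_one ?_) (orderOf_dvd_of_pow_eq_one ?_)
    · exact Units.ext (by simpa using hrn)
    · exact Units.ext (by simpa using FiniteField.pow_card_sub_one_eq_one r hr0)
  have hdvd : orderOf y ∣ Nat.card Y := Subgroup.orderOf_dvd_natCard Y hy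
  have hle : padicValNat 2 (orderOf y) ≤ padicValNat 2 (Nat.card Y) :=
    (padicValNat_dvd_iff_le Nat.card_pos.ne').1 (pow_padicValNat_dvd.trans hdvd)
  -- The order of y divides both |Y| and gcd(n, q - 1). The strict inequality of 2-parts leaves a
  -- spare factor 2 in the latter.
  have h2m := two_mul_dvd_of_padicValNat_lt hN (orderOf_dvd_of_pow_eq_one hyN)
    (hle.trans_lt (twoPart_lt_iff.1 h2))
  obtain ⟨w, hwn, hw⟩ := exists_mul_self_eq_of_pow_eq_one (Units.mk0 r hr0) (orderOf_pos y)
    (h2m.trans (Nat.gcd_dvd_right _ _)) (h2m.trans (Nat.gcd_dvd_left _ _))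
    ((hpow _).1 (pow_orderOf_eq_one y))
  have hwn' : (w : F) ^ n = 1 := by rw [← Units.val_pow_eq_pow_val, hwn, Units.val_one]
  have hww : (w : F) * w = r := by rw [← Units.val_mul, hw, Units.val_mk0]
  have hdet : (Matrix.scalar (Fin n) (w : F)).det = 1 := by
    rw [Matrix.scalar_apply, Matrix.det_diagonal, Finset.prod_const, Finset.card_univ,
      Fintype.card_fin, hwn']
  refine ⟨⟨Matrix.scalar (Fin n) (w : F), hdet⟩,
    Matrix.SpecialLinearGroup.mem_center_iff.2 ⟨w, by rwa [Fintype.card_fin], rfl⟩, ?_⟩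
  refine Subtype.ext (Eq.trans ?_ hr)
  change Matrix.scalar (Fin n) (w : F) * Matrix.scalar (Fin n) (w : F) = _
  rw [← hww, map_mul]

/-- If g is real modulo Y, then h g h⁻¹ = g⁻¹ w⁻² for some h and some central w, so wg is real in G.
An involution inverting wg inverts g up to w² in Y. -/
lemma IsRealElement.isStronglyRealElement_quotient {G : Type*} [Group G] (Y : Subgroup G)
    [Y.Normal] (hY : ∀ y ∈ Y, ∃ w ∈ Subgroup.center G, w * w = y)
    (hG : ∀ x : G, IsRealElement x → IsStronglyRealElement x) {x : G ⧸ Y} (hx : IsRealElement x) :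
    IsStronglyRealElement x := by
  obtain ⟨g, rfl⟩ := QuotientGroup.mk_surjective x
  obtain ⟨h, hh⟩ := hx
  obtain ⟨h, rfl⟩ := QuotientGroup.mk_surjective h
  have hy : (h * g * h⁻¹)⁻¹ * g⁻¹ ∈ Y := QuotientGroup.eq.1 hh
  obtain ⟨w, hw, hwy⟩ := hY _ hy
  have hc : ∀ k, k * w = w * k := Subgroup.mem_center_iff.1 hw
  have hreal : IsRealElement (w * g) := by
    refine ⟨h, ?_⟩
    have e1 : h * g * h⁻¹ = g⁻¹ * (w * w)⁻¹ := by
      rw [hwy]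
      group
    calc h * (w * g) * h⁻¹ = w * (h * g * h⁻¹) := by rw [← mul_assoc, hc h]; simp only [mul_assoc]
      _ = (w * g⁻¹) * (w * w)⁻¹ := by rw [e1, mul_assoc]
      _ = (w * g)⁻¹ := by rw [← hc g⁻¹]; group
  obtain ⟨t, ht2, ht⟩ := hG _ hreal
  refine ⟨(t : G ⧸ Y), ?_, ?_⟩
  · rw [← QuotientGroup.mk_pow, ht2, QuotientGroup.mk_one]
  · refine QuotientGroup.eq.2 ?_
    have e2 : w * (t * g * t⁻¹) = g⁻¹ * w⁻¹ := by
      rw [← mul_inv_rev, ← ht, ← mul_assoc t w g, hc t]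
      simp only [mul_assoc]
    have e3 : (t * g * t⁻¹)⁻¹ * g⁻¹ = w * w := by
      rw [eq_inv_mul_of_mul_eq e2, show (w⁻¹ * (g⁻¹ * w⁻¹))⁻¹ * g⁻¹ = w * (g * w) * g⁻¹ by group, hc]
      group
    rw [e3, hwy]
    exact hy

theorem mainTheorem12 {F : Type*} [Field F] [Fintype F] (n : ℕ)
    (Y : Subgroup (Matrix.SpecialLinearGroup (Fin n) F)) [Y.Normal]
    (hY : Y ≤ Subgroup.center (Matrix.SpecialLinearGroup (Fin n) F))
    (h1 : 1 < twoPart (Nat.card Y))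
    (h2 : twoPart (Nat.card Y) < twoPart (Nat.gcd n (Fintype.card F - 1))) :
    realClasses (Matrix.SpecialLinearGroup (Fin n) F ⧸ Y)
        = stronglyRealClasses (Matrix.SpecialLinearGroup (Fin n) F ⧸ Y) ∧
    ((realClasses (Matrix.SpecialLinearGroup (Fin n) F ⧸ Y)).ncard : ℚ)
        = ∑ ν : n.Partition, (hNum (Fintype.card F) ν : ℚ) * slNum (Fintype.card F) ν ∧
    (realClasses (Matrix.SpecialLinearGroup (Fin n) F ⧸ Y)).ncard
        = (realClasses (Matrix.SpecialLinearGroup (Fin n) F)).ncard := by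
  classical
  have hv1 : 1 ≤ padicValNat 2 (Nat.card Y) := by
    by_contra h
    rw [twoPart, show padicValNat 2 (Nat.card Y) = 0 by omega] at h1
    exact lt_irrefl _ h1
  -- The valuation of |Y| is at least 1 and strictly smaller than that of the gcd, which is
  -- therefore at least 2.
  have h4N : 4 ∣ Nat.gcd n (Fintype.card F - 1) :=
    (pow_dvd_pow 2 (by have := twoPart_lt_iff.1 h2; omega : 2 ≤ _)).trans pow_padicValNat_dvd
  have h4 : 4 ∣ n := h4N.trans (Nat.gcd_dvd_left _ _)
  have h4q : 4 ∣ Fintype.card F - 1 := h4N.trans (Nat.gcd_dvd_right _ _)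
  -- For n = 0 the special linear group is trivial, so |Y| would be 1.
  have hn : 0 < n := by
    rcases Nat.eq_zero_or_pos n with rfl | h
    · rw [Nat.card_of_subsingleton (1 : Y), padicValNat_one_right] at hv1
      omega
    · exact h
  have hcard := Fintype.one_lt_card (α := F)
  have hq : Odd (Fintype.card F) := by
    rw [Nat.odd_iff]
    omega
  have h2F : (2 : F) ≠ 0 := by
    intro h
    obtain ⟨k, hk⟩ := hq
    have := FiniteField.cast_card_eq_zero F
    rw [hk] at this
    push_cast at this
    rw [h, zero_mul, zero_add] at this
    exact one_ne_zero this
  have hsq : ∀ y ∈ Y, ∃ w ∈ Subgroup.center (Matrix.SpecialLinearGroup (Fin n) F), w * w = y :=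
    fun y hy => exists_center_mul_self_eq hY h2 hy
  have hcount := ncard_realClasses_quotient Y hsq
  refine ⟨Set.ext fun c => exists_congr fun g => and_congr_right fun _ => ?_, ?_, hcount⟩
  · exact ⟨IsRealElement.isStronglyRealElement_quotient Y hsq fun x hx =>
      isStronglyRealElement_of_toGL h4 ((isRealElement_toGL_iff h4 x).1 hx),
      IsStronglyRealElement.isRealElement⟩
  · rw [hcount, ncard_realClasses_SL_eq_sum h2F hq hn h4]

end Main
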